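/- Let $a>b>0$, $\lambda\in\mathbb R\setminus\{0\}$, $p^2=a^2+b^2$, $r^2=a^2-b^2$. In $\mathbb R^9(\boldsymbol\omega,\boldsymbol\alpha,\boldsymbol\beta)$ let $\mathcal P^6$ be given by $\boldsymbol\alpha\cdot\boldsymbol\alpha=a^2$, $\boldsymbol\beta\cdot\boldsymbol\beta=b^2$, $\boldsymbol\alpha\cdot\boldsymbol\beta=0$, put $\mathbf M=(2\omega_1,2\omega_2,\omega_3+\lambda)$, and consider the first integrals of the Kowalevski gyrostat in a double field $$H=\omega_1^2+\omega_2^2+\tfrac12\omega_3^2-\alpha_1-\beta_2,$$ $$K=(\omega_1^2-\omega_2^2+\alpha_1-\beta_2)^2+(2\omega_1\omega_2+\alpha_2+\beta_1)^2+2\lambda[(\omega_3-\lambda)(\omega_1^2+\omega_2^2)+2\omega_1\alpha_3+2\omega_2\beta_3],$$ $$G=\tfrac14\big[(\mathbf M\cdot\boldsymbol\alpha)^2+(\mathbf M\cdot\boldsymbol\beta)^2\big]+\tfrac12(\omega_3-\lambda)\,\mathbf M\cdot(\boldsymbol\alpha\times\boldsymbol\beta)-b^2\alpha_1-a^2\beta_2,$$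 and the integral map $J=(H,K,G):\mathcal P^6\to\mathbb R^3(h,k,g)$. For a function $F$ let $\operatorname{sgrad}F$ be the Hamiltonian field $\dot{\mathbf M}=\mathbf M\times F_{\mathbf M}+\boldsymbol\alpha\times F_{\boldsymbol\alpha}+\boldsymbol\beta\times F_{\boldsymbol\beta}$, $\dot{\boldsymbol\alpha}=\boldsymbol\alpha\times F_{\mathbf M}$, $\dot{\boldsymbol\beta}=\boldsymbol\beta\times F_{\mathbf M}$. Types. Let $x$ be a point of rank 2, i.e. $\operatorname{rank}dJ(x)=2$ on $T_x\mathcal P^6$. If $F=c_0H+c_1K+c_2G$ with $(c_0,c_1,c_2)\ne0$ satisfies $dF(x)=0$ on $T_x\mathcal P^6$, let $A_F$ be the linearization of $\operatorname{sgrad}F$ on $T_x\mathcal P^6$; if its characteristic polynomial is $\mu^4(\mu^2-C)$, then $C$ is called the square of the characteristic exponent of $F$ at $x$. The point $x$ is a center (a saddle) if some such $F$ has $C<0$ (resp. $C>0$), and is degenerate if no such $F$ has $C\neq0$. Surfaces. Let $\Pi_1,\Pi_2\subset\mathbb R^3(h,k,g)$ be the surfaces parametrized by $(h,s)$, $s\ne0$: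 $$\Pi_1:\ k=p^2+\big(h-\tfrac{\lambda^2}2\big)^2-4\big(h-\tfrac{\lambda^2}2\big)s+3s^2-\tfrac{p^4-r^4}{4s^2},\quad g=\big(h-\tfrac{\lambda^2}2-s\big)s^2+\tfrac{p^4-r^4}{4s};$$ $$\Pi_2:\ k=-2\lambda^2\big(h-\tfrac{\lambda^2}2-2s\big)-\lambda^4+\tfrac{r^4}{4s^2},\quad g=\tfrac12p^2\big(h+\tfrac{\lambda^2}2\big)-\lambda^2s^2-\tfrac{r^4}{4s}.$$ The cuspidal edge of $\Pi_2$ is the set of its points at which the germ of the parametrization is equivalent, under smooth changes of coordinates in source and target, to $(u,v)\mapsto(u,v^2,v^3)$. The curve of tangency of $\Pi_1,\Pi_2$ is the closure of the set of their common points at which both parametrizations are immersive and have the same tangent plane. The subsystem $\mathcal M_2$. Put $x_1=(\alpha_1-\beta_2)+i(\alpha_2+\beta_1)$, $y_1=(\alpha_1+\beta_2)+i(\alpha_2-\beta_1)$, $z_1=\alpha_3+i\beta_3$, $w_1=\omega_1+i\omega_2$, $w_3=\omega_3$, and let $x_2,y_2,z_2,w_2$ be the complex conjugates of $x_1,y_1,z_1,w_1$.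 The critical subsystem $\mathcal M_2$ is the closure of the set of points of $\mathcal P^6$ at which $w_1w_2+\lambda w_3\ne0$, $w_2x_1+\lambda z_1\neq0$ and $$y_1=\frac{1}{(w_1w_2+\lambda w_3)(w_2x_1+\lambda z_1)\lambda}\big[w_2(w_1^2+x_1)(x_2z_1w_1+x_1z_2w_2-x_1x_2w_3+2z_1z_2\lambda)+x_2(w_1w_3+z_1)(w_1z_1-x_1w_3)\lambda-(x_1w_3^2-2z_1w_1w_3-z_1^2)z_2\lambda^2\big]$$ (together with the conjugate equation for $y_2$). Theorem. Every $x\in\mathcal M_2$ is a critical point of $J$ (of rank at most 2) with $J(x)\in\Pi_2$, and the value $s\ne 0$ of the parameter with which $J(x)$ is the point $(h,s)$ of $\Pi_2$, $h=H(x)$, is unique. If $x\in\mathcal M_2$ has rank 2, then with this $s$ the number $$\mu^2=-\frac1s\big[8\lambda^2s^3-r^4\big]\Big[2s^2-2\big(h+\tfrac{\lambda^2}2\big)s+p^2\Big]$$ is the square of the characteristic exponent at $x$ of the integral $L=2G-(p^2-2\lambda^2s)H+sK$ (with the constant $s$; in particular $dL(x)=0$), and $x$ is a center if and only if $\mu^2<0$,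 a saddle if and only if $\mu^2>0$, and degenerate if and only if $\mu=0$. Moreover, a rank-2 point $x\in\mathcal M_2$ is degenerate if and only if $J(x)$ lies on the cuspidal edge of $\Pi_2$ or on the curve of tangency of $\Pi_2$ with $\Pi_1$, and the set of points of $\Pi_2$ with $\mu^2=0$ is exactly the union of this cuspidal edge and this curve of tangency. -/

import Mathlib

open scoped ContDiff Topology Matrix

noncomputable section

namespace KowalevskiGyrostat

/-- The space `ℝ⁹(ω, α, β)`; the point is written as `(ω, α, β)`. -/
abbrev Phase : Type := (Fin 3 → ℝ) × (Fin 3 → ℝ) × (Fin 3 → ℝ)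

/-- The space `ℝ³(h, k, g)` of constants of the first integrals. -/
abbrev Val : Type := ℝ × ℝ × ℝ

/-! ### Phase space and first integrals -/

/-- The geometric integrals `(α·α, β·β, α·β)`. -/
def geom (x : Phase) : ℝ × ℝ × ℝ :=
  (x.2.1 ⬝ᵥ x.2.1, x.2.2 ⬝ᵥ x.2.2, x.2.1 ⬝ᵥ x.2.2)

/-- The six-dimensional phase space `𝒫⁶`. -/
def phaseSpace (a b : ℝ) : Set Phase := {x | geom x = (a ^ 2, b ^ 2, 0)}

/-- The tangent space to `𝒫⁶` at its point `x`, as a subspace of `ℝ⁹`. -/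
def tangent (x : Phase) : Submodule ℝ Phase :=
  LinearMap.ker (fderiv ℝ geom x).toLinearMap

/-- The kinetic momentum `(2ω₁, 2ω₂, ω₃ + λ)`. -/
def momentum (lam : ℝ) (x : Phase) : Fin 3 → ℝ :=
  ![2 * x.1 0, 2 * x.1 1, x.1 2 + lam]

def intH (x : Phase) : ℝ :=
  (x.1 0) ^ 2 + (x.1 1) ^ 2 + (1 / 2) * (x.1 2) ^ 2 - x.2.1 0 - x.2.2 1

def intK (lam : ℝ) (x : Phase) : ℝ :=
  ((x.1 0) ^ 2 - (x.1 1) ^ 2 + x.2.1 0 - x.2.2 1) ^ 2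
    + (2 * x.1 0 * x.1 1 + x.2.1 1 + x.2.2 0) ^ 2
    + 2 * lam * ((x.1 2 - lam) * ((x.1 0) ^ 2 + (x.1 1) ^ 2)
        + 2 * x.1 0 * x.2.1 2 + 2 * x.1 1 * x.2.2 2)

def intG (a b lam : ℝ) (x : Phase) : ℝ :=
  (1 / 4) * ((momentum lam x ⬝ᵥ x.2.1) ^ 2 + (momentum lam x ⬝ᵥ x.2.2) ^ 2)
    + (1 / 2) * (x.1 2 - lam) * (momentum lam x ⬝ᵥ (x.2.1 ⨯₃ x.2.2))
    - b ^ 2 * x.2.1 0 - a ^ 2 * x.2.2 1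

/-- The integral map `J = H × K × G`. -/
def intJ (a b lam : ℝ) (x : Phase) : Val := (intH x, intK lam x, intG a b lam x)

/-- The rank of `J : 𝒫⁶ → ℝ³` at `x`: the dimension of the image of the tangent space. -/
def rankJ (a b lam : ℝ) (x : Phase) : ℕ :=
  Module.finrank ℝ ((tangent x).map (fderiv ℝ (intJ a b lam) x).toLinearMap)

/-! ### Hamiltonian fields -/

/-- Partial gradients of `F` in `ω`, `α`, `β`. -/
def gradω (F : Phase → ℝ) (x : Phase) : Fin 3 → ℝ :=
  fun i => fderiv ℝ F x (Pi.single i 1, 0, 0)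

def gradα (F : Phase → ℝ) (x : Phase) : Fin 3 → ℝ :=
  fun i => fderiv ℝ F x (0, Pi.single i 1, 0)

def gradβ (F : Phase → ℝ) (x : Phase) : Fin 3 → ℝ :=
  fun i => fderiv ℝ F x (0, 0, Pi.single i 1)

/-- Gradient of `F` in the kinetic momentum `M = (2ω₁, 2ω₂, ω₃ + λ)`. -/
def gradM (F : Phase → ℝ) (x : Phase) : Fin 3 → ℝ :=
  ![gradω F x 0 / 2, gradω F x 1 / 2, gradω F x 2]

/-- The time derivative of `M` along the Hamiltonian field of `F`. -/
def momentumDot (lam : ℝ) (F : Phase → ℝ) (x : Phase) : Fin 3 → ℝ :=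
  momentum lam x ⨯₃ gradM F x + x.2.1 ⨯₃ gradα F x + x.2.2 ⨯₃ gradβ F x

/-- The Hamiltonian field `sgrad F` on `ℝ⁹` for the Lie-Poisson bracket
`{Mᵢ,Mⱼ} = εᵢⱼₖ Mₖ`, `{Mᵢ,αⱼ} = εᵢⱼₖ αₖ`, `{Mᵢ,βⱼ} = εᵢⱼₖ βₖ`, `{α,α} = {α,β} = {β,β} = 0`
(up to the common sign), that is,
`Ṁ = M × F_M + α × F_α + β × F_β`, `α̇ = α × F_M`, `β̇ = β × F_M`,
written in the coordinates `(ω, α, β)`. The functions in `geom` are its Casimir functions, and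
for `F = H` these are the Euler-Poisson equations of the gyrostat. -/
def sgrad (lam : ℝ) (F : Phase → ℝ) (x : Phase) : Phase :=
  (![momentumDot lam F x 0 / 2, momentumDot lam F x 1 / 2, momentumDot lam F x 2],
    x.2.1 ⨯₃ gradM F x, x.2.2 ⨯₃ gradM F x)

/-- The linearization at `x` of the field `sgrad F` on `ℝ⁹`. -/
def linField (lam : ℝ) (F : Phase → ℝ) (x : Phase) : Phase →ₗ[ℝ] Phase :=
  (fderiv ℝ (sgrad lam F) x).toLinearMap

/-! ### Types of critical points of rank 2 -/

/-- The first integral `c₀ H + c₁ K + c₂ G`. -/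
def combo (a b lam : ℝ) (c : Fin 3 → ℝ) (x : Phase) : ℝ :=
  c 0 * intH x + c 1 * intK lam x + c 2 * intG a b lam x

/-- The differential of `F` on `𝒫⁶` vanishes at `x`. -/
def CriticalAt (F : Phase → ℝ) (x : Phase) : Prop :=
  ∀ v ∈ tangent x, fderiv ℝ F x v = 0

/-- `C` is the square of the characteristic exponent of `F` at `x`: `x` is a critical point of
`F` on `𝒫⁶`, and the operator `A_F`, the linearization of `sgrad F` on the six-dimensional tangent
space to `𝒫⁶`, has characteristic polynomial `μ⁴ (μ² - C)`. -/
def HasExponentSq (lam : ℝ) (F : Phase → ℝ) (x : Phase) (C : ℝ) : Prop :=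
  CriticalAt F x ∧
    ∃ hA : ∀ v ∈ tangent x, linField lam F x v ∈ tangent x,
      ((linField lam F x).restrict hA).charpoly =
        Polynomial.X ^ 4 * (Polynomial.X ^ 2 - Polynomial.C C)

/-- A critical point of rank 2 of type "center". -/
def IsCenter (a b lam : ℝ) (x : Phase) : Prop :=
  rankJ a b lam x = 2 ∧
    ∃ c : Fin 3 → ℝ, c ≠ 0 ∧ ∃ C < 0, HasExponentSq lam (combo a b lam c) x C

/-- A critical point of rank 2 of type "saddle". -/
def IsSaddle (a b lam : ℝ) (x : Phase) : Prop :=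
  rankJ a b lam x = 2 ∧
    ∃ c : Fin 3 → ℝ, c ≠ 0 ∧ ∃ C > 0, HasExponentSq lam (combo a b lam c) x C

/-- A degenerate critical point of rank 2: no integral has a non-zero characteristic exponent. -/
def IsDegenerate (a b lam : ℝ) (x : Phase) : Prop :=
  rankJ a b lam x = 2 ∧
    ¬ ∃ c : Fin 3 → ℝ, c ≠ 0 ∧ ∃ C ≠ 0, HasExponentSq lam (combo a b lam c) x C

/-! ### The surfaces `Π₁`, `Π₂` in `ℝ³(h, k, g)` -/

/-- The parametrization of `Π₁` by `(h, s)`, `s ≠ 0`; here `p² = a² + b²`, `r² = a² - b²`. -/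
def surf₁ (a b lam : ℝ) (q : ℝ × ℝ) : Val :=
  let h := q.1
  let s := q.2
  let p2 := a ^ 2 + b ^ 2
  let r4 := (a ^ 2 - b ^ 2) ^ 2
  (h,
    p2 + (h - lam ^ 2 / 2) ^ 2 - 4 * (h - lam ^ 2 / 2) * s + 3 * s ^ 2
      - (p2 ^ 2 - r4) / (4 * s ^ 2),
    (h - lam ^ 2 / 2 - s) * s ^ 2 + (p2 ^ 2 - r4) / (4 * s))

/-- The parametrization of `Π₂` by `(h, s)`, `s ≠ 0`. -/
def surf₂ (a b lam : ℝ) (q : ℝ × ℝ) : Val :=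
  let h := q.1
  let s := q.2
  let p2 := a ^ 2 + b ^ 2
  let r4 := (a ^ 2 - b ^ 2) ^ 2
  (h,
    -2 * lam ^ 2 * (h - lam ^ 2 / 2 - 2 * s) - lam ^ 4 + r4 / (4 * s ^ 2),
    (1 / 2) * p2 * (h + lam ^ 2 / 2) - lam ^ 2 * s ^ 2 - r4 / (4 * s))

/-- The germ of `f` at `q` is a cuspidal edge: after smooth changes of coordinates in the source
and in the target it becomes `(u, v) ↦ (u, v², v³)` at the origin. -/
def IsCuspidalEdgeAt (f : ℝ × ℝ → Val) (q : ℝ × ℝ) : Prop :=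
  ∃ (Φ : OpenPartialHomeomorph (ℝ × ℝ) (ℝ × ℝ)) (Ψ : OpenPartialHomeomorph Val Val),
    q ∈ Φ.source ∧ f q ∈ Ψ.source ∧ Φ q = 0 ∧
    ContDiffOn ℝ ∞ Φ Φ.source ∧ ContDiffOn ℝ ∞ Φ.symm Φ.target ∧
    ContDiffOn ℝ ∞ Ψ Ψ.source ∧ ContDiffOn ℝ ∞ Ψ.symm Ψ.target ∧
    ∀ᶠ y in 𝓝 q, Ψ (f y) = ((Φ y).1, (Φ y).2 ^ 2, (Φ y).2 ^ 3)

/-- The cuspidal edge of `Π₂`. -/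
def cuspidalEdge₂ (a b lam : ℝ) : Set Val :=
  {P | ∃ q : ℝ × ℝ, q.2 ≠ 0 ∧ surf₂ a b lam q = P ∧ IsCuspidalEdgeAt (surf₂ a b lam) q}

/-- The common points of `Π₁`, `Π₂` at which both are regular and have the same tangent plane. -/
def regularTangency (a b lam : ℝ) : Set Val :=
  {P | ∃ q₁ q₂ : ℝ × ℝ, q₁.2 ≠ 0 ∧ q₂.2 ≠ 0 ∧ surf₁ a b lam q₁ = P ∧ surf₂ a b lam q₂ = P ∧
    Function.Injective (fderiv ℝ (surf₁ a b lam) q₁) ∧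
    Function.Injective (fderiv ℝ (surf₂ a b lam) q₂) ∧
    LinearMap.range (fderiv ℝ (surf₁ a b lam) q₁).toLinearMap =
      LinearMap.range (fderiv ℝ (surf₂ a b lam) q₂).toLinearMap}

/-- The curve of tangency of `Π₁` and `Π₂`. The closure adds the isolated points of this curve
at which one of the surfaces is singular. -/
def tangencyCurve (a b lam : ℝ) : Set Val := closure (regularTangency a b lam)

/-! ### The critical subsystem `𝓜₂` -/

/-- The complex coordinates `x₁, y₁, z₁, w₁`; the coordinates `x₂, y₂, z₂, w₂` are their complex
conjugates. -/
def cx₁ (x : Phase) : ℂ := ⟨x.2.1 0 - x.2.2 1, x.2.1 1 + x.2.2 0⟩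
def cx₂ (x : Phase) : ℂ := ⟨x.2.1 0 - x.2.2 1, -(x.2.1 1 + x.2.2 0)⟩
def cy₁ (x : Phase) : ℂ := ⟨x.2.1 0 + x.2.2 1, x.2.1 1 - x.2.2 0⟩
def cy₂ (x : Phase) : ℂ := ⟨x.2.1 0 + x.2.2 1, -(x.2.1 1 - x.2.2 0)⟩
def cz₁ (x : Phase) : ℂ := ⟨x.2.1 2, x.2.2 2⟩
def cz₂ (x : Phase) : ℂ := ⟨x.2.1 2, -(x.2.2 2)⟩
def cw₁ (x : Phase) : ℂ := ⟨x.1 0, x.1 1⟩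
def cw₂ (x : Phase) : ℂ := ⟨x.1 0, -(x.1 1)⟩
def cw₃ (x : Phase) : ℂ := ((x.1 2 : ℝ) : ℂ)

/-- The right-hand side of the equation for `y₁`; the one for `y₂` is obtained by exchanging the
indices 1 and 2. -/
def rhs (l x₁ x₂ z₁ z₂ w₁ w₂ w₃ : ℂ) : ℂ :=
  1 / ((w₁ * w₂ + l * w₃) * (w₂ * x₁ + l * z₁) * l) *
    (w₂ * (w₁ ^ 2 + x₁) * (x₂ * z₁ * w₁ + x₁ * z₂ * w₂ - x₁ * x₂ * w₃ + 2 * z₁ * z₂ * l)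
      + x₂ * (w₁ * w₃ + z₁) * (w₁ * z₁ - x₁ * w₃) * l
      - (x₁ * w₃ ^ 2 - 2 * z₁ * w₁ * w₃ - z₁ ^ 2) * z₂ * l ^ 2)

/-- The part of `𝒫⁶` given by the explicit equations for `y₁, y₂`, with non-zero denominators. -/
def subsystem₂Generic (a b lam : ℝ) : Set Phase :=
  {x | x ∈ phaseSpace a b ∧
    cw₁ x * cw₂ x + lam * cw₃ x ≠ 0 ∧
    cw₂ x * cx₁ x + lam * cz₁ x ≠ 0 ∧
    cw₁ x * cx₂ x + lam * cz₂ x ≠ 0 ∧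
    cy₁ x = rhs lam (cx₁ x) (cx₂ x) (cz₁ x) (cz₂ x) (cw₁ x) (cw₂ x) (cw₃ x) ∧
    cy₂ x = rhs lam (cx₂ x) (cx₁ x) (cz₂ x) (cz₁ x) (cw₂ x) (cw₁ x) (cw₃ x)}

/-- The critical subsystem `𝓜₂` (for `λ ≠ 0`). -/
def subsystem₂ (a b lam : ℝ) : Set Phase := closure (subsystem₂Generic a b lam)

/-! ### The characteristic exponent -/

/-- `μ² = -(1/s) (8 λ² s³ - r⁴) (2 s² - 2 (h + λ²/2) s + p²)`. -/
def muSq (a b lam h s : ℝ) : ℝ :=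
  -(1 / s) * (8 * lam ^ 2 * s ^ 3 - (a ^ 2 - b ^ 2) ^ 2)
    * (2 * s ^ 2 - 2 * (h + lam ^ 2 / 2) * s + (a ^ 2 + b ^ 2))

/-- The coefficients of the integral `L = 2 G - (p² - 2 λ² s) H + s K`. -/
def coeffL (a b lam s : ℝ) : Fin 3 → ℝ :=
  ![-(a ^ 2 + b ^ 2 - 2 * lam ^ 2 * s), s, 2]

end KowalevskiGyrostat

end

/-!
At a generic point of `𝓜₂` all complex coordinates are polynomials in `s` and in six auxiliary
parameters which absorb the denominators. This turns the vanishing of `sgrad L`, the equations of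
`Π₂` and the value of `tr A_L²` into polynomial identities; the last one is short because the
linearization is a sum of three rank-one operators. Multiplied by the powers of `s` in their
denominators, these relations are closed conditions on `(x, s)`, and `s` is a root of a monic cubic
whose coefficients are continuous in `x`; hence they pass to the closure.

Where `J` has rank 2, the kernel of `A_L` contains the independent fields `sgrad H` and `sgrad K`,
and the values of `A_L` are skew-orthogonal to them since `H` and `K` are in involution with `L`. An
operator that is skew for a symplectic form on a space of dimension six then has characteristic
polynomial `μ⁴ (μ² - C)` with `C = tr A_L² / 2`. An integral critical at such a point is a multiple
of `L`, so the sign of `C` decides the type.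

Both surfaces satisfy `∂g/∂s = -(s / 2) ∂k/∂s`, so a common tangent plane determines `s`, and on a
line `s = const` the vanishing of the second factor of `μ²` is the condition for the two planes to
agree. The first factor vanishes where the parametrization of `Π₂` is not immersive; there
`k + 2λ²h` and `g - p²h/2` are, up to affine changes, the first two symmetric functions of the three
numbers `s, s, r⁴ / (8λ²s²)`, and depressing the corresponding cubic gives the normal form
`(u, v², v³)`.
-/

noncomputable section

namespace KowalevskiGyrostat

/-! ### Hamiltonian operators -/

section HamiltonianOperators

open Polynomial Module

variable {K V : Type*} [Field K] [AddCommGroup V] [Module K V]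

lemma span_le_orthogonal_span {B : LinearMap.BilinForm K V} {s : Set V}
    (h : ∀ u ∈ s, ∀ v ∈ s, B u v = 0) :
    Submodule.span K s ≤ B.orthogonal (Submodule.span K s) := by
  refine Submodule.span_le.2 fun v hv u hu => ?_
  have hle : Submodule.span K s ≤ LinearMap.ker (B.flip v) := Submodule.span_le.2 (h · · v hv)
  exact hle hu

variable [FiniteDimensional K V]

lemma charpoly_comp_comm {W : Type*} [AddCommGroup W] [Module K W] [FiniteDimensional K W]
    (f : V →ₗ[K] W) (g : W →ₗ[K] V) :
    (X : K[X]) ^ finrank K W * (g ∘ₗ f).charpoly = X ^ finrank K V * (f ∘ₗ g).charpoly := by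
  have bV := finBasis K V
  have bW := finBasis K W
  rw [← LinearMap.charpoly_toMatrix (g ∘ₗ f) bV, ← LinearMap.charpoly_toMatrix (f ∘ₗ g) bW,
    LinearMap.toMatrix_comp bV bW bV, LinearMap.toMatrix_comp bW bV bW]
  simpa using Matrix.charpoly_mul_comm' (LinearMap.toMatrix bW bV g) (LinearMap.toMatrix bV bW f)

lemma charpoly_restrict_of_forall_mem {A : V →ₗ[K] V} {U : Submodule K V} (hU : ∀ v, A v ∈ U) :
    X ^ finrank K U * A.charpoly =
      X ^ finrank K V * (A.restrict fun v (_ : v ∈ U) => hU v).charpoly :=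
  charpoly_comp_comm (A.codRestrict U hU) U.subtype

lemma charpoly_mapQ_of_le_ker {A : V →ₗ[K] V} {Q : Submodule K V} (hQ : Q ≤ LinearMap.ker A)
    (hQ' : Q ≤ Q.comap A) :
    X ^ finrank K (V ⧸ Q) * A.charpoly = X ^ finrank K V * (Q.mapQ Q A hQ').charpoly := by
  have hA : A = Q.liftQ A hQ ∘ₗ Q.mkQ := (Q.liftQ_mkQ A hQ).symm
  have hmap : Q.mapQ Q A hQ' = Q.mkQ ∘ₗ Q.liftQ A hQ := Submodule.linearMap_qext _ rfl
  rw [hmap, ← charpoly_comp_comm, ← hA]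

lemma trace_mapQ_of_le_ker {A : V →ₗ[K] V} {Q : Submodule K V} (hQ : Q ≤ LinearMap.ker A)
    (hQ' : Q ≤ Q.comap A) :
    LinearMap.trace K (V ⧸ Q) (Q.mapQ Q A hQ') = LinearMap.trace K V A := by
  have hA : A = Q.liftQ A hQ ∘ₗ Q.mkQ := (Q.liftQ_mkQ A hQ).symm
  have hmap : Q.mapQ Q A hQ' = Q.mkQ ∘ₗ Q.liftQ A hQ := Submodule.linearMap_qext _ rfl
  rw [hmap, LinearMap.trace_comp_comm', ← hA]

lemma charpoly_of_finrank_eq_two_of_trace_eq_zero (h2 : (2 : K) ≠ 0) (hV : finrank K V = 2)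
    {A : V →ₗ[K] V} (hA : LinearMap.trace K V A = 0) :
    A.charpoly = X ^ 2 - C (LinearMap.trace K V (A ∘ₗ A) / 2) := by
  have b := finBasisOfFinrankEq K V hV
  rw [LinearMap.trace_eq_matrix_trace K b] at hA ⊢
  rw [← LinearMap.charpoly_toMatrix A b, Matrix.charpoly_fin_two, hA,
    LinearMap.toMatrix_comp b b b]
  set M := LinearMap.toMatrix b b A
  have hdet : (M * M).trace / 2 = -M.det := by
    rw [Matrix.trace_fin_two] at hA
    rw [Matrix.trace_fin_two, Matrix.det_fin_two, Matrix.mul_apply, Matrix.mul_apply,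
      Fin.sum_univ_two, Fin.sum_univ_two]
    field_simp
    linear_combination (M 0 0 + M 1 1) * hA
  rw [hdet]
  simp

lemma trace_eq_zero_of_isSkewAdjoint (h2 : (2 : K) ≠ 0) {B : LinearMap.BilinForm K V}
    (hB : B.Nondegenerate) {A : V →ₗ[K] V} (hA : B.IsSkewAdjoint A) :
    LinearMap.trace K V A = 0 := by
  have hconj : (B.toDual hB).conj A = (-1 : K) • Module.Dual.transpose (R := K) A := by
    ext f v
    obtain ⟨u, rfl⟩ := (B.toDual hB).surjective f
    rw [LinearEquiv.conj_apply_apply, LinearEquiv.symm_apply_apply]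
    exact (hA u v).trans ((map_neg (B u) (A v)).trans (neg_one_mul _).symm)
  have htrace := LinearMap.trace_conj' A (B.toDual hB)
  rw [hconj, map_smul, LinearMap.trace_transpose', neg_one_smul, neg_eq_iff_add_eq_zero,
    ← two_mul] at htrace
  exact (mul_eq_zero.mp htrace).resolve_left h2

/-- `A` maps `V` to the orthogonal complement of `P`, and kills `P`; so all of its non-zero spectrum
is that of the induced operator on the two-dimensional quotient of these spaces. -/
theorem charpoly_of_isSkewAdjoint_of_isotropic_le_ker (h2 : (2 : K) ≠ 0)
    {B : LinearMap.BilinForm K V} (hB : B.Nondegenerate) {A : V →ₗ[K] V} (hA : B.IsSkewAdjoint A)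
    {P : Submodule K V} (hP : P ≤ B.orthogonal P) (hAP : P ≤ LinearMap.ker A)
    (hV : finrank K V = 2 * finrank K P + 2) :
    A.charpoly =
      X ^ (2 * finrank K P) * (X ^ 2 - C (LinearMap.trace K V (A ∘ₗ A) / 2)) := by
  set U := B.orthogonal P
  have hU (v : V) : A v ∈ U := fun w hw => by
    have h := hA w v
    rw [hAP hw, map_zero, LinearMap.zero_apply, Pi.neg_apply, map_neg] at h
    exact neg_eq_zero.mp h.symm
  set AU := A.restrict fun v (_ : v ∈ U) => hU v with hAU
  set Q := P.comap U.subtype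
  have hQ : Q ≤ LinearMap.ker AU := fun w hw => Subtype.ext (hAP hw)
  have hQ' : Q ≤ Q.comap AU := hQ.trans (LinearMap.ker_le_comap _)
  set D := Q.mapQ Q AU hQ'
  have hdimU : finrank K U = finrank K P + 2 := by
    have : finrank K U = finrank K V - finrank K P :=
      LinearMap.BilinForm.finrank_orthogonal hB P
    omega
  have hdimD : finrank K (U ⧸ Q) = 2 := by
    have : finrank K Q = finrank K P := (Submodule.comapSubtypeEquivOfLe hP).finrank_eq
    have := Q.finrank_quotient_add_finrank
    omega
  have htrD : LinearMap.trace K _ D = 0 := by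
    rw [trace_mapQ_of_le_ker hQ, hAU, LinearMap.trace_restrict_eq_of_forall_mem _ _ hU,
      trace_eq_zero_of_isSkewAdjoint h2 hB hA]
  have htrDD : LinearMap.trace K _ (D ∘ₗ D) = LinearMap.trace K V (A ∘ₗ A) := by
    have hDD : D ∘ₗ D = Q.mapQ Q (AU ∘ₗ AU) (hQ'.trans (Submodule.comap_mono hQ')) :=
      Submodule.linearMap_qext _ rfl
    rw [hDD, trace_mapQ_of_le_ker (hQ.trans (LinearMap.ker_le_ker_comp _ _))]
    exact LinearMap.trace_restrict_eq_of_forall_mem U (A ∘ₗ A) fun v => hU (A v)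
  have hchar : X ^ (finrank K P + 4) * A.charpoly =
      X ^ (finrank K P + 4) * (X ^ (2 * finrank K P) * D.charpoly) := by
    have hcharU := charpoly_restrict_of_forall_mem hU
    have hcharD := charpoly_mapQ_of_le_ker hQ hQ'
    rw [hdimU, hV] at hcharU
    rw [hdimD, hdimU] at hcharD
    linear_combination X ^ 2 * hcharU + X ^ (2 * finrank K P + 2) * hcharD
  rw [mul_left_cancel₀ (pow_ne_zero _ X_ne_zero) hchar,
    charpoly_of_finrank_eq_two_of_trace_eq_zero h2 hdimD htrD, htrDD]

end HamiltonianOperators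

/-! ### Vector calculus -/

section VectorCalculus

variable {E F : Type*} [NormedAddCommGroup E] [NormedSpace ℝ E] [NormedAddCommGroup F]
  [NormedSpace ℝ F] {x : E} {n : WithTop ℕ∞}

section DotProduct

variable {ι : Type*} [Fintype ι] {f g : E → ι → ℝ}

@[fun_prop]
lemma contDiff_dotProduct (hf : ContDiff ℝ n f) (hg : ContDiff ℝ n g) :
    ContDiff ℝ n fun y => f y ⬝ᵥ g y := by
  unfold dotProduct
  fun_prop

@[fun_prop]
lemma differentiableAt_dotProduct (hf : DifferentiableAt ℝ f x) (hg : DifferentiableAt ℝ g x) :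
    DifferentiableAt ℝ (fun y => f y ⬝ᵥ g y) x := by
  unfold dotProduct
  fun_prop

lemma fderiv_dotProduct (hf : DifferentiableAt ℝ f x) (hg : DifferentiableAt ℝ g x) (v : E) :
    fderiv ℝ (fun y => f y ⬝ᵥ g y) x v = f x ⬝ᵥ fderiv ℝ g x v + fderiv ℝ f x v ⬝ᵥ g x :=
  DFunLike.congr_fun
    ((dotProductBilin ℝ ℝ (m := ι) (A := ℝ)).toContinuousBilinearMap.fderiv_of_bilinear hf hg) v

lemma dotProduct_apply_single [DecidableEq ι] (φ : (ι → ℝ) →ₗ[ℝ] ℝ) (v : ι → ℝ) :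
    (fun i => φ (Pi.single i 1)) ⬝ᵥ v = φ v := by
  conv_rhs => rw [← Finset.univ_sum_single v, map_sum]
  refine Finset.sum_congr rfl fun i _ => ?_
  rw [mul_comm, ← smul_eq_mul, ← map_smul, ← Pi.single_smul, smul_eq_mul, mul_one]

end DotProduct

section CrossProduct

variable {f g : E → Fin 3 → ℝ}

@[fun_prop]
lemma contDiff_crossProduct (hf : ContDiff ℝ n f) (hg : ContDiff ℝ n g) :
    ContDiff ℝ n fun y => f y ⨯₃ g y :=
  (crossProduct (R := ℝ)).toContinuousBilinearMap.isBoundedBilinearMap.contDiff.comp (hf.prodMk hg)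

@[fun_prop]
lemma differentiableAt_crossProduct (hf : DifferentiableAt ℝ f x) (hg : DifferentiableAt ℝ g x) :
    DifferentiableAt ℝ (fun y => f y ⨯₃ g y) x :=
  ((crossProduct (R := ℝ)).toContinuousBilinearMap.hasFDerivAt_of_bilinear
    hf.hasFDerivAt hg.hasFDerivAt).differentiableAt

lemma fderiv_crossProduct (hf : DifferentiableAt ℝ f x) (hg : DifferentiableAt ℝ g x) (v : E) :
    fderiv ℝ (fun y => f y ⨯₃ g y) x v = f x ⨯₃ fderiv ℝ g x v + fderiv ℝ f x v ⨯₃ g x :=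
  DFunLike.congr_fun
    ((crossProduct (R := ℝ)).toContinuousBilinearMap.fderiv_of_bilinear hf hg) v

end CrossProduct

lemma eq_zero_of_cross_eq_zero {u v ξ : Fin 3 → ℝ} (huv : u ⨯₃ v ≠ 0) (hu : u ⨯₃ ξ = 0)
    (hv : v ⨯₃ ξ = 0) : ξ = 0 := by
  by_contra hξ
  have hdep {w : Fin 3 → ℝ} (hw : w ⨯₃ ξ = 0) : ∃ t : ℝ, w = t • ξ := by
    have h : ¬ LinearIndependent ℝ ![ξ, w] := fun h =>
      crossProduct_ne_zero_iff_linearIndependent.2 h (by rw [← cross_anticomm, hw, neg_zero])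
    rw [LinearIndependent.pair_iff' hξ] at h
    push Not at h
    exact h.imp fun t => Eq.symm
  obtain ⟨s, rfl⟩ := hdep hu
  obtain ⟨t, rfl⟩ := hdep hv
  simp at huv

lemma fderiv_eq_zero_of_forall_level_eq_zero [CompleteSpace E] [CompleteSpace F] {f : E → F}
    {φ : E → ℝ} {f' : E →L[ℝ] F} {φ' : E →L[ℝ] ℝ} (hf : HasStrictFDerivAt f f' x)
    (hf' : Function.Surjective f') (hφ : HasStrictFDerivAt φ φ' x)
    (h : ∀ y, f y = f x → φ y = 0) {v : E} (hv : f' v = 0) : φ' v = 0 := by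
  have hext : IsLocalExtrOn φ {y | f y = f x} x := Or.inl <|
    Filter.eventually_of_mem self_mem_nhdsWithin fun y hy => (h x rfl).trans_le (h y hy).ge
  obtain ⟨Λ, Λ₀, hne, hΛ⟩ := hext.exists_linear_map_of_hasStrictFDerivAt hf hφ
  have hΛ₀ : Λ₀ ≠ 0 := by
    rintro rfl
    refine hne (Prod.ext (LinearMap.ext fun w => ?_) rfl)
    obtain ⟨u, rfl⟩ := hf' w
    simpa using hΛ u
  simpa [hv, hΛ₀] using hΛ v

end VectorCalculus

/-! ### Differentials of the first integrals -/

/-- The inertia operator `diag(2, 2, 1)`, so that `M = inertia ω + (0, 0, λ)`. -/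
def inertia : (Fin 3 → ℝ) ≃ₗ[ℝ] (Fin 3 → ℝ) where
  toFun v := ![2 * v 0, 2 * v 1, v 2]
  invFun m := ![m 0 / 2, m 1 / 2, m 2]
  map_add' v w := by
    ext i
    fin_cases i <;> simp [mul_add]
  map_smul' t v := by
    ext i
    fin_cases i <;> simp [mul_left_comm]
  left_inv v := by
    ext i
    fin_cases i <;> simp
  right_inv m := by
    ext i
    fin_cases i <;> simp [mul_div_cancel₀]

lemma inertia_apply (v : Fin 3 → ℝ) : inertia v = ![2 * v 0, 2 * v 1, v 2] := rfl

lemma inertia_symm_apply (m : Fin 3 → ℝ) : inertia.symm m = ![m 0 / 2, m 1 / 2, m 2] := rfl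

lemma momentum_eq_inertia (lam : ℝ) (x : Phase) :
    momentum lam x = inertia x.1 + ![0, 0, lam] := by
  ext i
  fin_cases i <;> simp [momentum, inertia_apply]

@[fun_prop]
lemma contDiff_momentum (lam : ℝ) : ContDiff ℝ ∞ (momentum lam) := by
  rw [funext (momentum_eq_inertia lam)]
  exact (inertia.toLinearMap.toContinuousLinearMap.contDiff.comp contDiff_fst).add contDiff_const

@[fun_prop]
lemma differentiableAt_momentum (lam : ℝ) (x : Phase) : DifferentiableAt ℝ (momentum lam) x :=
  (contDiff_momentum lam).differentiable (by simp) x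

lemma fderiv_momentum (lam : ℝ) (x v : Phase) : fderiv ℝ (momentum lam) x v = inertia v.1 := by
  have h := (inertia.toLinearMap.toContinuousLinearMap.comp
    (ContinuousLinearMap.fst ℝ (Fin 3 → ℝ) ((Fin 3 → ℝ) × (Fin 3 → ℝ)))).hasFDerivAt
      (x := x) |>.add_const ![0, 0, lam]
  rw [funext (momentum_eq_inertia lam)]
  exact DFunLike.congr_fun h.fderiv v

lemma fderiv_omega (x v : Phase) : fderiv ℝ (fun y : Phase => y.1) x v = v.1 := by
  rw [fderiv_fst]
  rfl

lemma fderiv_alpha (x v : Phase) : fderiv ℝ (fun y : Phase => y.2.1) x v = v.2.1 := by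
  rw [fderiv.fst differentiableAt_snd, fderiv_snd]
  rfl

lemma fderiv_beta (x v : Phase) : fderiv ℝ (fun y : Phase => y.2.2) x v = v.2.2 := by
  rw [fderiv.snd differentiableAt_snd, fderiv_snd]
  rfl

lemma fderiv_omega_apply (x v : Phase) (i : Fin 3) :
    fderiv ℝ (fun y : Phase => y.1 i) x v = v.1 i := by
  rw [fderiv_apply (by fun_prop), ContinuousLinearMap.comp_apply, fderiv_omega]
  rfl

lemma fderiv_alpha_apply (x v : Phase) (i : Fin 3) :
    fderiv ℝ (fun y : Phase => y.2.1 i) x v = v.2.1 i := by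
  rw [fderiv_apply (by fun_prop), ContinuousLinearMap.comp_apply, fderiv_alpha]
  rfl

lemma fderiv_beta_apply (x v : Phase) (i : Fin 3) :
    fderiv ℝ (fun y : Phase => y.2.2 i) x v = v.2.2 i := by
  rw [fderiv_apply (by fun_prop), ContinuousLinearMap.comp_apply, fderiv_beta]
  rfl

lemma contDiff_intH : ContDiff ℝ ∞ intH := by
  unfold intH
  fun_prop

lemma contDiff_intK (lam : ℝ) : ContDiff ℝ ∞ (intK lam) := by
  unfold intK
  fun_prop

lemma contDiff_intG (a b lam : ℝ) : ContDiff ℝ ∞ (intG a b lam) := by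
  unfold intG
  fun_prop

lemma contDiff_combo (a b lam : ℝ) (c : Fin 3 → ℝ) : ContDiff ℝ ∞ (combo a b lam c) := by
  have := contDiff_intH
  have := contDiff_intK lam
  have := contDiff_intG a b lam
  unfold combo
  fun_prop

lemma differentiableAt_intH (x : Phase) : DifferentiableAt ℝ intH x :=
  contDiff_intH.differentiable (by simp) x

lemma differentiableAt_intK (lam : ℝ) (x : Phase) : DifferentiableAt ℝ (intK lam) x :=
  (contDiff_intK lam).differentiable (by simp) x

lemma differentiableAt_intG (a b lam : ℝ) (x : Phase) : DifferentiableAt ℝ (intG a b lam) x :=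
  (contDiff_intG a b lam).differentiable (by simp) x

lemma fderiv_intJ (a b lam : ℝ) (x v : Phase) : fderiv ℝ (intJ a b lam) x v =
    (fderiv ℝ intH x v, fderiv ℝ (intK lam) x v, fderiv ℝ (intG a b lam) x v) :=
  DFunLike.congr_fun ((differentiableAt_intH x).hasFDerivAt.prodMk
    ((differentiableAt_intK lam x).hasFDerivAt.prodMk
      (differentiableAt_intG a b lam x).hasFDerivAt)).fderiv v

lemma fderiv_combo (a b lam : ℝ) (c : Fin 3 → ℝ) (x v : Phase) :
    fderiv ℝ (combo a b lam c) x v = c 0 * fderiv ℝ intH x v + c 1 * fderiv ℝ (intK lam) x v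
      + c 2 * fderiv ℝ (intG a b lam) x v :=
  DFunLike.congr_fun ((((differentiableAt_intH x).hasFDerivAt.const_mul (c 0)).add
    ((differentiableAt_intK lam x).hasFDerivAt.const_mul (c 1))).add
      ((differentiableAt_intG a b lam x).hasFDerivAt.const_mul (c 2))).fderiv v

lemma fderiv_eq_grad (F : Phase → ℝ) (x v : Phase) :
    fderiv ℝ F x v = gradM F x ⬝ᵥ inertia v.1 + gradα F x ⬝ᵥ v.2.1 + gradβ F x ⬝ᵥ v.2.2 := by
  have hM : gradM F x ⬝ᵥ inertia v.1 = gradω F x ⬝ᵥ v.1 := by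
    simp only [gradM, inertia_apply, dotProduct, Fin.sum_univ_three, Matrix.cons_val]
    ring
  have hω := dotProduct_apply_single ((fderiv ℝ F x).toLinearMap ∘ₗ LinearMap.inl ℝ _ _) v.1
  have hα := dotProduct_apply_single
    ((fderiv ℝ F x).toLinearMap ∘ₗ LinearMap.inr ℝ _ _ ∘ₗ LinearMap.inl ℝ _ _) v.2.1
  have hβ := dotProduct_apply_single
    ((fderiv ℝ F x).toLinearMap ∘ₗ LinearMap.inr ℝ _ _ ∘ₗ LinearMap.inr ℝ _ _) v.2.2
  have hv : v = (v.1, 0, 0) + (0, v.2.1, 0) + (0, 0, v.2.2) := by simp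
  calc fderiv ℝ F x v
      = fderiv ℝ F x (v.1, 0, 0) + fderiv ℝ F x (0, v.2.1, 0) + fderiv ℝ F x (0, 0, v.2.2) := by
        rw [← map_add, ← map_add, ← hv]
    _ = _ := by rw [hM]; exact congr_arg₂ _ (congr_arg₂ _ hω.symm hα.symm) hβ.symm

lemma grad_eq_of_fderiv_eq {F : Phase → ℝ} {x : Phase} {p q r : Fin 3 → ℝ}
    (h : ∀ v, fderiv ℝ F x v = p ⬝ᵥ inertia v.1 + q ⬝ᵥ v.2.1 + r ⬝ᵥ v.2.2) :
    gradM F x = p ∧ gradα F x = q ∧ gradβ F x = r := by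
  refine ⟨?_, ?_, ?_⟩ <;> refine dotProduct_eq _ _ fun v => ?_
  · simpa using (fderiv_eq_grad F x (inertia.symm v, 0, 0)).symm.trans (h _)
  · simpa using (fderiv_eq_grad F x (0, v, 0)).symm.trans (h _)
  · simpa using (fderiv_eq_grad F x (0, 0, v)).symm.trans (h _)

lemma grad_intH (x : Phase) :
    gradM intH x = x.1 ∧ gradα intH x = ![-1, 0, 0] ∧ gradβ intH x = ![0, -1, 0] := by
  refine grad_eq_of_fderiv_eq fun v => ?_
  unfold intH
  simp (disch := fun_prop) only [fderiv_fun_add, fderiv_fun_sub, fderiv_fun_mul, fderiv_fun_pow,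
    fderiv_fun_const, add_apply, sub_apply, smul_apply, zero_apply, Pi.zero_apply,
    fderiv_omega_apply, fderiv_alpha_apply, fderiv_beta_apply, smul_eq_mul, nsmul_eq_mul,
    inertia_apply, dotProduct, Fin.sum_univ_three, Matrix.cons_val]
  push_cast
  ring

lemma grad_intK (lam : ℝ) (x : Phase) :
    gradM (intK lam) x =
      ![2 * (x.1 0 ^ 2 - x.1 1 ^ 2 + x.2.1 0 - x.2.2 1) * x.1 0
          + 2 * (2 * x.1 0 * x.1 1 + x.2.1 1 + x.2.2 0) * x.1 1
          + 2 * lam * ((x.1 2 - lam) * x.1 0 + x.2.1 2),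
        -2 * (x.1 0 ^ 2 - x.1 1 ^ 2 + x.2.1 0 - x.2.2 1) * x.1 1
          + 2 * (2 * x.1 0 * x.1 1 + x.2.1 1 + x.2.2 0) * x.1 0
          + 2 * lam * ((x.1 2 - lam) * x.1 1 + x.2.2 2),
        2 * lam * (x.1 0 ^ 2 + x.1 1 ^ 2)] ∧
    gradα (intK lam) x =
      ![2 * (x.1 0 ^ 2 - x.1 1 ^ 2 + x.2.1 0 - x.2.2 1),
        2 * (2 * x.1 0 * x.1 1 + x.2.1 1 + x.2.2 0), 4 * lam * x.1 0] ∧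
    gradβ (intK lam) x =
      ![2 * (2 * x.1 0 * x.1 1 + x.2.1 1 + x.2.2 0),
        -2 * (x.1 0 ^ 2 - x.1 1 ^ 2 + x.2.1 0 - x.2.2 1), 4 * lam * x.1 1] := by
  refine grad_eq_of_fderiv_eq fun v => ?_
  unfold intK
  simp (disch := fun_prop) only [fderiv_fun_add, fderiv_fun_sub, fderiv_fun_mul, fderiv_fun_pow,
    fderiv_fun_const, add_apply, sub_apply, smul_apply, zero_apply, Pi.zero_apply,
    fderiv_omega_apply, fderiv_alpha_apply, fderiv_beta_apply, smul_eq_mul, nsmul_eq_mul,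
    inertia_apply, dotProduct, Fin.sum_univ_three, Matrix.cons_val]
  push_cast
  ring

lemma grad_intG (a b lam : ℝ) (x : Phase) :
    gradM (intG a b lam) x =
      (1 / 2 * (momentum lam x ⬝ᵥ x.2.1)) • x.2.1 + (1 / 2 * (momentum lam x ⬝ᵥ x.2.2)) • x.2.2
        + (1 / 2 * (momentum lam x ⬝ᵥ (x.2.1 ⨯₃ x.2.2))) • ![0, 0, 1]
        + (1 / 2 * (x.1 2 - lam)) • (x.2.1 ⨯₃ x.2.2) ∧
    gradα (intG a b lam) x = (1 / 2 * (momentum lam x ⬝ᵥ x.2.1)) • momentum lam x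
      + (1 / 2 * (x.1 2 - lam)) • (x.2.2 ⨯₃ momentum lam x) - b ^ 2 • ![1, 0, 0] ∧
    gradβ (intG a b lam) x = (1 / 2 * (momentum lam x ⬝ᵥ x.2.2)) • momentum lam x
      + (1 / 2 * (x.1 2 - lam)) • (momentum lam x ⨯₃ x.2.1) - a ^ 2 • ![0, 1, 0] := by
  refine grad_eq_of_fderiv_eq fun v => ?_
  have hα : x.2.2 ⨯₃ momentum lam x ⬝ᵥ v.2.1 = momentum lam x ⬝ᵥ (v.2.1 ⨯₃ x.2.2) := by
    rw [dotProduct_comm, triple_product_permutation, triple_product_permutation]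
  have hβ : momentum lam x ⨯₃ x.2.1 ⬝ᵥ v.2.2 = momentum lam x ⬝ᵥ (x.2.1 ⨯₃ v.2.2) := by
    rw [dotProduct_comm, triple_product_permutation]
  unfold intG
  simp (disch := fun_prop) only [fderiv_fun_add, fderiv_fun_sub, fderiv_fun_mul, fderiv_fun_pow,
    fderiv_fun_const, add_apply, sub_apply, smul_apply, zero_apply, Pi.zero_apply,
    fderiv_omega_apply, fderiv_alpha_apply, fderiv_beta_apply, fderiv_alpha, fderiv_beta,
    fderiv_dotProduct, fderiv_crossProduct, fderiv_momentum, smul_eq_mul, nsmul_eq_mul,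
    add_dotProduct, sub_dotProduct, smul_dotProduct, dotProduct_add, hα, hβ,
    dotProduct_comm (inertia v.1)]
  simp only [inertia_apply, dotProduct, Fin.sum_univ_three, Matrix.cons_val]
  push_cast
  ring

lemma gradM_combo (a b lam : ℝ) (c : Fin 3 → ℝ) (x : Phase) : gradM (combo a b lam c) x =
    c 0 • gradM intH x + c 1 • gradM (intK lam) x + c 2 • gradM (intG a b lam) x := by
  ext i
  fin_cases i <;> simp [gradM, gradω, fderiv_combo] <;> ring

lemma gradα_combo (a b lam : ℝ) (c : Fin 3 → ℝ) (x : Phase) : gradα (combo a b lam c) x =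
    c 0 • gradα intH x + c 1 • gradα (intK lam) x + c 2 • gradα (intG a b lam) x := by
  ext i
  simp [gradα, fderiv_combo]

lemma gradβ_combo (a b lam : ℝ) (c : Fin 3 → ℝ) (x : Phase) : gradβ (combo a b lam c) x =
    c 0 • gradβ intH x + c 1 • gradβ (intK lam) x + c 2 • gradβ (intG a b lam) x := by
  ext i
  simp [gradβ, fderiv_combo]

lemma fderiv_geom (x v : Phase) :
    fderiv ℝ geom x v = (2 * (x.2.1 ⬝ᵥ v.2.1), 2 * (x.2.2 ⬝ᵥ v.2.2),
      x.2.1 ⬝ᵥ v.2.2 + x.2.2 ⬝ᵥ v.2.1) := by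
  unfold geom
  rw [DifferentiableAt.fderiv_prodMk (by fun_prop) (by fun_prop),
    DifferentiableAt.fderiv_prodMk (by fun_prop) (by fun_prop)]
  simp (disch := fun_prop) only [ContinuousLinearMap.prod_apply, fderiv_dotProduct, fderiv_alpha,
    fderiv_beta, dotProduct_comm v.2.1, dotProduct_comm v.2.2, two_mul]

/-! ### Trivialization of the tangent bundle -/

lemma mem_tangent {x v : Phase} : v ∈ tangent x ↔
    x.2.1 ⬝ᵥ v.2.1 = 0 ∧ x.2.2 ⬝ᵥ v.2.2 = 0 ∧ x.2.1 ⬝ᵥ v.2.2 + x.2.2 ⬝ᵥ v.2.1 = 0 := by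
  have h : v ∈ tangent x ↔ fderiv ℝ geom x v = 0 := Iff.rfl
  simp [h, fderiv_geom, Prod.ext_iff]

lemma mem_phaseSpace {a b : ℝ} {x : Phase} : x ∈ phaseSpace a b ↔
    x.2.1 ⬝ᵥ x.2.1 = a ^ 2 ∧ x.2.2 ⬝ᵥ x.2.2 = b ^ 2 ∧ x.2.1 ⬝ᵥ x.2.2 = 0 := by
  simp [phaseSpace, geom, Prod.ext_iff]

lemma contDiff_geom : ContDiff ℝ ∞ geom := by
  unfold geom
  fun_prop

lemma fderiv_geom_surjective {a b : ℝ} (ha : a ≠ 0) (hb : b ≠ 0) {x : Phase}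
    (hx : x ∈ phaseSpace a b) : Function.Surjective (fderiv ℝ geom x) := by
  obtain ⟨hα, hβ, hαβ⟩ := mem_phaseSpace.1 hx
  rintro ⟨p, q, r⟩
  refine ⟨(0, (p / (2 * a ^ 2)) • x.2.1, (r / a ^ 2) • x.2.1 + (q / (2 * b ^ 2)) • x.2.2), ?_⟩
  simp only [fderiv_geom, dotProduct_smul, dotProduct_add, hα, hβ, hαβ, dotProduct_comm x.2.2 x.2.1,
    smul_eq_mul, mul_zero, add_zero, zero_add, Prod.mk.injEq]
  refine ⟨?_, ?_, ?_⟩ <;> field_simp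

/-- The tangent vector to `𝒫⁶` with `δM = m`, `δα = α × ξ`, `δβ = β × ξ`, where `u = (ξ, m)`. -/
def emb (x : Phase) : (Fin 3 → ℝ) × (Fin 3 → ℝ) →ₗ[ℝ] Phase :=
  (inertia.symm.toLinearMap ∘ₗ LinearMap.snd ℝ _ _).prod
    ((crossProduct x.2.1 ∘ₗ LinearMap.fst ℝ _ _).prod (crossProduct x.2.2 ∘ₗ LinearMap.fst ℝ _ _))

lemma emb_apply (x : Phase) (u : (Fin 3 → ℝ) × (Fin 3 → ℝ)) :
    emb x u = (inertia.symm u.2, x.2.1 ⨯₃ u.1, x.2.2 ⨯₃ u.1) := rfl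

lemma emb_mem_tangent (x : Phase) (u : (Fin 3 → ℝ) × (Fin 3 → ℝ)) : emb x u ∈ tangent x := by
  rw [mem_tangent, emb_apply]
  refine ⟨dot_self_cross _ _, dot_self_cross _ _, ?_⟩
  rw [triple_product_permutation x.2.2, ← cross_anticomm x.2.2, dotProduct_neg, add_neg_cancel]

lemma emb_injective {a b : ℝ} (ha : a ≠ 0) (hb : b ≠ 0) {x : Phase} (hx : x ∈ phaseSpace a b) :
    Function.Injective (emb x) := by
  obtain ⟨hα, hβ, hαβ⟩ := mem_phaseSpace.1 hx
  have hcross : x.2.1 ⨯₃ x.2.2 ≠ 0 := by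
    intro h
    have hsq := cross_dot_cross x.2.1 x.2.2 x.2.1 x.2.2
    rw [h, hα, hβ, hαβ] at hsq
    simp [ha, hb] at hsq
  refine (injective_iff_map_eq_zero _).2 fun u hu => ?_
  rw [emb_apply, Prod.mk_eq_zero, Prod.mk_eq_zero] at hu
  obtain ⟨hm, hξα, hξβ⟩ := hu
  exact Prod.ext (eq_zero_of_cross_eq_zero hcross hξα hξβ)
    ((LinearEquiv.map_eq_zero_iff _).1 hm)

lemma range_emb {a b : ℝ} (ha : a ≠ 0) (hb : b ≠ 0) {x : Phase} (hx : x ∈ phaseSpace a b) :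
    LinearMap.range (emb x) = tangent x := by
  refine Submodule.eq_of_le_of_finrank_eq ?_ ?_
  · rintro _ ⟨u, rfl⟩
    exact emb_mem_tangent x u
  · have hrank := LinearMap.finrank_range_add_finrank_ker (fderiv ℝ geom x).toLinearMap
    rw [LinearMap.range_eq_top.2 (fderiv_geom_surjective ha hb hx)] at hrank
    change _ = Module.finrank ℝ (LinearMap.ker (fderiv ℝ geom x).toLinearMap)
    rw [LinearMap.finrank_range_of_inj (emb_injective ha hb hx)]
    simp only [finrank_top, Module.finrank_prod, Module.finrank_fin_fun,
      Module.finrank_self] at hrank ⊢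
    omega

/-- The isomorphism of `ℝ³ × ℝ³` onto the tangent space given by `emb`. -/
def tangentEquiv {a b : ℝ} (ha : a ≠ 0) (hb : b ≠ 0) {x : Phase} (hx : x ∈ phaseSpace a b) :
    ((Fin 3 → ℝ) × (Fin 3 → ℝ)) ≃ₗ[ℝ] tangent x :=
  (LinearEquiv.ofInjective (emb x) (emb_injective ha hb hx)).trans
    (LinearEquiv.ofEq _ _ (range_emb ha hb hx))

lemma coe_tangentEquiv {a b : ℝ} (ha : a ≠ 0) (hb : b ≠ 0) {x : Phase}
    (hx : x ∈ phaseSpace a b) (u : (Fin 3 → ℝ) × (Fin 3 → ℝ)) :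
    (tangentEquiv ha hb hx u : Phase) = emb x u := rfl

/-! ### Hamiltonian fields in the trivialization -/

/-- The components `(F_M, Ṁ)` of the field `sgrad F` in the trivialization `emb`. -/
def reducedField (lam : ℝ) (F : Phase → ℝ) (x : Phase) : (Fin 3 → ℝ) × (Fin 3 → ℝ) :=
  (gradM F x, momentumDot lam F x)

/-- The linearization of `reducedField` along the tangent space to `𝒫⁶`. -/
def reducedLin (lam : ℝ) (F : Phase → ℝ) (x : Phase) :
    (Fin 3 → ℝ) × (Fin 3 → ℝ) →ₗ[ℝ] (Fin 3 → ℝ) × (Fin 3 → ℝ) :=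
  (fderiv ℝ (reducedField lam F) x).toLinearMap ∘ₗ emb x

lemma sgrad_eq_emb (lam : ℝ) (F : Phase → ℝ) (x : Phase) :
    sgrad lam F x = emb x (reducedField lam F x) := rfl

lemma reducedField_combo (a b lam : ℝ) (c : Fin 3 → ℝ) (x : Phase) :
    reducedField lam (combo a b lam c) x = c 0 • reducedField lam intH x
      + c 1 • reducedField lam (intK lam) x + c 2 • reducedField lam (intG a b lam) x := by
  refine Prod.ext (gradM_combo ..) ?_
  simp only [reducedField, momentumDot, gradM_combo, gradα_combo, gradβ_combo, map_add, map_smul,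
    Prod.snd_add, Prod.smul_snd, smul_add]
  abel

section Smoothness

variable {F : Phase → ℝ}

lemma contDiff_fderiv_apply (hF : ContDiff ℝ ∞ F) (v : Phase) :
    ContDiff ℝ ∞ fun y => fderiv ℝ F y v :=
  (hF.fderiv_right (m := ∞) (by simp)).clm_apply contDiff_const

lemma contDiff_gradM (hF : ContDiff ℝ ∞ F) : ContDiff ℝ ∞ (gradM F) := by
  have hω : ContDiff ℝ ∞ (gradω F) := contDiff_pi.2 fun _ => contDiff_fderiv_apply hF _
  exact inertia.symm.toLinearMap.toContinuousLinearMap.contDiff.comp hω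

lemma contDiff_gradα (hF : ContDiff ℝ ∞ F) : ContDiff ℝ ∞ (gradα F) :=
  contDiff_pi.2 fun _ => contDiff_fderiv_apply hF _

lemma contDiff_gradβ (hF : ContDiff ℝ ∞ F) : ContDiff ℝ ∞ (gradβ F) :=
  contDiff_pi.2 fun _ => contDiff_fderiv_apply hF _

lemma contDiff_reducedField (lam : ℝ) (hF : ContDiff ℝ ∞ F) :
    ContDiff ℝ ∞ (reducedField lam F) := by
  have hM := contDiff_gradM hF
  have hα := contDiff_gradα hF
  have hβ := contDiff_gradβ hF
  refine hM.prodMk ?_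
  unfold momentumDot
  fun_prop

lemma differentiableAt_reducedField (lam : ℝ) (hF : ContDiff ℝ ∞ F) (x : Phase) :
    DifferentiableAt ℝ (reducedField lam F) x :=
  (contDiff_reducedField lam hF).differentiable (by simp) x

lemma contDiff_sgrad (lam : ℝ) (hF : ContDiff ℝ ∞ F) : ContDiff ℝ ∞ (sgrad lam F) := by
  have hX := contDiff_reducedField lam hF
  have hξ := contDiff_gradM hF
  exact (inertia.symm.toLinearMap.toContinuousLinearMap.contDiff.comp hX.snd).prodMk
    ((contDiff_crossProduct (by fun_prop) hξ).prodMk (contDiff_crossProduct (by fun_prop) hξ))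

end Smoothness

section Linearization

variable {lam : ℝ} {F : Phase → ℝ} {x : Phase}

lemma linField_eq_of_reducedField_eq_zero (hF : ContDiff ℝ ∞ F) (h0 : reducedField lam F x = 0) :
    linField lam F x = emb x ∘ₗ (fderiv ℝ (reducedField lam F) x).toLinearMap := by
  have hX := differentiableAt_reducedField lam hF x
  have hξ : DifferentiableAt ℝ (gradM F) x := hX.fst
  have hξ0 : gradM F x = 0 := congrArg Prod.fst h0
  have hM := inertia.symm.toLinearMap.toContinuousLinearMap.hasFDerivAt.comp x
    hX.snd.hasFDerivAt
  have hα := differentiableAt_crossProduct (f := fun y : Phase => y.2.1) (by fun_prop) hξ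
  have hβ := differentiableAt_crossProduct (f := fun y : Phase => y.2.2) (by fun_prop) hξ
  have hsgrad := hM.prodMk (hα.hasFDerivAt.prodMk hβ.hasFDerivAt)
  refine LinearMap.ext fun v => ?_
  have hfst : fderiv ℝ (gradM F) x v = (fderiv ℝ (reducedField lam F) x v).1 :=
    congrArg (fun f => f v) (fderiv.fst hX)
  have hsnd : fderiv ℝ (fun y => (reducedField lam F y).2) x v
      = (fderiv ℝ (reducedField lam F) x v).2 := congrArg (fun f => f v) (fderiv.snd hX)
  refine (congrArg (fun f => f v) (HasFDerivAt.fderiv (f := sgrad lam F) hsgrad)).trans ?_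
  refine Prod.ext (congrArg inertia.symm hsnd) (Prod.ext ?_ ?_)
  · change fderiv ℝ (fun y : Phase => y.2.1 ⨯₃ gradM F y) x v = _
    rw [fderiv_crossProduct (by fun_prop) hξ, hξ0, map_zero, add_zero, hfst]
    rfl
  · change fderiv ℝ (fun y : Phase => y.2.2 ⨯₃ gradM F y) x v = _
    rw [fderiv_crossProduct (by fun_prop) hξ, hξ0, map_zero, add_zero, hfst]
    rfl

end Linearization

lemma fderiv_fderiv_comm {F : Phase → ℝ} (hF : ContDiff ℝ ∞ F) (x u v : Phase) :
    fderiv ℝ (fderiv ℝ F) x u v = fderiv ℝ (fderiv ℝ F) x v u :=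
  (hF.contDiffAt.isSymmSndFDerivAt (by
    rw [minSmoothness_of_isRCLikeNormedField]; exact WithTop.coe_le_coe.2 le_top)) u v

/-! ### The symplectic form -/

/-- The symplectic form of `𝒫⁶` at a point with kinetic momentum `M`, in the trivialization
`emb`. -/
def symp (M : Fin 3 → ℝ) : LinearMap.BilinForm ℝ ((Fin 3 → ℝ) × (Fin 3 → ℝ)) :=
  LinearMap.mk₂ ℝ (fun u v => u.1 ⬝ᵥ v.2 - u.2 ⬝ᵥ v.1 + M ⬝ᵥ (u.1 ⨯₃ v.1))
    (fun u u' v => by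
      simp only [Prod.fst_add, Prod.snd_add, add_dotProduct, map_add, LinearMap.add_apply,
        dotProduct_add]
      ring)
    (fun c u v => by
      simp only [Prod.smul_fst, Prod.smul_snd, smul_dotProduct, map_smul, LinearMap.smul_apply,
        dotProduct_smul, smul_eq_mul]
      ring)
    (fun u v v' => by
      simp only [Prod.fst_add, Prod.snd_add, map_add, dotProduct_add]
      ring)
    (fun c u v => by
      simp only [Prod.smul_fst, Prod.smul_snd, map_smul, dotProduct_smul, smul_eq_mul]
      ring)

lemma symp_apply (M : Fin 3 → ℝ) (u v : (Fin 3 → ℝ) × (Fin 3 → ℝ)) :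
    symp M u v = u.1 ⬝ᵥ v.2 - u.2 ⬝ᵥ v.1 + M ⬝ᵥ (u.1 ⨯₃ v.1) := rfl

lemma symp_swap (M : Fin 3 → ℝ) (u v : (Fin 3 → ℝ) × (Fin 3 → ℝ)) :
    symp M u v = -symp M v u := by
  rw [symp_apply, symp_apply, ← cross_anticomm v.1, dotProduct_neg, dotProduct_comm u.1,
    dotProduct_comm u.2]
  ring

lemma symp_separatingLeft {M : Fin 3 → ℝ} {u : (Fin 3 → ℝ) × (Fin 3 → ℝ)}
    (h : ∀ v, symp M u v = 0) : u = 0 := by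
  have hfst : u.1 = 0 := dotProduct_eq_zero _ fun w => by simpa [symp_apply] using h (0, w)
  have hsnd : u.2 = 0 := dotProduct_eq_zero _ fun w => by simpa [symp_apply, hfst] using h (w, 0)
  exact Prod.ext hfst hsnd

lemma symp_nondegenerate (M : Fin 3 → ℝ) : (symp M).Nondegenerate :=
  ⟨fun _ h => symp_separatingLeft h, fun v h => symp_separatingLeft fun u => by
    rw [symp_swap, h, neg_zero]⟩

lemma symp_reducedField (lam : ℝ) (F : Phase → ℝ) (x : Phase)
    (u : (Fin 3 → ℝ) × (Fin 3 → ℝ)) :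
    symp (momentum lam x) (reducedField lam F x) u = fderiv ℝ F x (emb x u) := by
  have hdF := fderiv_eq_grad F x (emb x u)
  rw [hdF, symp_apply]
  simp only [reducedField, momentumDot, emb_apply, momentum_eq_inertia, inertia_apply,
    inertia_symm_apply, cross_apply, dotProduct, Fin.sum_univ_three, Pi.add_apply,
    Matrix.cons_val_zero, Matrix.cons_val_one, Matrix.cons_val]
  ring

section Skewness

variable {lam : ℝ} {F : Phase → ℝ} {x : Phase}

lemma criticalAt_of_reducedField_eq_zero {a b : ℝ} (ha : a ≠ 0) (hb : b ≠ 0)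
    (hx : x ∈ phaseSpace a b) (h0 : reducedField lam F x = 0) : CriticalAt F x := by
  intro v hv
  rw [← range_emb ha hb hx] at hv
  obtain ⟨u, rfl⟩ := hv
  rw [← symp_reducedField lam, h0, map_zero, LinearMap.zero_apply]

lemma fderiv_symp_apply_of_eq_zero {X : Phase → (Fin 3 → ℝ) × (Fin 3 → ℝ)}
    (hX : DifferentiableAt ℝ X x) (h0 : X x = 0) (v : (Fin 3 → ℝ) × (Fin 3 → ℝ)) (w : Phase) :
    fderiv ℝ (fun y => symp (momentum lam y) (X y) v) x w =
      symp (momentum lam x) (fderiv ℝ X x w) v := by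
  simp only [symp_apply]
  rw [fderiv_fun_add (by fun_prop) (by fun_prop), fderiv_fun_sub (by fun_prop) (by fun_prop)]
  simp only [add_apply, sub_apply]
  rw [fderiv_dotProduct (by fun_prop) (by fun_prop), fderiv_dotProduct (by fun_prop) (by fun_prop),
    fderiv_dotProduct (by fun_prop) (by fun_prop), fderiv_crossProduct (by fun_prop) (by fun_prop),
    fderiv.fst hX, fderiv.snd hX]
  simp [h0]

lemma symp_reducedLin_left (hF : ContDiff ℝ ∞ F) (h0 : reducedField lam F x = 0)
    (u v : (Fin 3 → ℝ) × (Fin 3 → ℝ)) :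
    symp (momentum lam x) (reducedLin lam F x u) v =
      fderiv ℝ (fderiv ℝ F) x (emb x u) (emb x v)
        + fderiv ℝ F x (0, (x.2.1 ⨯₃ u.1) ⨯₃ v.1, (x.2.2 ⨯₃ u.1) ⨯₃ v.1) := by
  have hX := differentiableAt_reducedField lam hF x
  have hdF : DifferentiableAt ℝ (fderiv ℝ F) x :=
    (hF.fderiv_right (m := ∞) (by simp)).differentiable (by simp) x
  have hemb : HasFDerivAt (fun y => emb y v) ((0 : Phase →L[ℝ] Fin 3 → ℝ).prod
      ((fderiv ℝ (fun y : Phase => y.2.1 ⨯₃ v.1) x).prod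
        (fderiv ℝ (fun y : Phase => y.2.2 ⨯₃ v.1) x))) x := by
    simp only [emb_apply]
    exact (hasFDerivAt_const _ _).prodMk ((DifferentiableAt.hasFDerivAt (by fun_prop)).prodMk
      (DifferentiableAt.hasFDerivAt (by fun_prop)))
  refine (fderiv_symp_apply_of_eq_zero hX h0 v (emb x u)).symm.trans ?_
  simp only [symp_reducedField]
  rw [fderiv_clm_apply hdF hemb.differentiableAt, hemb.fderiv]
  have hα := fderiv_crossProduct (x := x) (f := fun y : Phase => y.2.1) (g := fun _ => v.1)
    (by fun_prop) (by fun_prop) (emb x u)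
  have hβ := fderiv_crossProduct (x := x) (f := fun y : Phase => y.2.2) (g := fun _ => v.1)
    (by fun_prop) (by fun_prop) (emb x u)
  simp only [fderiv_alpha, fderiv_beta, fderiv_fun_const, Pi.zero_apply, zero_apply, map_zero,
    zero_add] at hα hβ
  simp only [add_apply, ContinuousLinearMap.coe_comp, Function.comp_apply,
    ContinuousLinearMap.flip_apply, ContinuousLinearMap.prod_apply, zero_apply, hα, hβ]
  rw [add_comm]
  rfl

lemma isSkewAdjoint_reducedLin (hF : ContDiff ℝ ∞ F) (h0 : reducedField lam F x = 0) :
    (symp (momentum lam x)).IsSkewAdjoint (reducedLin lam F x) := by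
  intro u v
  have hjacobi : ∀ w : Fin 3 → ℝ,
      (w ⨯₃ u.1) ⨯₃ v.1 - (w ⨯₃ v.1) ⨯₃ u.1 = w ⨯₃ (u.1 ⨯₃ v.1) := by
    intro w
    rw [leibniz_cross w u.1, ← cross_anticomm (w ⨯₃ v.1)]
    abel
  have hdF : fderiv ℝ F x (emb x (u.1 ⨯₃ v.1, 0)) = 0 := by
    rw [← symp_reducedField lam, h0, map_zero, LinearMap.zero_apply]
  have hdiff : symp (momentum lam x) (reducedLin lam F x u) v
      - symp (momentum lam x) (reducedLin lam F x v) u = 0 := by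
    rw [symp_reducedLin_left hF h0, symp_reducedLin_left hF h0, fderiv_fderiv_comm hF,
      add_sub_add_left_eq_sub, ← map_sub, ← hdF, emb_apply]
    congr 1
    simp [hjacobi]
  rw [sub_eq_zero.1 hdiff, symp_swap]
  simp

lemma hasExponentSq_iff {a b : ℝ} (ha : a ≠ 0) (hb : b ≠ 0) (hF : ContDiff ℝ ∞ F)
    (hx : x ∈ phaseSpace a b) (h0 : reducedField lam F x = 0) (C : ℝ) :
    HasExponentSq lam F x C ↔ (reducedLin lam F x).charpoly =
      Polynomial.X ^ 4 * (Polynomial.X ^ 2 - Polynomial.C C) := by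
  have hlin := linField_eq_of_reducedField_eq_zero hF h0
  have hconj (hA : ∀ v ∈ tangent x, linField lam F x v ∈ tangent x) :
      (linField lam F x).restrict hA = (tangentEquiv ha hb hx).conj (reducedLin lam F x) := by
    refine LinearMap.ext fun v => Subtype.ext ?_
    obtain ⟨u, rfl⟩ := (tangentEquiv ha hb hx).surjective v
    rw [LinearEquiv.conj_apply_apply, LinearEquiv.symm_apply_apply, coe_tangentEquiv,
      LinearMap.coe_restrict_apply, coe_tangentEquiv, hlin]
    rfl
  constructor
  · rintro ⟨-, hA, h⟩
    rwa [hconj, LinearEquiv.charpoly_conj] at h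
  · intro h
    have hA (v : Phase) (_ : v ∈ tangent x) : linField lam F x v ∈ tangent x :=
      hlin ▸ emb_mem_tangent x _
    refine ⟨criticalAt_of_reducedField_eq_zero ha hb hx h0, hA, ?_⟩
    rwa [hconj, LinearEquiv.charpoly_conj]

end Skewness

/-! ### Integrals in involution -/

/-- The Poisson bracket, with the sign convention that `bracket lam F₁ F₂` is the derivative of `F₁`
along `sgrad F₂`. -/
def bracket (lam : ℝ) (F₁ F₂ : Phase → ℝ) (x : Phase) : ℝ := fderiv ℝ F₁ x (sgrad lam F₂ x)

section Bracket

variable (lam : ℝ) (F₁ F₂ : Phase → ℝ) (x : Phase)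

lemma bracket_eq_symp : bracket lam F₁ F₂ x =
    symp (momentum lam x) (reducedField lam F₁ x) (reducedField lam F₂ x) := by
  rw [symp_reducedField, bracket, sgrad_eq_emb]

lemma bracket_swap : bracket lam F₁ F₂ x = -bracket lam F₂ F₁ x := by
  rw [bracket_eq_symp, symp_swap, bracket_eq_symp]

lemma bracket_self : bracket lam F₁ F₁ x = 0 :=
  self_eq_neg.1 (bracket_swap lam F₁ F₁ x)

lemma bracket_combo (a b : ℝ) (c : Fin 3 → ℝ) : bracket lam F₁ (combo a b lam c) x =
    c 0 * bracket lam F₁ intH x + c 1 * bracket lam F₁ (intK lam) x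
      + c 2 * bracket lam F₁ (intG a b lam) x := by
  simp only [bracket_eq_symp, reducedField_combo, map_add, map_smul, smul_eq_mul]

lemma bracket_eq_grad : bracket lam F₁ F₂ x =
    gradM F₁ x ⬝ᵥ momentumDot lam F₂ x + gradα F₁ x ⬝ᵥ (x.2.1 ⨯₃ gradM F₂ x)
      + gradβ F₁ x ⬝ᵥ (x.2.2 ⨯₃ gradM F₂ x) := by
  have hM : inertia (sgrad lam F₂ x).1 = momentumDot lam F₂ x := inertia.apply_symm_apply _
  rw [bracket, fderiv_eq_grad, hM]
  rfl

end Bracket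

section Involution

variable {a b lam : ℝ} {x : Phase}

lemma reducedLin_reducedField_eq_zero (ha : a ≠ 0) (hb : b ≠ 0) {F₀ F : Phase → ℝ}
    (hF₀ : ContDiff ℝ ∞ F₀) (hF : ContDiff ℝ ∞ F) (hx : x ∈ phaseSpace a b)
    (h0 : reducedField lam F x = 0) (hbr : ∀ y ∈ phaseSpace a b, bracket lam F₀ F y = 0) :
    reducedLin lam F x (reducedField lam F₀ x) = 0 := by
  have hdF₀ : ContDiff ℝ ∞ (fderiv ℝ F₀) := hF₀.fderiv_right (by simp)
  have hsgrad := contDiff_sgrad lam hF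
  have hs0 : sgrad lam F x = 0 := by rw [sgrad_eq_emb, h0, map_zero]
  have hbr_deriv (v : Phase) : fderiv ℝ (bracket lam F₀ F) x v =
      fderiv ℝ F₀ x (emb x (fderiv ℝ (reducedField lam F) x v)) := by
    have hlin : fderiv ℝ (sgrad lam F) x v = emb x (fderiv ℝ (reducedField lam F) x v) :=
      DFunLike.congr_fun (linField_eq_of_reducedField_eq_zero hF h0) v
    unfold bracket
    rw [fderiv_clm_apply (hdF₀.differentiable (by simp) x) (hsgrad.differentiable (by simp) x)]
    simp [hs0, hlin]
  refine symp_separatingLeft (M := momentum lam x) fun v => ?_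
  have hskew := isSkewAdjoint_reducedLin hF h0 (reducedField lam F₀ x) v
  rw [hskew, Pi.neg_apply, map_neg, neg_eq_zero, symp_reducedField]
  refine (hbr_deriv (emb x v)).symm.trans ?_
  refine fderiv_eq_zero_of_forall_level_eq_zero
    (contDiff_geom.contDiffAt.hasStrictFDerivAt (by simp)) (fderiv_geom_surjective ha hb hx)
    ((hdF₀.clm_apply hsgrad).contDiffAt.hasStrictFDerivAt (by simp))
    (fun y hy => hbr y (hy.trans hx)) (emb_mem_tangent x v)

/-- The plane spanned by `X_{F₁}`, `X_{F₂}` is isotropic and is killed by the linearization of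
`X_F`. -/
theorem charpoly_reducedLin_of_involution (ha : a ≠ 0) (hb : b ≠ 0) {F F₁ F₂ : Phase → ℝ}
    (hF : ContDiff ℝ ∞ F) (hF₁ : ContDiff ℝ ∞ F₁) (hF₂ : ContDiff ℝ ∞ F₂)
    (hx : x ∈ phaseSpace a b) (h0 : reducedField lam F x = 0)
    (hbr₁ : ∀ y ∈ phaseSpace a b, bracket lam F₁ F y = 0)
    (hbr₂ : ∀ y ∈ phaseSpace a b, bracket lam F₂ F y = 0) (hbr : bracket lam F₁ F₂ x = 0)
    (hind : LinearIndependent ℝ ![reducedField lam F₁ x, reducedField lam F₂ x]) :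
    (reducedLin lam F x).charpoly = Polynomial.X ^ 4 * (Polynomial.X ^ 2 -
      Polynomial.C (LinearMap.trace ℝ _ (reducedLin lam F x ∘ₗ reducedLin lam F x) / 2)) := by
  set P := Submodule.span ℝ {reducedField lam F₁ x, reducedField lam F₂ x}
  have hfinrank : Module.finrank ℝ P = 2 := by
    have hcard := finrank_span_eq_card hind
    rwa [Matrix.range_cons, Matrix.range_cons, Matrix.range_empty, Set.union_empty,
      Set.singleton_union, Fintype.card_fin] at hcard
  have hisotropic : P ≤ (symp (momentum lam x)).orthogonal P := by
    refine span_le_orthogonal_span ?_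
    rintro _ (rfl | rfl) _ (rfl | rfl) <;> rw [← bracket_eq_symp]
    · exact bracket_self ..
    · exact hbr
    · rw [bracket_swap, hbr, neg_zero]
    · exact bracket_self ..
  have hker : P ≤ LinearMap.ker (reducedLin lam F x) := by
    rw [Submodule.span_le]
    rintro _ (rfl | rfl)
    · exact reducedLin_reducedField_eq_zero ha hb hF₁ hF hx h0 hbr₁
    · exact reducedLin_reducedField_eq_zero ha hb hF₂ hF hx h0 hbr₂
  have hcharpoly := charpoly_of_isSkewAdjoint_of_isotropic_le_ker two_ne_zero
    (symp_nondegenerate _) (isSkewAdjoint_reducedLin hF h0) hisotropic hker (by simp [hfinrank])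
  rwa [hfinrank] at hcharpoly

lemma bracket_intH_intK (lam : ℝ) (x : Phase) : bracket lam intH (intK lam) x = 0 := by
  obtain ⟨hHM, hHα, hHβ⟩ := grad_intH x
  obtain ⟨hKM, hKα, hKβ⟩ := grad_intK lam x
  rw [bracket_eq_grad, momentumDot, hHM, hHα, hHβ, hKM, hKα, hKβ]
  simp only [momentum, cross_apply, dotProduct, Fin.sum_univ_three, Pi.add_apply, Matrix.cons_val]
  ring

lemma bracket_intH_intG (hx : x ∈ phaseSpace a b) : bracket lam intH (intG a b lam) x = 0 := by
  obtain ⟨hα, hβ, hαβ⟩ := mem_phaseSpace.1 hx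
  obtain ⟨hHM, hHα, hHβ⟩ := grad_intH x
  obtain ⟨hGM, hGα, hGβ⟩ := grad_intG a b lam x
  rw [bracket_eq_grad, momentumDot, hHM, hHα, hHβ, hGM, hGα, hGβ, ← hα, ← hβ]
  obtain ⟨w, α, β⟩ := x
  simp only [momentum, cross_apply, dotProduct, Fin.sum_univ_three, Pi.add_apply, Pi.sub_apply,
    Pi.smul_apply, smul_eq_mul, Matrix.cons_val] at hαβ ⊢
  generalize w 0 = w₁, w 1 = w₂, w 2 = w₃, α 0 = α₁, α 1 = α₂, α 2 = α₃, β 0 = β₁, β 1 = β₂,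
    β 2 = β₃ at *
  linear_combination (α₃ * w₁ - α₁ * w₃ + β₂ * w₃ - β₃ * w₂) * hαβ

lemma bracket_intK_intG (hx : x ∈ phaseSpace a b) :
    bracket lam (intK lam) (intG a b lam) x = 0 := by
  obtain ⟨hα, hβ, hαβ⟩ := mem_phaseSpace.1 hx
  obtain ⟨hKM, hKα, hKβ⟩ := grad_intK lam x
  obtain ⟨hGM, hGα, hGβ⟩ := grad_intG a b lam x
  have hcasimir : bracket lam (intK lam) (intG a b lam) x =
      (x.2.1 ⬝ᵥ x.2.2) *
        ((x.2.1 ⨯₃ gradM (intK lam) x) 1 + (x.2.2 ⨯₃ gradM (intK lam) x) 0) := by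
    rw [bracket_eq_grad, momentumDot, hKM, hKα, hKβ, hGM, hGα, hGβ, ← hα, ← hβ]
    clear hα hβ hαβ hKM hKα hKβ hGM hGα hGβ hx
    obtain ⟨w, α, β⟩ := x
    simp only [momentum, cross_apply, dotProduct, Fin.sum_univ_three, Pi.add_apply, Pi.sub_apply,
      Pi.smul_apply, smul_eq_mul, Matrix.cons_val]
    generalize w 0 = w₁, w 1 = w₂, w 2 = w₃, α 0 = α₁, α 1 = α₂, α 2 = α₃, β 0 = β₁, β 1 = β₂,
      β 2 = β₃
    ring
  rw [hcasimir, hαβ, zero_mul]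

theorem charpoly_reducedLin_combo (ha : a ≠ 0) (hb : b ≠ 0) (hx : x ∈ phaseSpace a b)
    {c : Fin 3 → ℝ} (h0 : reducedField lam (combo a b lam c) x = 0)
    (hind : LinearIndependent ℝ ![reducedField lam intH x, reducedField lam (intK lam) x]) :
    (reducedLin lam (combo a b lam c) x).charpoly = Polynomial.X ^ 4 * (Polynomial.X ^ 2 -
      Polynomial.C (LinearMap.trace ℝ _ (reducedLin lam (combo a b lam c) x ∘ₗ
        reducedLin lam (combo a b lam c) x) / 2)) := by
  refine charpoly_reducedLin_of_involution ha hb (contDiff_combo a b lam c) contDiff_intH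
    (contDiff_intK lam) hx h0 (fun y hy => ?_) (fun y hy => ?_) (bracket_intH_intK lam x) hind
  · rw [bracket_combo, bracket_self, bracket_intH_intK, bracket_intH_intG hy]
    ring
  · rw [bracket_combo, bracket_self, bracket_swap, bracket_intH_intK, bracket_intK_intG hy]
    ring

end Involution

/-! ### The field of `L` in complex coordinates -/

/-- Values of the complex coordinates, with `x₁, x₂` etc. regarded as independent variables. -/
@[ext]
structure Coords where
  (x₁ x₂ y₁ y₂ z₁ z₂ w₁ w₂ w₃ : ℂ)

/-- The complex coordinates of a point of `ℝ⁹`. -/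
def coords (y : Phase) : Coords :=
  ⟨cx₁ y, cx₂ y, cy₁ y, cy₂ y, cz₁ y, cz₂ y, cw₁ y, cw₂ y, cw₃ y⟩

/-- The exchange of the indices 1 and 2, which is complex conjugation on the points of `ℝ⁹`. -/
def Coords.swap (q : Coords) : Coords :=
  ⟨q.x₂, q.x₁, q.y₂, q.y₁, q.z₂, q.z₁, q.w₂, q.w₁, q.w₃⟩

/-- The combination `φ₁ + i φ₂` of the components of `(φ, ψ) = (L_M, Ṁ)`, where `Ṁ` is the
derivative along `sgrad L`. -/
def phi₁ (l s p : ℂ) (q : Coords) : ℂ :=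
  1 / 2 * q.x₁ * q.x₂ * q.w₁ + q.x₁ * q.y₁ * q.w₂ + q.x₁ * q.z₂ * q.w₃ + 2 * q.x₁ * q.w₂ * s
    + 1 / 2 * q.y₁ * q.y₂ * q.w₁ + q.y₁ * q.z₁ * l + 2 * q.z₁ * s * l + 2 * q.w₁ ^ 2 * q.w₂ * s
    + 2 * q.w₁ * q.w₃ * s * l - q.w₁ * p

/-- The component `φ₃` of `(φ, ψ) = (L_M, Ṁ)`. -/
def phi₃ (l s p : ℂ) (q : Coords) : ℂ :=
  -1 / 2 * q.x₁ * q.x₂ * q.w₃ + q.x₁ * q.z₂ * q.w₂ + q.x₂ * q.z₁ * q.w₁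
    + 1 / 2 * q.y₁ * q.y₂ * q.w₃ + q.z₁ * q.z₂ * q.w₃ + q.z₁ * q.z₂ * l
    + 2 * q.w₁ * q.w₂ * s * l + 2 * q.w₃ * s * l ^ 2 - q.w₃ * p

/-- The combination `-i (ψ₁ + i ψ₂)` of the components of `(φ, ψ) = (L_M, Ṁ)`. -/
def psi₁ (l s p r : ℂ) (q : Coords) : ℂ :=
  1 / 2 * q.x₁ * q.x₂ * q.w₁ * q.w₃ + 1 / 2 * q.x₁ * q.x₂ * q.w₁ * l
    - q.x₁ * q.z₂ * q.w₁ * q.w₂ + 2 * q.x₁ * q.z₂ * s + 2 * q.x₁ * q.w₂ * q.w₃ * s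
    - q.x₂ * q.z₁ * q.w₁ ^ 2 - 1 / 2 * q.y₁ * q.y₂ * q.w₁ * q.w₃
    - 1 / 2 * q.y₁ * q.y₂ * q.w₁ * l + q.y₁ * q.z₁ * q.w₁ * q.w₂ - 2 * q.y₁ * q.w₁ * s * l
    + q.y₂ * q.z₂ * q.w₁ ^ 2 + 2 * q.z₁ * q.w₃ * s * l + 2 * q.z₂ * q.w₁ ^ 2 * s + q.z₂ * r
    + 2 * q.w₁ ^ 2 * q.w₂ * q.w₃ * s - 2 * q.w₁ ^ 2 * q.w₂ * s * l
    + 2 * q.w₁ * q.w₃ ^ 2 * s * l - 2 * q.w₁ * q.w₃ * s * l ^ 2 + q.w₁ * q.w₃ * p - q.w₁ * l * p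

/-- The combination `-i ψ₃` of the components of `(φ, ψ) = (L_M, Ṁ)`. -/
def psi₃ (l s r : ℂ) (q : Coords) : ℂ :=
  -q.x₁ * q.w₂ ^ 2 * s + 1 / 2 * q.x₁ * r + q.x₂ * q.w₁ ^ 2 * s - 1 / 2 * q.x₂ * r
    - q.y₁ * s * l ^ 2 + q.y₂ * s * l ^ 2 - 2 * q.z₁ * q.w₂ * s * l + 2 * q.z₂ * q.w₁ * s * l

/-- The field `(L_M, Ṁ)` of the integral `L` in the complex coordinates `complexify`, as a
polynomial in the complex coordinates of the point and in `l = λ`, `s`, `p = p²`, `r = r²`. -/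
def fieldL (l s p r : ℂ) (q : Coords) : Fin 3 ⊕ Fin 3 → ℂ :=
  Sum.elim ![phi₁ l s p q, phi₁ l s p q.swap, phi₃ l s p q]
    ![psi₁ l s p r q, -psi₁ l s p r q.swap, psi₃ l s r q]

section Complexification

open Complex Matrix

/-- Complex coordinates on the pairs `(ξ, m) ∈ ℝ³ × ℝ³`; the factor `-i` in the second half makes
the coefficients of `fieldL` real. -/
def complexify : ((Fin 3 → ℝ) × (Fin 3 → ℝ)) →ₗ[ℝ] (Fin 3 ⊕ Fin 3 → ℂ) where
  toFun u := Sum.elim ![u.1 0 + u.1 1 * I, u.1 0 - u.1 1 * I, u.1 2]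
    ![-I * (u.2 0 + u.2 1 * I), -I * (u.2 0 - u.2 1 * I), -I * u.2 2]
  map_add' u v := by
    ext k
    rcases k with k | k <;> fin_cases k <;> simp <;> ring
  map_smul' t u := by
    ext k
    rcases k with k | k <;> fin_cases k <;> simp <;> ring

lemma complexify_apply (u : (Fin 3 → ℝ) × (Fin 3 → ℝ)) :
    complexify u = Sum.elim ![(u.1 0 : ℂ) + u.1 1 * I, u.1 0 - u.1 1 * I, u.1 2]
      ![-I * (u.2 0 + u.2 1 * I), -I * (u.2 0 - u.2 1 * I), -I * u.2 2] := rfl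

lemma complexify_injective : Function.Injective complexify := by
  rw [← LinearMap.ker_eq_bot, LinearMap.ker_eq_bot']
  intro u hu
  rw [complexify_apply] at hu
  have hξ₁ := congrFun hu (Sum.inl 0)
  have hξ₃ := congrFun hu (Sum.inl 2)
  have hm₁ := congrFun hu (Sum.inr 0)
  have hm₃ := congrFun hu (Sum.inr 2)
  simp [Complex.ext_iff] at hξ₁ hξ₃ hm₁ hm₃
  ext i
  · fin_cases i <;> simp [hξ₁, hξ₃]
  · fin_cases i <;> simp [hm₁, hm₃]

variable (a b lam s : ℝ) (y : Phase)

lemma gradM_eq_phi :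
    (gradM (combo a b lam (coeffL a b lam s)) y 0 : ℂ)
        + gradM (combo a b lam (coeffL a b lam s)) y 1 * I =
      phi₁ lam s (a ^ 2 + b ^ 2) (coords y) ∧
    (gradM (combo a b lam (coeffL a b lam s)) y 0 : ℂ)
        - gradM (combo a b lam (coeffL a b lam s)) y 1 * I =
      phi₁ lam s (a ^ 2 + b ^ 2) (coords y).swap ∧
    (gradM (combo a b lam (coeffL a b lam s)) y 2 : ℂ) =
      phi₃ lam s (a ^ 2 + b ^ 2) (coords y) := by
  simp only [gradM_combo, (grad_intH y).1, (grad_intK lam y).1, (grad_intG a b lam y).1, coeffL,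
    momentum, cross_apply, dotProduct, Fin.sum_univ_three, Pi.add_apply, Pi.smul_apply,
    smul_eq_mul, Matrix.cons_val]
  refine ⟨?_, ?_, ?_⟩ <;> apply Complex.ext <;>
  · simp [phi₁, phi₃, Coords.swap, coords, cx₁, cx₂, cy₁, cy₂, cz₁, cz₂, cw₁, cw₂, cw₃, pow_two]
    ring

lemma momentumDot_eq_psi :
    -I * ((momentumDot lam (combo a b lam (coeffL a b lam s)) y 0 : ℂ)
        + momentumDot lam (combo a b lam (coeffL a b lam s)) y 1 * I) =
      psi₁ lam s (a ^ 2 + b ^ 2) (a ^ 2 - b ^ 2) (coords y) ∧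
    -I * ((momentumDot lam (combo a b lam (coeffL a b lam s)) y 0 : ℂ)
        - momentumDot lam (combo a b lam (coeffL a b lam s)) y 1 * I) =
      -psi₁ lam s (a ^ 2 + b ^ 2) (a ^ 2 - b ^ 2) (coords y).swap ∧
    -I * (momentumDot lam (combo a b lam (coeffL a b lam s)) y 2 : ℂ) =
      psi₃ lam s (a ^ 2 - b ^ 2) (coords y) := by
  obtain ⟨hHM, hHα, hHβ⟩ := grad_intH y
  obtain ⟨hKM, hKα, hKβ⟩ := grad_intK lam y
  obtain ⟨hGM, hGα, hGβ⟩ := grad_intG a b lam y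
  simp only [momentumDot, gradM_combo, gradα_combo, gradβ_combo, hHM, hHα, hHβ, hKM, hKα, hKβ,
    hGM, hGα, hGβ, coeffL, momentum, cross_apply, dotProduct, Fin.sum_univ_three, Pi.add_apply,
    Pi.sub_apply, Pi.smul_apply, smul_eq_mul, Matrix.cons_val]
  refine ⟨?_, ?_, ?_⟩ <;> apply Complex.ext <;>
  · simp [psi₁, psi₃, Coords.swap, coords, cx₁, cx₂, cy₁, cy₂, cz₁, cz₂, cw₁, cw₂, cw₃, pow_two]
    ring

lemma complexify_reducedField :
    complexify (reducedField lam (combo a b lam (coeffL a b lam s)) y) =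
      fieldL lam s (a ^ 2 + b ^ 2) (a ^ 2 - b ^ 2) (coords y) := by
  obtain ⟨hφ₁, hφ₂, hφ₃⟩ := gradM_eq_phi a b lam s y
  obtain ⟨hψ₁, hψ₂, hψ₃⟩ := momentumDot_eq_psi a b lam s y
  rw [complexify_apply, fieldL, ← hφ₁, ← hφ₂, ← hφ₃, ← hψ₁, ← hψ₂, ← hψ₃]
  rfl

end Complexification

section Linearization

open Complex Matrix

/-- The displacement of a point of `𝒫⁶` by `τ / i` times the tangent vector `v`, in complex
coordinates. -/
def Coords.shift (q : Coords) (v : Fin 3 ⊕ Fin 3 → ℂ) (τ : ℂ) : Coords where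
  x₁ := q.x₁ + τ * (v (.inl 0) * q.z₁ - v (.inl 2) * q.x₁)
  x₂ := q.x₂ + τ * (v (.inl 2) * q.x₂ - v (.inl 1) * q.z₂)
  y₁ := q.y₁ + τ * (v (.inl 0) * q.z₂ - v (.inl 2) * q.y₁)
  y₂ := q.y₂ + τ * (v (.inl 2) * q.y₂ - v (.inl 1) * q.z₁)
  z₁ := q.z₁ + τ * ((v (.inl 1) * q.x₁ - v (.inl 0) * q.y₂) / 2)
  z₂ := q.z₂ + τ * ((v (.inl 1) * q.y₁ - v (.inl 0) * q.x₂) / 2)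
  w₁ := q.w₁ + τ * (v (.inr 0) / 2)
  w₂ := q.w₂ + τ * (v (.inr 1) / 2)
  w₃ := q.w₃ + τ * v (.inr 2)

lemma coords_add_smul_emb (x : Phase) (u : (Fin 3 → ℝ) × (Fin 3 → ℝ)) (t : ℝ) :
    coords (x + t • emb x u) = (coords x).shift (complexify u) (t * I) := by
  rw [complexify_apply]
  ext <;> apply Complex.ext <;>
    simp [coords, Coords.shift, cx₁, cx₂, cy₁, cy₂, cz₁, cz₂, cw₁, cw₂, cw₃, emb_apply,
      inertia_symm_apply, cross_apply, -mul_eq_mul_left_iff] <;> ring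

lemma complexify_reducedLin {a b lam s : ℝ} {x : Phase} {u : (Fin 3 → ℝ) × (Fin 3 → ℝ)}
    {c : Fin 3 ⊕ Fin 3 → ℂ}
    (hc : ∀ k, HasDerivAt (fun τ => fieldL lam s (a ^ 2 + b ^ 2) (a ^ 2 - b ^ 2)
      ((coords x).shift (complexify u) τ) k) (c k) 0) :
    complexify (reducedLin lam (combo a b lam (coeffL a b lam s)) x u) = I • c := by
  have hline : HasLineDerivAt ℝ (reducedField lam (combo a b lam (coeffL a b lam s)))
      (reducedLin lam (combo a b lam (coeffL a b lam s)) x u) x (emb x u) :=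
    (differentiableAt_reducedField lam (contDiff_combo a b lam _) x).hasFDerivAt.hasLineDerivAt _
  have hderiv : HasDerivAt (fun t : ℝ => complexify
      (reducedField lam (combo a b lam (coeffL a b lam s)) (x + t • emb x u)))
      (complexify (reducedLin lam (combo a b lam (coeffL a b lam s)) x u)) 0 :=
    complexify.toContinuousLinearMap.hasFDerivAt.comp_hasDerivAt 0 hline
  simp only [complexify_reducedField, coords_add_smul_emb] at hderiv
  ext k
  have hτ : HasDerivAt (fun t : ℝ => (t : ℂ) * I) I 0 := by
    simpa using (Complex.ofRealCLM.hasDerivAt (x := 0)).mul_const I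
  have hc' := HasDerivAt.comp (𝕜' := ℂ) (0 : ℝ) (by simpa using hc k) hτ
  rw [(hasDerivAt_pi.1 hderiv k).unique hc', Pi.smul_apply, smul_eq_mul, mul_comm]

lemma ofReal_trace_of_semiconj {V W ι : Type*} [AddCommGroup V] [Module ℝ V] [AddCommGroup W]
    [Module ℂ W] [Finite ι] (B : Module.Basis ι ℝ V) (B' : Module.Basis ι ℂ W)
    (Θ : V →ₗ[ℝ] W) (hΘ : ∀ j, Θ (B j) = B' j) (A : V →ₗ[ℝ] V) (A' : W →ₗ[ℂ] W)
    (hA : ∀ v, Θ (A v) = A' (Θ v)) :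
    ((LinearMap.trace ℝ V A : ℝ) : ℂ) = LinearMap.trace ℂ W A' := by
  classical
  have := Fintype.ofFinite ι
  have hmatrix : LinearMap.toMatrix B' B' A' = (LinearMap.toMatrix B B A).map (↑) := by
    ext i j
    have hcol : A' (B' j) = ∑ k, (LinearMap.toMatrix B B A k j : ℂ) • B' k := by
      rw [← hΘ, ← hA, ← B.sum_repr (A (B j)), map_sum]
      simp only [map_smul, hΘ, LinearMap.toMatrix_apply, Complex.coe_smul]
    rw [LinearMap.toMatrix_apply, hcol, B'.repr_sum_self, Matrix.map_apply]
  rw [LinearMap.trace_eq_matrix_trace ℝ B, LinearMap.trace_eq_matrix_trace ℂ B', hmatrix]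
  exact Complex.ofReal_sum _ _

lemma linearIndependent_complexify : LinearIndependent ℂ
    (complexify ∘ (Pi.basisFun ℝ (Fin 3)).prod (Pi.basisFun ℝ (Fin 3))) := by
  rw [Fintype.linearIndependent_iff]
  intro c hc
  simp only [Fintype.sum_sum_type, Fin.sum_univ_three, funext_iff, Sum.forall,
    Fin.forall_fin_succ] at hc
  obtain ⟨⟨hξ₁, hξ₂, hξ₃⟩, hm₁, hm₂, hm₃⟩ :
      (c (.inl 0) + c (.inl 1) * I = 0 ∧ c (.inl 0) + -(c (.inl 1) * I) = 0 ∧ c (.inl 2) = 0) ∧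
        -(c (.inr 0) * I) + c (.inr 1) = 0 ∧ -(c (.inr 0) * I) + -c (.inr 1) = 0 ∧
        c (.inr 2) = 0 := by
    simpa [complexify_apply] using hc
  have hI : I * I = -1 := I_mul_I
  rintro (j | j) <;> fin_cases j
  · change c (.inl 0) = 0
    linear_combination (hξ₁ + hξ₂) / 2
  · change c (.inl 1) = 0
    linear_combination -I / 2 * (hξ₁ - hξ₂) + c (.inl 1) * hI
  · exact hξ₃
  · change c (.inr 0) = 0
    linear_combination I / 2 * (hm₁ + hm₂) + c (.inr 0) * hI
  · change c (.inr 1) = 0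
    linear_combination (hm₁ - hm₂) / 2
  · exact hm₃

lemma ofReal_trace_comp_self_of_complexify
    {A : (Fin 3 → ℝ) × (Fin 3 → ℝ) →ₗ[ℝ] (Fin 3 → ℝ) × (Fin 3 → ℝ)}
    {C : Matrix (Fin 3 ⊕ Fin 3) (Fin 3 ⊕ Fin 3) ℂ}
    (hA : ∀ u, complexify (A u) = I • (C *ᵥ complexify u)) :
    ((LinearMap.trace ℝ _ (A ∘ₗ A) : ℝ) : ℂ) = -(C * C).trace := by
  let B := (Pi.basisFun ℝ (Fin 3)).prod (Pi.basisFun ℝ (Fin 3))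
  let B' := basisOfLinearIndependentOfCardEqFinrank linearIndependent_complexify
    (Module.finrank_pi ℂ).symm
  have htrace := ofReal_trace_of_semiconj B B' complexify
    (fun j => by rw [coe_basisOfLinearIndependentOfCardEqFinrank]; rfl) (A ∘ₗ A)
    (-(C * C).toLin') fun u => by
      simp only [LinearMap.comp_apply, hA, Matrix.mulVec_smul, smul_smul, I_mul_I, neg_smul,
        one_smul, LinearMap.neg_apply, toLin'_apply, Matrix.mulVec_mulVec]
  rw [htrace, map_neg, trace_toLin'_eq]

end Linearization

/-! ### Rational parametrization of `𝓜₂` -/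

section Parametrization

open Matrix

/-- Parameters of a generic point of `𝓜₂`. -/
structure Params where
  (x₁ x₂ e₁ e₂ f₁ f₂ : ℂ)

/-- The exchange of the indices 1 and 2. -/
def Params.swap (c : Params) : Params := ⟨c.x₂, c.x₁, c.e₂, c.e₁, c.f₂, c.f₁⟩

/-- The rational parametrization of `𝓜₂`, for `l = λ` and the parameter `s` of `Π₂`. -/
def param (l s : ℂ) (c : Params) : Coords where
  x₁ := c.x₁
  x₂ := c.x₂
  y₁ := -2 * s * c.x₁ * c.e₂ ^ 2 - 4 * l * s * c.e₂ * c.f₁ - c.x₂ * c.f₁ ^ 2 - 2 * s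
  y₂ := -2 * s * c.x₂ * c.e₁ ^ 2 - 4 * l * s * c.e₁ * c.f₂ - c.x₁ * c.f₂ ^ 2 - 2 * s
  z₁ := -2 * l * s * c.e₁ - c.x₁ * c.f₂
  z₂ := -2 * l * s * c.e₂ - c.x₂ * c.f₁
  w₁ := c.x₁ * c.e₂ + l * c.f₁
  w₂ := c.x₂ * c.e₁ + l * c.f₂
  w₃ := -2 * l * s * c.e₁ * c.e₂ - c.x₁ * c.e₂ * c.f₂ - c.x₂ * c.e₁ * c.f₁ - l * c.f₁ * c.f₂

/-- The constant `p²` as a function of the complex coordinates. -/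
def Coords.p2 (q : Coords) : ℂ := (q.x₁ * q.x₂ + q.y₁ * q.y₂) / 2 + q.z₁ * q.z₂

/-- The Hamiltonian as a function of the complex coordinates. -/
def Coords.h (q : Coords) : ℂ := q.w₁ * q.w₂ + q.w₃ ^ 2 / 2 - (q.y₁ + q.y₂) / 2

/-- The factor `x₁x₂ - 2λ²s` of the linearized field. -/
def Params.scale (l s : ℂ) (c : Params) : ℂ := c.x₁ * c.x₂ - 2 * l ^ 2 * s

/-- The condition that a parametrized point has the constants `p = p²` and `r = r²`. -/
structure Params.IsAdmissible (l s p r : ℂ) (c : Params) : Prop where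
  p_eq : p = (param l s c).p2
  r_eq₁ : r = -2 * s * (c.x₁ + c.scale l s * c.e₁ ^ 2)
  r_eq₂ : r = -2 * s * (c.x₂ + c.scale l s * c.e₂ ^ 2)

variable {l s p r : ℂ} {c : Params}

lemma param_swap (l s : ℂ) (c : Params) : param l s c.swap = (param l s c).swap := by
  ext <;> (simp only [param, Params.swap, Coords.swap]; try ring)

lemma Params.scale_swap (l s : ℂ) (c : Params) : c.swap.scale l s = c.scale l s := by
  simp only [scale, swap, mul_comm]

lemma Params.IsAdmissible.swap (hc : c.IsAdmissible l s p r) : c.swap.IsAdmissible l s p r where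
  p_eq := by
    rw [hc.p_eq, param_swap]
    simp only [Coords.p2, Coords.swap, mul_comm]
  r_eq₁ := by rw [scale_swap]; exact hc.r_eq₂
  r_eq₂ := by rw [scale_swap]; exact hc.r_eq₁

lemma Params.IsAdmissible.r_sq (hc : c.IsAdmissible l s p r) :
    r ^ 2 = 4 * s ^ 2 * (c.x₁ + c.scale l s * c.e₁ ^ 2) * (c.x₂ + c.scale l s * c.e₂ ^ 2) := by
  linear_combination r * hc.r_eq₁ - 2 * s * (c.x₁ + c.scale l s * c.e₁ ^ 2) * hc.r_eq₂

lemma phi₁_param (hc : c.IsAdmissible l s p r) : phi₁ l s p (param l s c) = 0 := by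
  simp only [hc.p_eq, phi₁, param, Coords.p2]
  ring

lemma phi₃_param (hc : c.IsAdmissible l s p r) : phi₃ l s p (param l s c) = 0 := by
  simp only [hc.p_eq, phi₃, param, Coords.p2]
  ring

lemma psi₁_param (hc : c.IsAdmissible l s p r) : psi₁ l s p r (param l s c) = 0 := by
  have hr₁ := hc.r_eq₁
  simp only [hc.p_eq, psi₁, param, Coords.p2, Params.scale] at hr₁ ⊢
  linear_combination (-2 * l * s * c.e₂ - c.x₂ * c.f₁) * hr₁

lemma psi₃_param (hc : c.IsAdmissible l s p r) : psi₃ l s r (param l s c) = 0 := by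
  have hr₁ := hc.r_eq₁
  have hr₂ := hc.r_eq₂
  simp only [psi₃, param, Params.scale] at hr₁ hr₂ ⊢
  linear_combination 1 / 2 * c.x₁ * hr₂ - 1 / 2 * c.x₂ * hr₁

lemma fieldL_param (hc : c.IsAdmissible l s p r) : fieldL l s p r (param l s c) = 0 := by
  rw [fieldL, ← param_swap, phi₁_param hc, phi₁_param hc.swap, phi₃_param hc, psi₁_param hc,
    psi₁_param hc.swap, psi₃_param hc]
  ext k
  rcases k with k | k <;> fin_cases k <;> simp

/-- The exchange of the indices 1 and 2 on the tangent vectors in the coordinates `complexify`. -/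
def reflect (v : Fin 3 ⊕ Fin 3 → ℂ) : Fin 3 ⊕ Fin 3 → ℂ :=
  Sum.elim ![v (.inl 1), v (.inl 0), v (.inl 2)] ![-v (.inr 1), -v (.inr 0), -v (.inr 2)]

lemma reflect_dotProduct_reflect (u v : Fin 3 ⊕ Fin 3 → ℂ) :
    reflect u ⬝ᵥ reflect v = u ⬝ᵥ v := by
  simp only [reflect, dotProduct, Fintype.sum_sum_type, Fin.sum_univ_three, Sum.elim_inl,
    Sum.elim_inr, cons_val]
  ring

lemma reflect_reflect (v : Fin 3 ⊕ Fin 3 → ℂ) : reflect (reflect v) = v := by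
  ext k
  rcases k with k | k <;> fin_cases k <;> simp [reflect]

lemma reflect_neg (v : Fin 3 ⊕ Fin 3 → ℂ) : reflect (-v) = -reflect v := by
  ext k
  rcases k with k | k <;> fin_cases k <;> simp [reflect]

lemma swap_shift (q : Coords) (v : Fin 3 ⊕ Fin 3 → ℂ) (τ : ℂ) :
    (q.shift v τ).swap = q.swap.shift (reflect v) (-τ) := by
  ext <;> simp only [Coords.shift, Coords.swap, reflect, Sum.elim_inl, Sum.elim_inr, cons_val] <;>
    ring

/-- With `colB` and `colC`, spans the image of the linearized field. -/
def colA (l s : ℂ) (c : Params) : Fin 3 ⊕ Fin 3 → ℂ :=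
  Sum.elim ![c.f₁, c.f₂, 1]
    ![-2 * c.x₁ * s * c.e₁ * c.e₂ ^ 2 - c.x₁ * c.e₂ * c.f₁ * c.f₂ - c.x₁ * c.e₂
        - 2 * s * l * c.e₁ * c.e₂ * c.f₁ - 2 * s * c.e₁ - l * c.f₁ ^ 2 * c.f₂ - l * c.f₁,
      2 * c.x₂ * s * c.e₁ ^ 2 * c.e₂ + c.x₂ * c.e₁ * c.f₁ * c.f₂ + c.x₂ * c.e₁
        + 2 * s * l * c.e₁ * c.e₂ * c.f₂ + 2 * s * c.e₂ + l * c.f₁ * c.f₂ ^ 2 + l * c.f₂,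
      0]

/-- With `colA` and `colC`, spans the image of the linearized field. -/
def colB (l : ℂ) (c : Params) : Fin 3 ⊕ Fin 3 → ℂ :=
  Sum.elim ![2 * c.e₁, 0, 0]
    ![-2 * c.x₁ * c.e₁ * c.e₂ * c.f₂ - 2 * l * c.e₁ * c.f₁ * c.f₂,
      2 * c.x₂ * c.e₁ ^ 2 * c.f₂ + 2 * l * c.e₁ * c.f₂ ^ 2 + 2 * c.f₂, 1]

/-- With `colA` and `colB`, spans the image of the linearized field. -/
def colC (l : ℂ) (c : Params) : Fin 3 ⊕ Fin 3 → ℂ := -reflect (colB l c.swap)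

/-- The coefficient covector of `colA` in the linearized field. -/
def rowU (s : ℂ) (c : Params) : Fin 3 ⊕ Fin 3 → ℂ :=
  Sum.elim
    ![-1 / 2 * c.x₁ * c.e₂ * c.f₂ ^ 2 + c.x₂ * s * c.e₁ ^ 2 * c.e₂ - 1 / 2 * c.x₂ * c.e₁
        + s * c.e₂,
      -c.x₁ * s * c.e₁ * c.e₂ ^ 2 + 1 / 2 * c.x₁ * c.e₂ + 1 / 2 * c.x₂ * c.e₁ * c.f₁ ^ 2
        - s * c.e₁,
      -c.x₁ * c.e₂ * c.f₂ + c.x₂ * c.e₁ * c.f₁]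
    ![-1 / 2 * c.f₂, -1 / 2 * c.f₁, -1]

/-- The coefficient covector of `colB` in the linearized field. -/
def rowV (l s : ℂ) (c : Params) : Fin 3 ⊕ Fin 3 → ℂ :=
  Sum.elim
    ![c.x₁ * s * c.e₂ ^ 2 * c.f₂ + 2 * s ^ 2 * l * c.e₁ * c.e₂ ^ 2 - s * l * c.e₂,
      c.x₁ * s * c.e₂ ^ 2 * c.f₁ + s * l * c.e₂ * c.f₁ ^ 2 + s * c.f₁,
      2 * c.x₁ * s * c.e₂ ^ 2 + 2 * s * l * c.e₂ * c.f₁ + s]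
    ![s * c.e₂, 0, 0]

/-- The coefficient covector of `colC` in the linearized field. -/
def rowW (l s : ℂ) (c : Params) : Fin 3 ⊕ Fin 3 → ℂ := reflect (rowV l s c.swap)

/-- The matrix of the linearized field in the coordinates `complexify`, up to the factor `i`. -/
def linMatrix (l s : ℂ) (c : Params) : Matrix (Fin 3 ⊕ Fin 3) (Fin 3 ⊕ Fin 3) ℂ :=
  c.scale l s • (vecMulVec (colA l s c) (rowU s c) + vecMulVec (colB l c) (rowV l s c)
    + vecMulVec (colC l c) (rowW l s c))

lemma linMatrix_mulVec_apply (l s : ℂ) (c : Params) (v : Fin 3 ⊕ Fin 3 → ℂ)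
    (k : Fin 3 ⊕ Fin 3) : (linMatrix l s c *ᵥ v) k =
      c.scale l s * (colA l s c k * (rowU s c ⬝ᵥ v) + colB l c k * (rowV l s c ⬝ᵥ v)
        + colC l c k * (rowW l s c ⬝ᵥ v)) := by
  simp only [linMatrix, smul_mulVec, add_mulVec, vecMulVec_mulVec, Pi.smul_apply, Pi.add_apply,
    smul_eq_mul, MulOpposite.smul_eq_mul_unop, MulOpposite.unop_op]

end Parametrization

section LinearizationParam

open Matrix

variable {l s p r : ℂ} {c : Params}

lemma colA_swap (l s : ℂ) (c : Params) : colA l s c.swap = reflect (colA l s c) := by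
  ext k
  rcases k with k | k <;> fin_cases k <;> simp [colA, reflect, Params.swap] <;> ring

lemma rowU_swap (s : ℂ) (c : Params) : rowU s c.swap = -reflect (rowU s c) := by
  ext k
  rcases k with k | k <;> fin_cases k <;> simp [rowU, reflect, Params.swap] <;> ring

lemma linMatrix_swap_mulVec_reflect (l s : ℂ) (c : Params) (v : Fin 3 ⊕ Fin 3 → ℂ) :
    linMatrix l s c.swap *ᵥ reflect v = -reflect (linMatrix l s c *ᵥ v) := by
  have hU : rowU s c.swap ⬝ᵥ reflect v = -(rowU s c ⬝ᵥ v) := by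
    rw [rowU_swap, neg_dotProduct, reflect_dotProduct_reflect]
  have hV : rowV l s c.swap ⬝ᵥ reflect v = rowW l s c ⬝ᵥ v := by
    rw [rowW, ← reflect_dotProduct_reflect, reflect_reflect]
  have hW : rowW l s c.swap ⬝ᵥ reflect v = rowV l s c ⬝ᵥ v := by
    rw [rowW, reflect_dotProduct_reflect]; rfl
  have hB : colB l c.swap = -reflect (colC l c) := by
    rw [colC, reflect_neg, reflect_reflect, neg_neg]
  have hC : colC l c.swap = -reflect (colB l c) := rfl
  ext k
  rw [linMatrix_mulVec_apply, hU, hV, hW, colA_swap, Params.scale_swap, hB, hC]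
  rcases k with k | k <;> fin_cases k <;>
    simp only [reflect, linMatrix_mulVec_apply, Pi.neg_apply, Sum.elim_inl, Sum.elim_inr,
      cons_val, Fin.zero_eta, Fin.mk_one, Fin.reduceFinMk] <;> ring

lemma hasDerivAt_phi₁ (hc : c.IsAdmissible l s p r) (v : Fin 3 ⊕ Fin 3 → ℂ) :
    HasDerivAt (fun τ => phi₁ l s p ((param l s c).shift v τ))
      ((linMatrix l s c *ᵥ v) (.inl 0)) 0 := by
  have hdiff : DifferentiableAt ℂ (fun τ => phi₁ l s p ((param l s c).shift v τ)) 0 := by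
    unfold phi₁ Coords.shift
    fun_prop
  refine hdiff.hasDerivAt.congr_deriv ?_
  rw [linMatrix_mulVec_apply]
  unfold phi₁ Coords.shift
  simp (disch := fun_prop) only [deriv_fun_add, deriv_fun_sub, deriv_fun_mul, deriv_fun_pow,
    deriv_const', deriv_id'', zero_mul, add_zero]
  simp only [hc.p_eq, Params.scale, param, Coords.p2, colA, colB, colC, rowU, rowV, rowW, reflect,
    Params.swap, dotProduct, Fintype.sum_sum_type, Fin.sum_univ_three, Sum.elim_inl,
    Sum.elim_inr, cons_val, Pi.neg_apply]
  ring

lemma hasDerivAt_phi₃ (hc : c.IsAdmissible l s p r) (v : Fin 3 ⊕ Fin 3 → ℂ) :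
    HasDerivAt (fun τ => phi₃ l s p ((param l s c).shift v τ))
      ((linMatrix l s c *ᵥ v) (.inl 2)) 0 := by
  have hdiff : DifferentiableAt ℂ (fun τ => phi₃ l s p ((param l s c).shift v τ)) 0 := by
    unfold phi₃ Coords.shift
    fun_prop
  refine hdiff.hasDerivAt.congr_deriv ?_
  rw [linMatrix_mulVec_apply]
  unfold phi₃ Coords.shift
  simp (disch := fun_prop) only [deriv_fun_add, deriv_fun_sub, deriv_fun_mul, deriv_fun_pow,
    deriv_const', deriv_id'', zero_mul, add_zero]
  simp only [hc.p_eq, Params.scale, param, Coords.p2, colA, colB, colC, rowU, rowV, rowW, reflect,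
    Params.swap, dotProduct, Fintype.sum_sum_type, Fin.sum_univ_three, Sum.elim_inl,
    Sum.elim_inr, cons_val, Pi.neg_apply]
  ring

lemma hasDerivAt_psi₁ (hc : c.IsAdmissible l s p r) (v : Fin 3 ⊕ Fin 3 → ℂ) :
    HasDerivAt (fun τ => psi₁ l s p r ((param l s c).shift v τ))
      ((linMatrix l s c *ᵥ v) (.inr 0)) 0 := by
  have hdiff : DifferentiableAt ℂ (fun τ => psi₁ l s p r ((param l s c).shift v τ)) 0 := by
    unfold psi₁ Coords.shift
    fun_prop
  refine hdiff.hasDerivAt.congr_deriv ?_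
  rw [linMatrix_mulVec_apply]
  unfold psi₁ Coords.shift
  simp (disch := fun_prop) only [deriv_fun_add, deriv_fun_sub, deriv_fun_mul, deriv_fun_pow,
    deriv_const', deriv_id'', zero_mul, add_zero]
  have hr₁ := hc.r_eq₁
  simp only [hc.p_eq, Params.scale, param, Coords.p2, colA, colB, colC, rowU, rowV, rowW, reflect,
    Params.swap, dotProduct, Fintype.sum_sum_type, Fin.sum_univ_three, Sum.elim_inl,
    Sum.elim_inr, cons_val, Pi.neg_apply] at hr₁ ⊢
  linear_combination (-1 / 2 * c.x₂ * v (.inl 0) + 1 / 2 * (-2 * s * c.x₁ * c.e₂ ^ 2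
    - 4 * l * s * c.e₂ * c.f₁ - c.x₂ * c.f₁ ^ 2 - 2 * s) * v (.inl 1)) * hr₁

lemma hasDerivAt_psi₃ (hc : c.IsAdmissible l s p r) (v : Fin 3 ⊕ Fin 3 → ℂ) :
    HasDerivAt (fun τ => psi₃ l s r ((param l s c).shift v τ))
      ((linMatrix l s c *ᵥ v) (.inr 2)) 0 := by
  have hdiff : DifferentiableAt ℂ (fun τ => psi₃ l s r ((param l s c).shift v τ)) 0 := by
    unfold psi₃ Coords.shift
    fun_prop
  refine hdiff.hasDerivAt.congr_deriv ?_
  rw [linMatrix_mulVec_apply]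
  unfold psi₃ Coords.shift
  simp (disch := fun_prop) only [deriv_fun_add, deriv_fun_sub, deriv_fun_mul, deriv_fun_pow,
    deriv.fun_neg, deriv_const', deriv_id'', zero_mul, add_zero]
  have hr₁ := hc.r_eq₁
  have hr₂ := hc.r_eq₂
  simp only [Params.scale, param, colA, colB, colC, rowU, rowV, rowW, reflect,
    Params.swap, dotProduct, Fintype.sum_sum_type, Fin.sum_univ_three, Sum.elim_inl,
    Sum.elim_inr, cons_val, Pi.neg_apply] at hr₁ hr₂ ⊢
  linear_combination 1 / 2 * (-2 * l * s * c.e₁ - c.x₁ * c.f₂) * v (.inl 0) * hr₂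
    + 1 / 2 * (-2 * l * s * c.e₂ - c.x₂ * c.f₁) * v (.inl 1) * hr₁
    - 1 / 2 * v (.inl 2) * (c.x₁ * hr₂ + c.x₂ * hr₁)

lemma hasDerivAt_fieldL (hc : c.IsAdmissible l s p r) (v : Fin 3 ⊕ Fin 3 → ℂ)
    (k : Fin 3 ⊕ Fin 3) : HasDerivAt (fun τ => fieldL l s p r ((param l s c).shift v τ) k)
      ((linMatrix l s c *ᵥ v) k) 0 := by
  have hneg : HasDerivAt (fun τ : ℂ => -τ) (-1) 0 := hasDerivAt_neg 0
  have hswap (τ : ℂ) : ((param l s c).shift v τ).swap =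
      (param l s c.swap).shift (reflect v) (-τ) := by rw [swap_shift, param_swap]
  have hphi := HasDerivAt.comp (0 : ℂ) (by simpa using hasDerivAt_phi₁ hc.swap (reflect v)) hneg
  have hpsi := HasDerivAt.comp (0 : ℂ) (by simpa using hasDerivAt_psi₁ hc.swap (reflect v)) hneg
  simp only [fieldL, hswap]
  rcases k with k | k <;> fin_cases k
  · exact hasDerivAt_phi₁ hc v
  · refine hphi.congr_deriv ?_
    rw [linMatrix_swap_mulVec_reflect]
    simp [reflect]
  · exact hasDerivAt_phi₃ hc v
  · exact hasDerivAt_psi₁ hc v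
  · refine hpsi.neg.congr_deriv ?_
    rw [linMatrix_swap_mulVec_reflect]
    simp [reflect]
  · exact hasDerivAt_psi₃ hc v

end LinearizationParam

section TraceParam

open Complex Matrix

/-- The common factor of the products of `rowU`, `rowV`, `rowW` with `colA`, `colB`, `colC`. -/
def Params.kappa (s : ℂ) (c : Params) : ℂ := 2 * s * c.e₁ * c.e₂ - c.f₁ * c.f₂ - 1

lemma Params.kappa_swap (s : ℂ) (c : Params) : c.swap.kappa s = c.kappa s := by
  simp only [kappa, swap]
  ring

lemma rowU_dotProduct_colA (l s : ℂ) (c : Params) : rowU s c ⬝ᵥ colA l s c = 0 := by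
  simp only [dotProduct, rowU, colA, Fintype.sum_sum_type, Fin.sum_univ_three, Sum.elim_inl,
    Sum.elim_inr, cons_val]
  ring

lemma rowU_dotProduct_colB (l s : ℂ) (c : Params) :
    rowU s c ⬝ᵥ colB l c = c.kappa s * (c.x₂ * c.e₁ ^ 2 + 1) := by
  simp only [dotProduct, rowU, colB, Params.kappa, Fintype.sum_sum_type, Fin.sum_univ_three,
    Sum.elim_inl, Sum.elim_inr, cons_val]
  ring

lemma rowU_dotProduct_colC (l s : ℂ) (c : Params) :
    rowU s c ⬝ᵥ colC l c = c.kappa s * (c.x₁ * c.e₂ ^ 2 + 1) := by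
  have hU : rowU s c = -reflect (rowU s c.swap) := rowU_swap s c.swap
  rw [hU, colC, neg_dotProduct_neg, reflect_dotProduct_reflect, rowU_dotProduct_colB,
    Params.kappa_swap]
  rfl

lemma rowV_dotProduct_colA (l s : ℂ) (c : Params) :
    rowV l s c ⬝ᵥ colA l s c = -s * c.kappa s * (c.x₁ * c.e₂ ^ 2 + 1) := by
  simp only [dotProduct, rowV, colA, Params.kappa, Fintype.sum_sum_type, Fin.sum_univ_three,
    Sum.elim_inl, Sum.elim_inr, cons_val]
  ring

lemma rowV_dotProduct_colB (l s : ℂ) (c : Params) :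
    rowV l s c ⬝ᵥ colB l c = 2 * s * l * c.e₁ * c.e₂ * c.kappa s := by
  simp only [dotProduct, rowV, colB, Params.kappa, Fintype.sum_sum_type, Fin.sum_univ_three,
    Sum.elim_inl, Sum.elim_inr, cons_val]
  ring

lemma rowV_dotProduct_colC (l s : ℂ) (c : Params) : rowV l s c ⬝ᵥ colC l c = 0 := by
  simp only [dotProduct, rowV, colC, colB, reflect, Params.swap, Fintype.sum_sum_type,
    Fin.sum_univ_three, Pi.neg_apply, Sum.elim_inl, Sum.elim_inr, cons_val]
  ring

lemma rowW_dotProduct_colA (l s : ℂ) (c : Params) :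
    rowW l s c ⬝ᵥ colA l s c = -s * c.kappa s * (c.x₂ * c.e₁ ^ 2 + 1) := by
  have hA : colA l s c = reflect (colA l s c.swap) := colA_swap l s c.swap
  rw [hA, rowW, reflect_dotProduct_reflect, rowV_dotProduct_colA, Params.kappa_swap]
  rfl

lemma rowW_dotProduct_colC (l s : ℂ) (c : Params) :
    rowW l s c ⬝ᵥ colC l c = -(2 * s * l * c.e₂ * c.e₁ * c.kappa s) := by
  rw [rowW, colC, dotProduct_neg, reflect_dotProduct_reflect, rowV_dotProduct_colB,
    Params.kappa_swap]
  rfl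

lemma trace_mul_self_smul_add_vecMulVec {ι R : Type*} [Fintype ι] [CommRing R] (n : R)
    (a b c u v w : ι → R) :
    ((n • (vecMulVec a u + vecMulVec b v + vecMulVec c w)) *
      (n • (vecMulVec a u + vecMulVec b v + vecMulVec c w))).trace =
    n ^ 2 * ((u ⬝ᵥ a) ^ 2 + (v ⬝ᵥ b) ^ 2 + (w ⬝ᵥ c) ^ 2 + 2 * (u ⬝ᵥ b) * (v ⬝ᵥ a)
      + 2 * (u ⬝ᵥ c) * (w ⬝ᵥ a) + 2 * (v ⬝ᵥ c) * (w ⬝ᵥ b)) := by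
  simp only [Matrix.smul_mul, Matrix.mul_smul, trace_smul, Matrix.add_mul, Matrix.mul_add,
    vecMulVec_mul_vecMulVec, trace_add, trace_vecMulVec, smul_dotProduct, smul_eq_mul,
    dotProduct_comm a, dotProduct_comm b, dotProduct_comm c]
  ring

lemma scale_mul_kappa_sq (l s : ℂ) (c : Params) :
    c.scale l s * c.kappa s ^ 2 =
      2 * (2 * s ^ 2 - 2 * ((param l s c).h + l ^ 2 / 2) * s + (param l s c).p2) := by
  simp only [Params.scale, Params.kappa, param, Coords.h, Coords.p2]
  ring

lemma trace_linMatrix_mul_self {l s p r : ℂ} {c : Params} (hc : c.IsAdmissible l s p r) :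
    s * (linMatrix l s c * linMatrix l s c).trace =
      2 * (8 * l ^ 2 * s ^ 3 - r ^ 2) *
        (2 * s ^ 2 - 2 * ((param l s c).h + l ^ 2 / 2) * s + p) := by
  have htrace : (linMatrix l s c * linMatrix l s c).trace = -4 * s * c.scale l s ^ 2 *
      c.kappa s ^ 2 *
      ((c.x₁ * c.e₂ ^ 2 + 1) * (c.x₂ * c.e₁ ^ 2 + 1) - 2 * l ^ 2 * s * c.e₁ ^ 2 * c.e₂ ^ 2) := by
    rw [linMatrix, trace_mul_self_smul_add_vecMulVec, rowU_dotProduct_colA,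
      rowU_dotProduct_colB, rowU_dotProduct_colC, rowV_dotProduct_colA, rowV_dotProduct_colB,
      rowV_dotProduct_colC, rowW_dotProduct_colA, rowW_dotProduct_colC]
    ring
  have hfactor : 8 * l ^ 2 * s ^ 3 - r ^ 2 = -4 * s ^ 2 * c.scale l s *
      ((c.x₁ * c.e₂ ^ 2 + 1) * (c.x₂ * c.e₁ ^ 2 + 1) - 2 * l ^ 2 * s * c.e₁ ^ 2 * c.e₂ ^ 2) := by
    rw [hc.r_sq, Params.scale]
    ring
  rw [htrace, hfactor, hc.p_eq]
  linear_combination -4 * s ^ 2 * c.scale l s * ((c.x₁ * c.e₂ ^ 2 + 1) * (c.x₂ * c.e₁ ^ 2 + 1)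
    - 2 * l ^ 2 * s * c.e₁ ^ 2 * c.e₂ ^ 2) * scale_mul_kappa_sq l s c

variable {a b lam s : ℝ} {x : Phase} {c : Params}

lemma reducedField_eq_zero_of_param (hx : coords x = param lam s c)
    (hc : c.IsAdmissible lam s (a ^ 2 + b ^ 2) (a ^ 2 - b ^ 2)) :
    reducedField lam (combo a b lam (coeffL a b lam s)) x = 0 := by
  apply complexify_injective
  rw [complexify_reducedField, hx, fieldL_param hc, map_zero]

lemma ofReal_trace_reducedLin_of_param (hx : coords x = param lam s c)
    (hc : c.IsAdmissible lam s (a ^ 2 + b ^ 2) (a ^ 2 - b ^ 2)) :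
    ((LinearMap.trace ℝ _ (reducedLin lam (combo a b lam (coeffL a b lam s)) x ∘ₗ
      reducedLin lam (combo a b lam (coeffL a b lam s)) x) : ℝ) : ℂ) =
      -(linMatrix lam s c * linMatrix lam s c).trace :=
  ofReal_trace_comp_self_of_complexify fun u =>
    complexify_reducedLin (by rw [hx]; exact hasDerivAt_fieldL hc (complexify u))

end TraceParam

section GenericPoints

open Matrix

/-- The value of the parameter `s` of `Π₂` at a generic point of `𝓜₂`. -/
def genericValue (l : ℂ) (q : Coords) : ℂ :=
  (q.x₁ * q.x₂ - (q.w₂ * q.x₁ + l * q.z₁) * (q.w₁ * q.x₂ + l * q.z₂) / (q.w₁ * q.w₂ + l * q.w₃)) /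
    (2 * l ^ 2)

/-- The parameters of a generic point of `𝓜₂`. -/
def genericParams (l : ℂ) (q : Coords) : Params where
  x₁ := q.x₁
  x₂ := q.x₂
  e₁ := (q.w₁ * q.w₂ + l * q.w₃) / (q.w₁ * q.x₂ + l * q.z₂)
  e₂ := (q.w₁ * q.w₂ + l * q.w₃) / (q.w₂ * q.x₁ + l * q.z₁)
  f₁ := (q.w₁ - q.x₁ * ((q.w₁ * q.w₂ + l * q.w₃) / (q.w₂ * q.x₁ + l * q.z₁))) / l
  f₂ := (q.w₂ - q.x₂ * ((q.w₁ * q.w₂ + l * q.w₃) / (q.w₁ * q.x₂ + l * q.z₂))) / l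

lemma param_genericParams {l : ℂ} {q : Coords} (hl : l ≠ 0) (hD : q.w₁ * q.w₂ + l * q.w₃ ≠ 0)
    (hX₁ : q.w₂ * q.x₁ + l * q.z₁ ≠ 0) (hX₂ : q.w₁ * q.x₂ + l * q.z₂ ≠ 0)
    (hy₁ : q.y₁ = rhs l q.x₁ q.x₂ q.z₁ q.z₂ q.w₁ q.w₂ q.w₃)
    (hy₂ : q.y₂ = rhs l q.x₂ q.x₁ q.z₂ q.z₁ q.w₂ q.w₁ q.w₃) :
    param l (genericValue l q) (genericParams l q) = q := by
  obtain ⟨x₁, x₂, y₁, y₂, z₁, z₂, w₁, w₂, w₃⟩ := q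
  -- The denominators replace `w₃`, `z₁`, `z₂` as coordinates.
  obtain ⟨D, rfl⟩ : ∃ D, w₃ = (D - w₁ * w₂) / l := ⟨w₁ * w₂ + l * w₃, by field_simp; ring⟩
  obtain ⟨X₁, rfl⟩ : ∃ X, z₁ = (X - w₂ * x₁) / l := ⟨w₂ * x₁ + l * z₁, by field_simp; ring⟩
  obtain ⟨X₂, rfl⟩ : ∃ X, z₂ = (X - w₁ * x₂) / l := ⟨w₁ * x₂ + l * z₂, by field_simp; ring⟩
  have hDl : w₁ * w₂ + l * ((D - w₁ * w₂) / l) = D := by field_simp; ring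
  have hX₁l : w₂ * x₁ + l * ((X₁ - w₂ * x₁) / l) = X₁ := by field_simp; ring
  have hX₂l : w₁ * x₂ + l * ((X₂ - w₁ * x₂) / l) = X₂ := by field_simp; ring
  simp only [rhs, mul_comm w₂ w₁, hDl, hX₁l, hX₂l] at hD hX₁ hX₂ hy₁ hy₂
  subst hy₁ hy₂
  simp only [param, genericValue, genericParams, hDl, hX₁l, hX₂l, Coords.mk.injEq, true_and]
  refine ⟨?_, ?_, ?_, ?_, ?_, ?_, ?_⟩ <;> field_simp <;> try ring

/-- The integral `K` as a function of the complex coordinates. -/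
def Coords.k (l : ℂ) (q : Coords) : ℂ :=
  (q.w₁ ^ 2 + q.x₁) * (q.w₂ ^ 2 + q.x₂)
    + 2 * l * ((q.w₃ - l) * q.w₁ * q.w₂ + q.w₁ * q.z₂ + q.w₂ * q.z₁)

/-- The integral `G` as a function of the complex coordinates, for `p = p²` and `r = r²`. -/
def Coords.g (l p r : ℂ) (q : Coords) : ℂ :=
  1 / 4 * (q.x₁ * q.w₂ + q.y₂ * q.w₁ + (q.w₃ + l) * q.z₁)
      * (q.x₂ * q.w₁ + q.y₁ * q.w₂ + (q.w₃ + l) * q.z₂)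
    + 1 / 2 * (q.w₃ - l) * (1 / 2 * (q.w₂ * (q.z₂ * q.x₁ - q.z₁ * q.y₁)
      + q.w₁ * (q.z₁ * q.x₂ - q.z₂ * q.y₂)) + 1 / 4 * (q.w₃ + l) * (q.y₁ * q.y₂ - q.x₁ * q.x₂))
    - p / 4 * (q.y₁ + q.y₂) + r / 4 * (q.x₁ + q.x₂)

lemma ofReal_intH (x : Phase) : (intH x : ℂ) = (coords x).h := by
  apply Complex.ext <;>
  · simp [intH, Coords.h, coords, cy₁, cy₂, cw₁, cw₂, cw₃, pow_two]
    ring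

lemma ofReal_intK (lam : ℝ) (x : Phase) : (intK lam x : ℂ) = (coords x).k lam := by
  apply Complex.ext <;>
  · simp [intK, Coords.k, coords, cx₁, cx₂, cz₁, cz₂, cw₁, cw₂, cw₃, pow_two]
    ring

lemma ofReal_intG (a b lam : ℝ) (x : Phase) :
    (intG a b lam x : ℂ) = (coords x).g lam (a ^ 2 + b ^ 2) (a ^ 2 - b ^ 2) := by
  apply Complex.ext <;>
  · simp [intG, Coords.g, coords, cx₁, cx₂, cy₁, cy₂, cz₁, cz₂, cw₁, cw₂, cw₃, pow_two, momentum,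
      dotProduct, Fin.sum_univ_three, cross_apply]
    ring

lemma p2_coords (x : Phase) :
    (coords x).p2 = ((x.2.1 ⬝ᵥ x.2.1 + x.2.2 ⬝ᵥ x.2.2 : ℝ) : ℂ) := by
  apply Complex.ext <;>
  · simp [Coords.p2, coords, cx₁, cx₂, cy₁, cy₂, cz₁, cz₂, dotProduct, Fin.sum_univ_three]
    ring

lemma cz₁_sq_add (x : Phase) : cz₁ x ^ 2 + cx₁ x * cy₂ x =
    ((x.2.1 ⬝ᵥ x.2.1 - x.2.2 ⬝ᵥ x.2.2 : ℝ) : ℂ) + 2 * Complex.I * ((x.2.1 ⬝ᵥ x.2.2 : ℝ) : ℂ) := by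
  apply Complex.ext <;>
  · simp [cx₁, cy₂, cz₁, pow_two, dotProduct, Fin.sum_univ_three]
    ring

lemma cz₂_sq_add (x : Phase) : cz₂ x ^ 2 + cx₂ x * cy₁ x =
    ((x.2.1 ⬝ᵥ x.2.1 - x.2.2 ⬝ᵥ x.2.2 : ℝ) : ℂ) - 2 * Complex.I * ((x.2.1 ⬝ᵥ x.2.2 : ℝ) : ℂ) := by
  apply Complex.ext <;>
  · simp [cx₂, cy₁, cz₂, pow_two, dotProduct, Fin.sum_univ_three]
    ring

lemma isAdmissible_of_mem_phaseSpace {a b : ℝ} {l s : ℂ} {x : Phase} {c : Params}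
    (hm : x ∈ phaseSpace a b) (hx : coords x = param l s c) :
    c.IsAdmissible l s (a ^ 2 + b ^ 2) (a ^ 2 - b ^ 2) := by
  obtain ⟨hα, hβ, hαβ⟩ := mem_phaseSpace.mp hm
  refine ⟨?_, ?_, ?_⟩
  · rw [← hx, p2_coords, hα, hβ]
    push_cast
    rfl
  · have hr : (a : ℂ) ^ 2 - b ^ 2 = (coords x).z₁ ^ 2 + (coords x).x₁ * (coords x).y₂ := by
      simp only [coords, cz₁_sq_add, hα, hβ, hαβ]
      push_cast
      ring
    rw [hr, hx]
    simp only [param, Params.scale]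
    ring
  · have hr : (a : ℂ) ^ 2 - b ^ 2 = (coords x).z₂ ^ 2 + (coords x).x₂ * (coords x).y₁ := by
      simp only [coords, cz₂_sq_add, hα, hβ, hαβ]
      push_cast
      ring
    rw [hr, hx]
    simp only [param, Params.scale]
    ring

variable {l s p r : ℂ} {c : Params}

lemma k_param (hc : c.IsAdmissible l s p r) :
    4 * s ^ 2 * (param l s c).k l =
      4 * s ^ 2 * (-2 * l ^ 2 * ((param l s c).h - l ^ 2 / 2 - 2 * s) - l ^ 4) + r ^ 2 := by
  rw [hc.r_sq]
  simp only [Coords.k, Coords.h, param, Params.scale]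
  ring

lemma g_param (hc : c.IsAdmissible l s p r) :
    4 * s * (param l s c).g l p r =
      4 * s * (1 / 2 * p * ((param l s c).h + l ^ 2 / 2) - l ^ 2 * s ^ 2) - r ^ 2 := by
  have hr₁ := hc.r_eq₁
  have hr₂ := hc.r_eq₂
  rw [hc.r_sq, hc.p_eq]
  simp only [Coords.g, Coords.h, Coords.p2, param, Params.scale] at hr₁ hr₂ ⊢
  linear_combination s * c.x₁ * hr₂ + s * c.x₂ * hr₁

/-- The relations between a point `x` of `𝓜₂` and the value `s` with which `J(x)` is a point of
`Π₂`, multiplied by the denominators: they are closed conditions on `(x, s)`. -/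
structure IsSurfaceParam (a b lam : ℝ) (x : Phase) (s : ℝ) : Prop where
  mem : x ∈ phaseSpace a b
  field_eq : reducedField lam (combo a b lam (coeffL a b lam s)) x = 0
  k_eq : 4 * s ^ 2 * intK lam x =
    4 * s ^ 2 * (-2 * lam ^ 2 * (intH x - lam ^ 2 / 2 - 2 * s) - lam ^ 4) + (a ^ 2 - b ^ 2) ^ 2
  g_eq : 4 * s * intG a b lam x =
    4 * s * (1 / 2 * (a ^ 2 + b ^ 2) * (intH x + lam ^ 2 / 2) - lam ^ 2 * s ^ 2)
      - (a ^ 2 - b ^ 2) ^ 2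
  trace_eq : s * LinearMap.trace ℝ _ (reducedLin lam (combo a b lam (coeffL a b lam s)) x ∘ₗ
      reducedLin lam (combo a b lam (coeffL a b lam s)) x) =
    -2 * (8 * lam ^ 2 * s ^ 3 - (a ^ 2 - b ^ 2) ^ 2) *
      (2 * s ^ 2 - 2 * (intH x + lam ^ 2 / 2) * s + (a ^ 2 + b ^ 2))

lemma isSurfaceParam_of_param {a b lam s : ℝ} {x : Phase} (hm : x ∈ phaseSpace a b)
    (hx : coords x = param lam s c) : IsSurfaceParam a b lam x s := by
  have hc := isAdmissible_of_mem_phaseSpace hm hx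
  refine ⟨hm, reducedField_eq_zero_of_param hx hc, ?_, ?_, ?_⟩ <;> apply Complex.ofReal_injective
  · have hk := k_param hc
    rw [← hx, ← ofReal_intH, ← ofReal_intK] at hk
    push_cast
    exact hk
  · have hg := g_param hc
    rw [← hx, ← ofReal_intH, ← ofReal_intG] at hg
    push_cast
    exact hg
  · have htrace := trace_linMatrix_mul_self hc
    rw [← hx, ← ofReal_intH] at htrace
    rw [Complex.ofReal_mul, ofReal_trace_reducedLin_of_param hx hc]
    push_cast
    linear_combination -htrace

lemma cx₂_eq_conj (x : Phase) : cx₂ x = (starRingEnd ℂ) (cx₁ x) := rfl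

lemma cz₂_eq_conj (x : Phase) : cz₂ x = (starRingEnd ℂ) (cz₁ x) := rfl

lemma cw₂_eq_conj (x : Phase) : cw₂ x = (starRingEnd ℂ) (cw₁ x) := rfl

lemma conj_genericValue (lam : ℝ) (x : Phase) :
    (starRingEnd ℂ) (genericValue lam (coords x)) = genericValue lam (coords x) := by
  simp only [genericValue, coords, cx₂_eq_conj, cz₂_eq_conj, cw₂_eq_conj, cw₃, map_div₀,
    map_sub, map_mul, map_add, map_pow, Complex.conj_conj, Complex.conj_ofReal, map_ofNat]
  ring

lemma exists_isSurfaceParam_of_generic {a b lam : ℝ} (hlam : lam ≠ 0) {x : Phase}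
    (hx : x ∈ subsystem₂Generic a b lam) : ∃ s, IsSurfaceParam a b lam x s := by
  obtain ⟨hm, hD, hX₁, hX₂, hy₁, hy₂⟩ := hx
  obtain ⟨s, hs⟩ := Complex.conj_eq_iff_real.mp (conj_genericValue lam x)
  have hq := param_genericParams (q := coords x) (Complex.ofReal_ne_zero.mpr hlam)
    hD hX₁ hX₂ hy₁ hy₂
  exact ⟨s, isSurfaceParam_of_param hm (hs ▸ hq.symm)⟩

end GenericPoints

section Closure

open Filter Matrix

lemma continuous_trace_comp_self {Y V : Type*} [TopologicalSpace Y] [NormedAddCommGroup V]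
    [NormedSpace ℝ V] [FiniteDimensional ℝ V] {A : Y → V →ₗ[ℝ] V}
    (hA : ∀ v, Continuous fun y => A y v) :
    Continuous fun y => LinearMap.trace ℝ V (A y ∘ₗ A y) := by
  let B := Module.finBasis ℝ V
  have hmatrix : Continuous fun y => LinearMap.toMatrix B B (A y) :=
    continuous_matrix fun i j => by
      simpa only [LinearMap.toMatrix_apply] using!
        (B.coord i).continuous_of_finiteDimensional.comp (hA (B j))
  simpa only [LinearMap.trace_eq_matrix_trace ℝ B, LinearMap.toMatrix_comp B B B] using
    (hmatrix.matrix_mul hmatrix).matrix_trace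

lemma continuous_reducedLin_apply (lam : ℝ) {F : Phase → ℝ} (hF : ContDiff ℝ ∞ F)
    (u : (Fin 3 → ℝ) × (Fin 3 → ℝ)) : Continuous fun x => reducedLin lam F x u := by
  have hemb : Continuous fun x => emb x u := by
    have hcross : ContDiff ℝ ∞ fun x : Phase => (x.2.1 ⨯₃ u.1, x.2.2 ⨯₃ u.1) := by fun_prop
    exact continuous_const.prodMk hcross.continuous
  exact ((contDiff_reducedField lam hF).continuous_fderiv (by simp)).clm_apply hemb

variable (a b lam : ℝ)

lemma reducedLin_combo (c : Fin 3 → ℝ) (x : Phase) :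
    reducedLin lam (combo a b lam c) x = c 0 • reducedLin lam intH x
      + c 1 • reducedLin lam (intK lam) x + c 2 • reducedLin lam (intG a b lam) x := by
  have hH := (differentiableAt_reducedField lam contDiff_intH x).hasFDerivAt
  have hK := (differentiableAt_reducedField lam (contDiff_intK lam) x).hasFDerivAt
  have hG := (differentiableAt_reducedField lam (contDiff_intG a b lam) x).hasFDerivAt
  have hcombo := ((hH.const_smul (c 0)).add (hK.const_smul (c 1))).add (hG.const_smul (c 2))
  rw [reducedLin, funext (reducedField_combo a b lam c)]
  refine LinearMap.ext fun u => ?_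
  exact DFunLike.congr_fun hcombo.fderiv (emb x u)

lemma continuous_reducedField_coeffL :
    Continuous fun y : Phase × ℝ =>
      reducedField lam (combo a b lam (coeffL a b lam y.2)) y.1 := by
  have hH := (contDiff_reducedField lam contDiff_intH).continuous
  have hK := (contDiff_reducedField lam (contDiff_intK lam)).continuous
  have hG := (contDiff_reducedField lam (contDiff_intG a b lam)).continuous
  simp only [reducedField_combo, coeffL, cons_val]
  fun_prop

lemma continuous_reducedLin_coeffL_apply (u : (Fin 3 → ℝ) × (Fin 3 → ℝ)) :
    Continuous fun y : Phase × ℝ =>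
      reducedLin lam (combo a b lam (coeffL a b lam y.2)) y.1 u := by
  have hH := continuous_reducedLin_apply lam contDiff_intH u
  have hK := continuous_reducedLin_apply lam (contDiff_intK lam) u
  have hG := continuous_reducedLin_apply lam (contDiff_intG a b lam) u
  simp only [reducedLin_combo, coeffL, cons_val, LinearMap.add_apply, LinearMap.smul_apply]
  fun_prop

lemma isClosed_setOf_isSurfaceParam :
    IsClosed {y : Phase × ℝ | IsSurfaceParam a b lam y.1 y.2} := by
  have hgeom : Continuous geom := contDiff_geom.continuous
  have hH : Continuous intH := contDiff_intH.continuous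
  have hK : Continuous (intK lam) := (contDiff_intK lam).continuous
  have hG : Continuous (intG a b lam) := (contDiff_intG a b lam).continuous
  have htrace := continuous_trace_comp_self (continuous_reducedLin_coeffL_apply a b lam)
  exact isClosed_of_closure_subset fun y hy =>
    ⟨closure_minimal (fun _ h => h.mem)
      (isClosed_eq (hgeom.comp continuous_fst) continuous_const) hy,
    Set.EqOn.closure (fun _ h => h.field_eq) (continuous_reducedField_coeffL a b lam)
      continuous_const hy,
    Set.EqOn.closure (fun _ h => h.k_eq) (by fun_prop) (by fun_prop) hy,
    Set.EqOn.closure (fun _ h => h.g_eq) (by fun_prop) (by fun_prop) hy,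
    Set.EqOn.closure (fun _ h => h.trace_eq) (by fun_prop) (by fun_prop) hy⟩

variable {a b lam}

lemma abs_le_of_cube_eq {s A B : ℝ} (h : s ^ 3 = A * s ^ 2 + B) : |s| ≤ 1 + |A| + |B| := by
  rcases le_total |s| 1 with hs | hs
  · linarith [abs_nonneg A, abs_nonneg B]
  · have hs2 : 1 ≤ |s| ^ 2 := one_le_pow₀ hs
    have hcube : |s| ^ 2 * |s| ≤ |s| ^ 2 * (|A| + |B|) := calc
      |s| ^ 2 * |s| = |A * s ^ 2 + B| := by rw [← h, abs_pow]; ring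
      _ ≤ |A * s ^ 2| + |B| := abs_add_le _ _
      _ = |A| * |s| ^ 2 + 1 * |B| := by rw [abs_mul, abs_pow, one_mul]
      _ ≤ |A| * |s| ^ 2 + |s| ^ 2 * |B| := by gcongr
      _ = |s| ^ 2 * (|A| + |B|) := by ring
    linarith [le_of_mul_le_mul_left hcube (by positivity)]

lemma IsSurfaceParam.abs_le (hlam : lam ≠ 0) {x : Phase} {s : ℝ}
    (h : IsSurfaceParam a b lam x s) :
    |s| ≤ 1 + |(intK lam x + 2 * lam ^ 2 * (intH x - lam ^ 2 / 2) + lam ^ 4) / (4 * lam ^ 2)|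
      + |-(a ^ 2 - b ^ 2) ^ 2 / (16 * lam ^ 2)| := by
  apply abs_le_of_cube_eq
  field_simp
  linear_combination -4 * h.k_eq

lemma exists_isSurfaceParam (hlam : lam ≠ 0) {x : Phase} (hx : x ∈ subsystem₂ a b lam) :
    ∃ s, IsSurfaceParam a b lam x s := by
  obtain ⟨u, hu, hux⟩ := mem_closure_iff_seq_limit.1 hx
  choose s hs using fun n => exists_isSurfaceParam_of_generic hlam (hu n)
  have hH : Continuous intH := contDiff_intH.continuous
  have hK : Continuous (intK lam) := (contDiff_intK lam).continuous
  have hbound : Continuous fun y : Phase => 1 + |(intK lam y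
      + 2 * lam ^ 2 * (intH y - lam ^ 2 / 2) + lam ^ 4) / (4 * lam ^ 2)|
      + |-(a ^ 2 - b ^ 2) ^ 2 / (16 * lam ^ 2)| := by fun_prop
  obtain ⟨R, hR⟩ := ((hbound.tendsto x).comp hux).bddAbove_range
  have hsR (n : ℕ) : s n ∈ Metric.closedBall (0 : ℝ) R :=
    mem_closedBall_zero_iff.2 (((hs n).abs_le hlam).trans (hR ⟨n, rfl⟩))
  obtain ⟨t, -, φ, hφ, ht⟩ := (isCompact_closedBall (0 : ℝ) R).tendsto_subseq hsR
  exact ⟨t, (isClosed_setOf_isSurfaceParam a b lam).mem_of_tendsto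
    ((hux.comp hφ.tendsto_atTop).prodMk_nhds ht) (Eventually.of_forall fun n => hs (φ n))⟩

end Closure

/-! ### Types of the points of `𝓜₂` -/

section Types

open Matrix

/-- The linear functional `c₀ h + c₁ k + c₂ g`. -/
def valFunctional (c : Fin 3 → ℝ) : Val →ₗ[ℝ] ℝ :=
  c 0 • LinearMap.fst ℝ _ _ + c 1 • LinearMap.fst ℝ _ _ ∘ₗ LinearMap.snd ℝ _ _
    + c 2 • LinearMap.snd ℝ _ _ ∘ₗ LinearMap.snd ℝ _ _

lemma valFunctional_apply (c : Fin 3 → ℝ) (P : Val) :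
    valFunctional c P = c 0 * P.1 + c 1 * P.2.1 + c 2 * P.2.2 := rfl

lemma finrank_ker_valFunctional {c : Fin 3 → ℝ} (hc : c 2 ≠ 0) :
    Module.finrank ℝ (LinearMap.ker (valFunctional c)) = 2 := by
  have hsurj : Function.Surjective (valFunctional c) := fun t =>
    ⟨(0, 0, t / c 2), by rw [valFunctional_apply]; field_simp; ring⟩
  have hrank := LinearMap.finrank_range_add_finrank_ker (valFunctional c)
  rw [LinearMap.range_eq_top.2 hsurj, finrank_top] at hrank
  simp only [Module.finrank_prod, Module.finrank_self] at hrank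
  omega

lemma eq_smul_of_ker_le_ker {c d : Fin 3 → ℝ} (hc : c 2 ≠ 0)
    (h : LinearMap.ker (valFunctional c) ≤ LinearMap.ker (valFunctional d)) :
    d = (d 2 / c 2) • c := by
  have h₀ : valFunctional d (c 2, 0, -c 0) = 0 := h (by
    rw [LinearMap.mem_ker, valFunctional_apply]; ring)
  have h₁ : valFunctional d (0, c 2, -c 1) = 0 := h (by
    rw [LinearMap.mem_ker, valFunctional_apply]; ring)
  rw [valFunctional_apply] at h₀ h₁
  ext i
  fin_cases i <;> simp only [Fin.zero_eta, Fin.mk_one, Fin.reduceFinMk, Pi.smul_apply,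
    smul_eq_mul] <;> field_simp
  · linear_combination h₀
  · linear_combination h₁

variable {a b lam : ℝ} {x : Phase} {c d : Fin 3 → ℝ}

lemma criticalAt_combo_iff :
    CriticalAt (combo a b lam c) x ↔
      (tangent x).map (fderiv ℝ (intJ a b lam) x).toLinearMap ≤
        LinearMap.ker (valFunctional c) := by
  rw [Submodule.map_le_iff_le_comap]
  refine forall₂_congr fun v _ => ?_
  rw [fderiv_combo, Submodule.mem_comap, LinearMap.mem_ker, valFunctional_apply]
  simp only [ContinuousLinearMap.coe_coe, fderiv_intJ]

lemma rankJ_le_two (hc : c 2 ≠ 0) (h : CriticalAt (combo a b lam c) x) : rankJ a b lam x ≤ 2 := by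
  rw [← finrank_ker_valFunctional hc]
  exact Submodule.finrank_mono (criticalAt_combo_iff.1 h)

lemma eq_smul_of_criticalAt (hc : c 2 ≠ 0) (hr : rankJ a b lam x = 2)
    (h : CriticalAt (combo a b lam c) x) (hd : CriticalAt (combo a b lam d) x) :
    d = (d 2 / c 2) • c := by
  rw [criticalAt_combo_iff] at h hd
  have heq := Submodule.eq_of_le_of_finrank_eq h (hr.trans (finrank_ker_valFunctional hc).symm)
  exact eq_smul_of_ker_le_ker hc (heq ▸ hd)

lemma linearIndependent_reducedField (ha : a ≠ 0) (hb : b ≠ 0) (hc : c 2 ≠ 0)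
    (hx : x ∈ phaseSpace a b) (h : CriticalAt (combo a b lam c) x) (hr : rankJ a b lam x = 2) :
    LinearIndependent ℝ ![reducedField lam intH x, reducedField lam (intK lam) x] := by
  rw [LinearIndependent.pair_iff]
  intro t u htu
  have h₀ : reducedField lam (combo a b lam ![t, u, 0]) x = 0 := by
    rw [reducedField_combo]
    simpa using htu
  have heq := eq_smul_of_criticalAt hc hr h (criticalAt_of_reducedField_eq_zero ha hb hx h₀)
  exact ⟨by simpa using congrFun heq 0, by simpa using congrFun heq 1⟩

lemma reducedField_combo_smul (t : ℝ) :
    reducedField lam (combo a b lam (t • c)) x = t • reducedField lam (combo a b lam c) x := by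
  simp only [reducedField_combo, Pi.smul_apply, smul_eq_mul, smul_add, smul_smul]

lemma reducedLin_combo_smul (t : ℝ) :
    reducedLin lam (combo a b lam (t • c)) x = t • reducedLin lam (combo a b lam c) x := by
  simp only [reducedLin_combo, Pi.smul_apply, smul_eq_mul, smul_add, smul_smul]

lemma coeffL_two_ne_zero (a b lam s : ℝ) : coeffL a b lam s 2 ≠ 0 := two_ne_zero

namespace IsSurfaceParam

variable {s : ℝ}

lemma ne_zero (hr : a ^ 2 - b ^ 2 ≠ 0) (h : IsSurfaceParam a b lam x s) : s ≠ 0 := by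
  rintro rfl
  have hk : 0 = (a ^ 2 - b ^ 2) ^ 2 := by linear_combination h.k_eq
  exact pow_ne_zero 2 hr hk.symm

lemma intJ_eq (hs : s ≠ 0) (h : IsSurfaceParam a b lam x s) :
    intJ a b lam x = surf₂ a b lam (intH x, s) := by
  simp only [intJ, surf₂, Prod.mk.injEq, true_and]
  constructor <;> field_simp
  · linear_combination h.k_eq
  · linear_combination 4 * h.g_eq

lemma criticalAt (ha : a ≠ 0) (hb : b ≠ 0) (h : IsSurfaceParam a b lam x s) :
    CriticalAt (combo a b lam (coeffL a b lam s)) x :=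
  criticalAt_of_reducedField_eq_zero ha hb h.mem h.field_eq

lemma trace_eq_muSq (hs : s ≠ 0) (h : IsSurfaceParam a b lam x s) :
    LinearMap.trace ℝ _ (reducedLin lam (combo a b lam (coeffL a b lam s)) x ∘ₗ
        reducedLin lam (combo a b lam (coeffL a b lam s)) x) = 2 * muSq a b lam (intH x) s := by
  apply mul_left_cancel₀ hs
  rw [h.trace_eq, muSq]
  field_simp

lemma hasExponentSq_smul_iff (ha : a ≠ 0) (hb : b ≠ 0) (hs : s ≠ 0)
    (h : IsSurfaceParam a b lam x s) (hr : rankJ a b lam x = 2) (t C : ℝ) :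
    HasExponentSq lam (combo a b lam (t • coeffL a b lam s)) x C ↔
      C = t ^ 2 * muSq a b lam (intH x) s := by
  have h₀ : reducedField lam (combo a b lam (t • coeffL a b lam s)) x = 0 := by
    rw [reducedField_combo_smul, h.field_eq, smul_zero]
  have hind := linearIndependent_reducedField ha hb (coeffL_two_ne_zero a b lam s) h.mem
    (h.criticalAt ha hb) hr
  have htrace : (t * t) • (2 * muSq a b lam (intH x) s) / 2 = t ^ 2 * muSq a b lam (intH x) s := by
    rw [smul_eq_mul]
    ring
  rw [hasExponentSq_iff ha hb (contDiff_combo a b lam _) h.mem h₀,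
    charpoly_reducedLin_combo ha hb h.mem h₀ hind, reducedLin_combo_smul, LinearMap.smul_comp,
    LinearMap.comp_smul, smul_smul, map_smul, h.trace_eq_muSq hs, htrace,
    mul_right_inj' (pow_ne_zero 4 Polynomial.X_ne_zero), sub_right_inj, Polynomial.C_inj, eq_comm]

lemma hasExponentSq (ha : a ≠ 0) (hb : b ≠ 0) (hs : s ≠ 0) (h : IsSurfaceParam a b lam x s)
    (hr : rankJ a b lam x = 2) :
    HasExponentSq lam (combo a b lam (coeffL a b lam s)) x (muSq a b lam (intH x) s) := by
  simpa using h.hasExponentSq_smul_iff ha hb hs hr 1 (muSq a b lam (intH x) s)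

lemma exists_hasExponentSq_iff (ha : a ≠ 0) (hb : b ≠ 0) (hs : s ≠ 0)
    (h : IsSurfaceParam a b lam x s) (hr : rankJ a b lam x = 2) {P : ℝ → Prop}
    (hP : ∀ t y, 0 < t → P (t * y) → P y) :
    (∃ c : Fin 3 → ℝ, c ≠ 0 ∧ ∃ C, P C ∧ HasExponentSq lam (combo a b lam c) x C) ↔
      P (muSq a b lam (intH x) s) := by
  constructor
  · rintro ⟨c, hc, C, hC, hE⟩
    have hsmul := eq_smul_of_criticalAt (coeffL_two_ne_zero a b lam s) hr (h.criticalAt ha hb) hE.1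
    have ht : c 2 / coeffL a b lam s 2 ≠ 0 := fun h₀ => hc (by rw [hsmul, h₀, zero_smul])
    rw [hsmul, h.hasExponentSq_smul_iff ha hb hs hr] at hE
    exact hP _ _ (by positivity) (hE ▸ hC)
  · intro hμ
    exact ⟨_, fun h₀ => coeffL_two_ne_zero a b lam s (congrFun h₀ 2), _, hμ,
      h.hasExponentSq ha hb hs hr⟩

lemma isCenter_iff (ha : a ≠ 0) (hb : b ≠ 0) (hs : s ≠ 0) (h : IsSurfaceParam a b lam x s)
    (hr : rankJ a b lam x = 2) : IsCenter a b lam x ↔ muSq a b lam (intH x) s < 0 := by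
  rw [← h.exists_hasExponentSq_iff ha hb hs hr (P := (· < 0))
    (fun t y ht hy => neg_of_mul_neg_right hy ht.le), IsCenter, and_iff_right hr]

lemma isSaddle_iff (ha : a ≠ 0) (hb : b ≠ 0) (hs : s ≠ 0) (h : IsSurfaceParam a b lam x s)
    (hr : rankJ a b lam x = 2) : IsSaddle a b lam x ↔ 0 < muSq a b lam (intH x) s := by
  rw [← h.exists_hasExponentSq_iff ha hb hs hr (P := (0 < ·))
    (fun t y ht hy => pos_of_mul_pos_right hy ht.le), IsSaddle, and_iff_right hr]

lemma isDegenerate_iff (ha : a ≠ 0) (hb : b ≠ 0) (hs : s ≠ 0) (h : IsSurfaceParam a b lam x s)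
    (hr : rankJ a b lam x = 2) : IsDegenerate a b lam x ↔ muSq a b lam (intH x) s = 0 := by
  rw [IsDegenerate, and_iff_right hr, h.exists_hasExponentSq_iff ha hb hs hr (P := (· ≠ 0))
    (fun t y _ hy => right_ne_zero_of_mul hy), not_not]

end IsSurfaceParam

lemma surf₂_injective (hlam : lam ≠ 0) {h h' s t : ℝ} (hs : s ≠ 0) (ht : t ≠ 0)
    (heq : surf₂ a b lam (h, s) = surf₂ a b lam (h', t)) : h = h' ∧ s = t := by
  simp only [surf₂, Prod.mk.injEq] at heq
  obtain ⟨rfl, hk, hg⟩ := heq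
  refine ⟨rfl, ?_⟩
  by_contra hne
  have hst : s - t ≠ 0 := sub_ne_zero.2 hne
  have hk' : 16 * lam ^ 2 * s ^ 2 * t ^ 2 = (a ^ 2 - b ^ 2) ^ 2 * (s + t) := by
    apply mul_left_cancel₀ hst
    field_simp at hk
    linear_combination hk
  have hg' : 4 * lam ^ 2 * s * t * (s + t) = (a ^ 2 - b ^ 2) ^ 2 := by
    apply mul_left_cancel₀ hst
    field_simp at hg
    linear_combination -hg / 4
  have hzero : 4 * lam ^ 2 * s * t * (s - t) ^ 2 = 0 := by
    linear_combination (s + t) * hg' - hk'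
  have hpos : 4 * lam ^ 2 * s * t * (s - t) ^ 2 ≠ 0 := by positivity
  exact hpos hzero

end Types

/-! ### The curve of tangency -/

section Tangency

open Filter

variable {a b lam h s t : ℝ}

/-- The shape shared by the differentials of the parametrizations of `Π₁` and `Π₂` at `(h, s)`:
there `σ = s / 2`, and `χ` is the derivative of the coordinate `k` along `s`. -/
def tangentMap (A B σ χ : ℝ) : ℝ × ℝ →L[ℝ] Val :=
  (ContinuousLinearMap.fst ℝ ℝ ℝ).prod
    ((A • ContinuousLinearMap.fst ℝ ℝ ℝ + χ • ContinuousLinearMap.snd ℝ ℝ ℝ).prod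
      (B • ContinuousLinearMap.fst ℝ ℝ ℝ - (σ * χ) • ContinuousLinearMap.snd ℝ ℝ ℝ))

lemma tangentMap_apply (A B σ χ : ℝ) (v : ℝ × ℝ) :
    tangentMap A B σ χ v = (v.1, A * v.1 + χ * v.2, B * v.1 - σ * χ * v.2) := rfl

lemma injective_tangentMap_iff {A B σ χ : ℝ} :
    Function.Injective (tangentMap A B σ χ) ↔ χ ≠ 0 := by
  rw [injective_iff_map_eq_zero]
  constructor
  · rintro hinj rfl
    exact one_ne_zero (congrArg Prod.snd (hinj (0, 1) (by simp [tangentMap_apply])))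
  · intro hχ v hv
    obtain ⟨hfst, hsnd, -⟩ : v.1 = 0 ∧ A * v.1 + χ * v.2 = 0 ∧ B * v.1 - σ * χ * v.2 = 0 := by
      simpa [tangentMap_apply] using hv
    rw [hfst, mul_zero, zero_add] at hsnd
    exact Prod.ext hfst ((mul_eq_zero.1 hsnd).resolve_left hχ)

lemma mem_range_tangentMap_iff {A B σ χ : ℝ} (hχ : χ ≠ 0) {P : Val} :
    P ∈ LinearMap.range (tangentMap A B σ χ).toLinearMap ↔
      P.2.2 = (B + σ * A) * P.1 - σ * P.2.1 := by
  constructor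
  · rintro ⟨v, rfl⟩
    simp only [ContinuousLinearMap.coe_coe, tangentMap_apply]
    ring
  · intro hP
    refine ⟨(P.1, (P.2.1 - A * P.1) / χ), Prod.ext rfl (Prod.ext ?_ ?_)⟩ <;>
    simp only [ContinuousLinearMap.coe_coe, tangentMap_apply, mul_assoc, mul_div_cancel₀ _ hχ]
    · ring
    · linear_combination -hP

lemma range_tangentMap_eq_iff {A B σ χ A' B' σ' χ' : ℝ} (hχ : χ ≠ 0) (hχ' : χ' ≠ 0) :
    LinearMap.range (tangentMap A B σ χ).toLinearMap =
        LinearMap.range (tangentMap A' B' σ' χ').toLinearMap ↔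
      σ = σ' ∧ B + σ * A = B' + σ' * A' := by
  simp only [SetLike.ext_iff, mem_range_tangentMap_iff hχ, mem_range_tangentMap_iff hχ']
  constructor
  · intro hP
    have hσ := (hP (0, 1, -σ)).1 (by ring)
    have hAB := (hP (1, 0, B + σ * A)).1 (by ring)
    exact ⟨by linear_combination -hσ, by linear_combination hAB⟩
  · rintro ⟨rfl, hAB⟩ P
    rw [hAB]

lemma hasDerivAt_div_mul_sq (c d : ℝ) (hd : d ≠ 0) (hs : s ≠ 0) :
    HasDerivAt (fun t => c / (d * t ^ 2)) (-(2 * c / (d * s ^ 3))) s := by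
  refine ((hasDerivAt_const s c).fun_div ((hasDerivAt_pow 2 s).const_mul d)
    (by positivity)).congr_deriv ?_
  field_simp
  ring

lemma hasDerivAt_div_mul (c d : ℝ) (hd : d ≠ 0) (hs : s ≠ 0) :
    HasDerivAt (fun t => c / (d * t)) (-(c / (d * s ^ 2))) s := by
  refine ((hasDerivAt_const s c).fun_div ((hasDerivAt_id' s).const_mul d)
    (by positivity)).congr_deriv ?_
  field_simp
  ring

/-- The partial derivative `∂k/∂s` on `Π₁`. -/
def slope₁ (a b lam h s : ℝ) : ℝ :=
  -4 * (h - lam ^ 2 / 2) + 6 * s + ((a ^ 2 + b ^ 2) ^ 2 - (a ^ 2 - b ^ 2) ^ 2) / (2 * s ^ 3)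

/-- The partial derivative `∂k/∂s` on `Π₂`. -/
def slope₂ (a b lam s : ℝ) : ℝ := 4 * lam ^ 2 - (a ^ 2 - b ^ 2) ^ 2 / (2 * s ^ 3)

lemma slope₂_eq_zero_iff (hs : s ≠ 0) :
    slope₂ a b lam s = 0 ↔ 8 * lam ^ 2 * s ^ 3 - (a ^ 2 - b ^ 2) ^ 2 = 0 := by
  have hslope : slope₂ a b lam s = (8 * lam ^ 2 * s ^ 3 - (a ^ 2 - b ^ 2) ^ 2) / (2 * s ^ 3) := by
    rw [slope₂]
    field_simp
    ring
  rw [hslope, div_eq_zero_iff, or_iff_left (by positivity)]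

lemma hasFDerivAt_surf₁ (a b lam h : ℝ) (hs : s ≠ 0) :
    HasFDerivAt (surf₁ a b lam)
      (tangentMap (2 * (h - lam ^ 2 / 2) - 4 * s) (s ^ 2) (s / 2) (slope₁ a b lam h s))
      (h, s) := by
  have hfst : HasFDerivAt (fun q : ℝ × ℝ => q.1) (ContinuousLinearMap.fst ℝ ℝ ℝ) (h, s) :=
    hasFDerivAt_fst
  have hsnd : HasFDerivAt (fun q : ℝ × ℝ => q.2) (ContinuousLinearMap.snd ℝ ℝ ℝ) (h, s) :=
    hasFDerivAt_snd
  set n := (a ^ 2 + b ^ 2) ^ 2 - (a ^ 2 - b ^ 2) ^ 2 with hn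
  have hη := hfst.sub_const (lam ^ 2 / 2)
  have hk := (((hη.pow 2).const_add (a ^ 2 + b ^ 2)).sub ((hη.const_mul 4).mul hsnd)).add
    ((hsnd.pow 2).const_mul 3) |>.sub
      ((hasDerivAt_div_mul_sq n 4 four_ne_zero hs).comp_hasFDerivAt (h, s) hsnd)
  have hg := ((hη.sub hsnd).mul (hsnd.pow 2)).add
    ((hasDerivAt_div_mul n 4 four_ne_zero hs).comp_hasFDerivAt (h, s) hsnd)
  refine (hfst.prodMk (hk.prodMk hg)).congr_fderiv (ContinuousLinearMap.ext fun v => ?_)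
  simp only [Nat.add_one_sub_one, pow_one, nsmul_eq_mul, Nat.cast_ofNat, hn, neg_smul,
    sub_neg_eq_add, Pi.sub_apply, ContinuousLinearMap.prod_apply, ContinuousLinearMap.coe_fst',
    ContinuousLinearMap.coe_snd', add_apply, sub_apply, neg_apply, smul_apply, smul_eq_mul, slope₁,
    tangentMap_apply, Prod.mk.injEq, true_and]
  constructor <;>
  · field_simp
    ring

lemma hasFDerivAt_surf₂ (a b lam h : ℝ) (hs : s ≠ 0) :
    HasFDerivAt (surf₂ a b lam)
      (tangentMap (-2 * lam ^ 2) ((a ^ 2 + b ^ 2) / 2) (s / 2) (slope₂ a b lam s)) (h, s) := by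
  have hfst : HasFDerivAt (fun q : ℝ × ℝ => q.1) (ContinuousLinearMap.fst ℝ ℝ ℝ) (h, s) :=
    hasFDerivAt_fst
  have hsnd : HasFDerivAt (fun q : ℝ × ℝ => q.2) (ContinuousLinearMap.snd ℝ ℝ ℝ) (h, s) :=
    hasFDerivAt_snd
  have hk := ((((hfst.sub_const (lam ^ 2 / 2)).sub (hsnd.const_mul 2)).const_mul
    (-2 * lam ^ 2)).sub_const (lam ^ 4)).add
      ((hasDerivAt_div_mul_sq ((a ^ 2 - b ^ 2) ^ 2) 4 four_ne_zero hs).comp_hasFDerivAt (h, s) hsnd)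
  have hg := (((hfst.add_const (lam ^ 2 / 2)).const_mul (1 / 2 * (a ^ 2 + b ^ 2))).sub
    ((hsnd.pow 2).const_mul (lam ^ 2))).sub
      ((hasDerivAt_div_mul ((a ^ 2 - b ^ 2) ^ 2) 4 four_ne_zero hs).comp_hasFDerivAt (h, s) hsnd)
  refine (hfst.prodMk (hk.prodMk hg)).congr_fderiv (ContinuousLinearMap.ext fun v => ?_)
  simp only [Nat.add_one_sub_one, pow_one, nsmul_eq_mul, Nat.cast_ofNat, neg_smul, sub_neg_eq_add,
    ContinuousLinearMap.prod_apply, ContinuousLinearMap.coe_fst', ContinuousLinearMap.coe_snd',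
    add_apply, sub_apply, neg_apply, smul_apply, smul_eq_mul, slope₂, tangentMap_apply,
    Prod.mk.injEq, true_and]
  constructor <;>
  · field_simp
    ring

lemma injective_fderiv_surf₁_iff (hs : s ≠ 0) :
    Function.Injective (fderiv ℝ (surf₁ a b lam) (h, s)) ↔ slope₁ a b lam h s ≠ 0 := by
  rw [(hasFDerivAt_surf₁ a b lam h hs).fderiv, injective_tangentMap_iff]

lemma injective_fderiv_surf₂_iff (hs : s ≠ 0) :
    Function.Injective (fderiv ℝ (surf₂ a b lam) (h, s)) ↔ slope₂ a b lam s ≠ 0 := by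
  rw [(hasFDerivAt_surf₂ a b lam h hs).fderiv, injective_tangentMap_iff]

lemma range_fderiv_eq_iff (hs : s ≠ 0) (ht : t ≠ 0) (h₁ : slope₁ a b lam h s ≠ 0)
    (h₂ : slope₂ a b lam t ≠ 0) :
    LinearMap.range (fderiv ℝ (surf₁ a b lam) (h, s)).toLinearMap =
        LinearMap.range (fderiv ℝ (surf₂ a b lam) (h, t)).toLinearMap ↔
      s = t ∧ 2 * t ^ 2 - 2 * (h + lam ^ 2 / 2) * t + (a ^ 2 + b ^ 2) = 0 := by
  rw [(hasFDerivAt_surf₁ a b lam h hs).fderiv, (hasFDerivAt_surf₂ a b lam h ht).fderiv,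
    range_tangentMap_eq_iff h₁ h₂, div_left_inj' two_ne_zero]
  refine and_congr_right ?_
  rintro rfl
  constructor <;> intro heq
  · linear_combination -2 * heq
  · linear_combination -heq / 2

lemma surf₁_eq_surf₂ (hs : s ≠ 0)
    (hd : 2 * s ^ 2 - 2 * (h + lam ^ 2 / 2) * s + (a ^ 2 + b ^ 2) = 0) :
    surf₁ a b lam (h, s) = surf₂ a b lam (h, s) := by
  obtain rfl : h = s + (a ^ 2 + b ^ 2) / (2 * s) - lam ^ 2 / 2 := by
    field_simp
    linear_combination -hd
  refine Prod.ext rfl (Prod.ext ?_ ?_) <;>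
  · simp only [surf₁, surf₂]
    field_simp
    ring

lemma mem_regularTangency_iff {P : Val} :
    P ∈ regularTangency a b lam ↔
      ∃ h s : ℝ, s ≠ 0 ∧ surf₂ a b lam (h, s) = P ∧ slope₁ a b lam h s ≠ 0 ∧ slope₂ a b lam s ≠ 0 ∧
        2 * s ^ 2 - 2 * (h + lam ^ 2 / 2) * s + (a ^ 2 + b ^ 2) = 0 := by
  constructor
  · rintro ⟨⟨h, s⟩, ⟨h', t⟩, hs, ht, hP₁, hP₂, hi₁, hi₂, hrange⟩
    obtain rfl : h = h' := congrArg Prod.fst (hP₁.trans hP₂.symm)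
    rw [injective_fderiv_surf₁_iff hs] at hi₁
    rw [injective_fderiv_surf₂_iff ht] at hi₂
    obtain ⟨rfl, hd⟩ := (range_fderiv_eq_iff hs ht hi₁ hi₂).1 hrange
    exact ⟨h, s, hs, hP₂, hi₁, hi₂, hd⟩
  · rintro ⟨h, s, hs, rfl, h₁, h₂, hd⟩
    exact ⟨(h, s), (h, s), hs, hs, surf₁_eq_surf₂ hs hd, rfl, (injective_fderiv_surf₁_iff hs).2 h₁,
      (injective_fderiv_surf₂_iff hs).2 h₂, (range_fderiv_eq_iff hs hs h₁ h₂).2 ⟨rfl, hd⟩⟩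

/-- The curve on `Π₂` on which the quadratic factor of `μ²` vanishes. -/
def discriminantCurve (a b lam : ℝ) : Set Val :=
  {P | ∃ h s : ℝ, s ≠ 0 ∧ surf₂ a b lam (h, s) = P ∧
    2 * s ^ 2 - 2 * (h + lam ^ 2 / 2) * s + (a ^ 2 + b ^ 2) = 0}

lemma regularTangency_subset : regularTangency a b lam ⊆ discriminantCurve a b lam := by
  intro P hP
  obtain ⟨h, s, hs, hP, -, -, hd⟩ := mem_regularTangency_iff.1 hP
  exact ⟨h, s, hs, hP, hd⟩

lemma abs_le_of_mem_discriminant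
    (hd : 2 * s ^ 2 - 2 * (h + lam ^ 2 / 2) * s + (a ^ 2 + b ^ 2) = 0) :
    |s| ≤ |h + lam ^ 2 / 2| := by
  have hsq : (h + lam ^ 2 / 2) ^ 2 - s ^ 2 = (h + lam ^ 2 / 2 - s) ^ 2 + (a ^ 2 + b ^ 2) := by
    linear_combination -hd
  rw [← sq_le_sq, ← sub_nonneg, hsq]
  positivity

lemma isClosed_discriminantCurve (hb : b ≠ 0) : IsClosed (discriminantCurve a b lam) := by
  refine isSeqClosed_iff_isClosed.1 fun P Q hP hPQ => ?_
  choose h s _ hP hd using hP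
  have hh : Tendsto h atTop (𝓝 Q.1) :=
    ((continuous_fst.tendsto Q).comp hPQ).congr fun n => (congrArg Prod.fst (hP n)).symm
  obtain ⟨B, hB⟩ := ((hh.add_const (lam ^ 2 / 2)).abs).bddAbove_range
  have hsB : ∀ n, s n ∈ Metric.closedBall (0 : ℝ) B := fun n => by
    rw [mem_closedBall_zero_iff]
    exact (abs_le_of_mem_discriminant (hd n)).trans (hB ⟨n, rfl⟩)
  obtain ⟨t, -, φ, hφ, ht⟩ := (isCompact_closedBall (0 : ℝ) B).tendsto_subseq hsB
  have hht : Tendsto (fun n => (h (φ n), s (φ n))) atTop (𝓝 (Q.1, t)) :=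
    (hh.comp hφ.tendsto_atTop).prodMk_nhds ht
  have hdt : 2 * t ^ 2 - 2 * (Q.1 + lam ^ 2 / 2) * t + (a ^ 2 + b ^ 2) = 0 := by
    have hcont : Continuous fun y : ℝ × ℝ =>
        2 * y.2 ^ 2 - 2 * (y.1 + lam ^ 2 / 2) * y.2 + (a ^ 2 + b ^ 2) := by fun_prop
    exact tendsto_nhds_unique ((hcont.tendsto (Q.1, t)).comp hht)
      (tendsto_const_nhds.congr fun n => (hd (φ n)).symm)
  have ht₀ : t ≠ 0 := by
    rintro rfl
    have : 0 < a ^ 2 + b ^ 2 := by positivity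
    linarith
  exact ⟨Q.1, t, ht₀, tendsto_nhds_unique
    ((hasFDerivAt_surf₂ a b lam Q.1 ht₀).continuousAt.tendsto.comp hht)
    ((hPQ.comp hφ.tendsto_atTop).congr fun n => (hP (φ n)).symm), hdt⟩

lemma eventually_ne_zero_of_analyticOnNhd {𝕜 E : Type*} [NontriviallyNormedField 𝕜]
    [ConnectedSpace 𝕜] [NormedAddCommGroup E] [NormedSpace 𝕜 E] {f : 𝕜 → E}
    (hf : AnalyticOnNhd 𝕜 f Set.univ) {t : 𝕜} (ht : f t ≠ 0) (s : 𝕜) :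
    ∀ᶠ y in 𝓝[≠] s, f y ≠ 0 := by
  simpa using! mem_codiscreteWithin_iff_forall_mem_nhdsNE.1
    (hf.preimage_zero_mem_codiscrete ht) s (Set.mem_univ s)

/-- The equation `2s² - 2(h + λ²/2)s + p² = 0` solved for `h`. -/
def discriminantEnergy (a b lam s : ℝ) : ℝ := s + (a ^ 2 + b ^ 2) / (2 * s) - lam ^ 2 / 2

lemma eq_discriminantEnergy_iff (hs : s ≠ 0) :
    h = discriminantEnergy a b lam s ↔
      2 * s ^ 2 - 2 * (h + lam ^ 2 / 2) * s + (a ^ 2 + b ^ 2) = 0 := by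
  rw [discriminantEnergy]
  field_simp
  constructor <;> intro heq <;> linear_combination -heq

lemma slope₁_discriminantEnergy (hs : s ≠ 0) :
    slope₁ a b lam (discriminantEnergy a b lam s) s =
      (4 * s ^ 4 + 8 * lam ^ 2 * s ^ 3 - 4 * (a ^ 2 + b ^ 2) * s ^ 2 + 4 * a ^ 2 * b ^ 2) /
        (2 * s ^ 3) := by
  rw [slope₁, discriminantEnergy]
  field_simp
  ring

lemma eventually_slope₁_ne_zero (ha : a ≠ 0) (hb : b ≠ 0) (hs : s ≠ 0) :
    ∀ᶠ t in 𝓝[≠] s, slope₁ a b lam (discriminantEnergy a b lam t) t ≠ 0 := by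
  have hpoly := eventually_ne_zero_of_analyticOnNhd (t := 0)
    (f := fun t => 4 * t ^ 4 + 8 * lam ^ 2 * t ^ 3 - 4 * (a ^ 2 + b ^ 2) * t ^ 2
      + 4 * a ^ 2 * b ^ 2) (fun t _ => by fun_prop) (by simp [ha, hb]) s
  filter_upwards [hpoly, nhdsWithin_le_nhds (isOpen_ne.mem_nhds hs)] with t hpoly ht
  rw [slope₁_discriminantEnergy ht]
  exact div_ne_zero hpoly (mul_ne_zero two_ne_zero (pow_ne_zero 3 ht))

lemma eventually_slope₂_ne_zero (hab : a ^ 2 - b ^ 2 ≠ 0) (hs : s ≠ 0) :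
    ∀ᶠ t in 𝓝[≠] s, slope₂ a b lam t ≠ 0 := by
  have hpoly := eventually_ne_zero_of_analyticOnNhd (t := 0)
    (f := fun t => 8 * lam ^ 2 * t ^ 3 - (a ^ 2 - b ^ 2) ^ 2) (fun t _ => by fun_prop)
    (by simp [hab]) s
  filter_upwards [hpoly, nhdsWithin_le_nhds (isOpen_ne.mem_nhds hs)] with t hpoly ht
  rwa [Ne, slope₂_eq_zero_iff ht]

lemma tangencyCurve_eq (ha : a ≠ 0) (hb : b ≠ 0) (hab : a ^ 2 - b ^ 2 ≠ 0) :
    tangencyCurve a b lam = discriminantCurve a b lam := by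
  refine (closure_minimal regularTangency_subset (isClosed_discriminantCurve hb)).antisymm ?_
  rintro _ ⟨h, s, hs, rfl, hd⟩
  obtain rfl := (eq_discriminantEnergy_iff hs).2 hd
  have hcont : ContinuousAt (fun t => surf₂ a b lam (discriminantEnergy a b lam t, t)) s := by
    have henergy : ContinuousAt (discriminantEnergy a b lam) s := by
      unfold discriminantEnergy
      have : 2 * s ≠ 0 := by positivity
      fun_prop (disch := assumption)
    exact ContinuousAt.comp (f := fun t => (discriminantEnergy a b lam t, t))
      (hasFDerivAt_surf₂ a b lam _ hs).continuousAt (henergy.prodMk continuousAt_id)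
  refine mem_closure_of_tendsto (hcont.tendsto.mono_left nhdsWithin_le_nhds) (b := 𝓝[≠] s) ?_
  filter_upwards [eventually_slope₁_ne_zero ha hb hs, eventually_slope₂_ne_zero hab hs,
    nhdsWithin_le_nhds (isOpen_ne.mem_nhds hs)] with t h₁ h₂ ht
  exact mem_regularTangency_iff.2
    ⟨_, t, ht, rfl, h₁, h₂, (eq_discriminantEnergy_iff ht).1 rfl⟩

end Tangency

/-! ### The cuspidal edge -/

section CuspidalEdge

open Filter

section Diffeomorphism

variable {E F : Type*} [NormedAddCommGroup E] [NormedSpace ℝ E] [NormedAddCommGroup F]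
  [NormedSpace ℝ F]

lemma exists_openPartialHomeomorph_of_injective_fderiv [FiniteDimensional ℝ E] {f : E → E} {q : E}
    {f' : E →L[ℝ] E} (hf : ContDiffAt ℝ ω f q) (hf' : HasFDerivAt f f' q)
    (hinj : Function.Injective f') :
    ∃ Φ : OpenPartialHomeomorph E E, q ∈ Φ.source ∧ (Φ : E → E) = f ∧
      ContDiffOn ℝ ∞ Φ Φ.source ∧ ContDiffOn ℝ ∞ Φ.symm Φ.target := by
  have : CompleteSpace E := FiniteDimensional.complete ℝ E
  let e : E ≃L[ℝ] E := (LinearEquiv.ofInjectiveEndo f'.toLinearMap hinj).toContinuousLinearEquiv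
  have he : HasFDerivAt f (e : E →L[ℝ] E) q := hf'
  let Φ := hf.toOpenPartialHomeomorph f he (by simp)
  have hq : q ∈ Φ.source := hf.mem_toOpenPartialHomeomorph_source he (by simp)
  have hn : (ω : WithTop ℕ∞) ≠ ∞ := by simp
  exact ⟨Φ.restrContDiff ℝ ω hn, ⟨hq, hf, hf.to_localInverse he (by simp)⟩, rfl,
    (Φ.contDiffOn_restrContDiff_source ℝ hn).of_le le_top,
    (Φ.contDiffOn_restrContDiff_target ℝ hn).of_le le_top⟩

lemma fderiv_symm_fderiv (Φ : OpenPartialHomeomorph E F) {q : E} (hq : q ∈ Φ.source)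
    (hΦ : DifferentiableAt ℝ Φ q) (hΦ' : DifferentiableAt ℝ Φ.symm (Φ q)) (v : E) :
    fderiv ℝ Φ.symm (Φ q) (fderiv ℝ Φ q v) = v := by
  have hcomp := hΦ'.hasFDerivAt.comp q hΦ.hasFDerivAt
  have hid : HasFDerivAt (Φ.symm ∘ Φ) (ContinuousLinearMap.id ℝ E) q :=
    (hasFDerivAt_id q).congr_of_eventuallyEq (Φ.eventually_left_inverse hq)
  exact congrArg (fun L => L v) (hcomp.unique hid)

lemma bijective_fderiv (Φ : OpenPartialHomeomorph E F) {q : E} (hq : q ∈ Φ.source)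
    (hΦ : DifferentiableAt ℝ Φ q) (hΦ' : DifferentiableAt ℝ Φ.symm (Φ q)) :
    Function.Bijective (fderiv ℝ Φ q) := by
  have hright : Function.RightInverse (fderiv ℝ Φ.symm (Φ q)) (fderiv ℝ Φ q) := fun w => by
    have hΦq : DifferentiableAt ℝ Φ.symm.symm (Φ.symm (Φ q)) := by
      rwa [OpenPartialHomeomorph.symm_symm, Φ.left_inv hq]
    simpa only [OpenPartialHomeomorph.symm_symm, Φ.left_inv hq] using
      fderiv_symm_fderiv Φ.symm (Φ.map_source hq) hΦ' hΦq w
  have hleft : Function.LeftInverse (fderiv ℝ Φ.symm (Φ q)) (fderiv ℝ Φ q) :=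
    fderiv_symm_fderiv Φ hq hΦ hΦ'
  exact ⟨hleft.injective, hright.surjective⟩

end Diffeomorphism

lemma hasFDerivAt_cuspidalModel :
    HasFDerivAt (fun y : ℝ × ℝ => ((y.1, y.2 ^ 2, y.2 ^ 3) : Val))
      ((ContinuousLinearMap.fst ℝ ℝ ℝ).prod 0) 0 := by
  have hfst : HasFDerivAt (fun q : ℝ × ℝ => q.1) (ContinuousLinearMap.fst ℝ ℝ ℝ) 0 :=
    hasFDerivAt_fst
  have hsnd : HasFDerivAt (fun q : ℝ × ℝ => q.2) (ContinuousLinearMap.snd ℝ ℝ ℝ) 0 :=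
    hasFDerivAt_snd
  refine (hfst.prodMk ((hsnd.pow 2).prodMk (hsnd.pow 3))).congr_fderiv ?_
  ext <;> simp

lemma IsCuspidalEdgeAt.not_injective {f : ℝ × ℝ → Val} {q : ℝ × ℝ} (h : IsCuspidalEdgeAt f q)
    (hf : DifferentiableAt ℝ f q) : ¬ Function.Injective (fderiv ℝ f q) := by
  obtain ⟨Φ, Ψ, hq, hfq, hΦq, hΦ, hΦ', hΨ, hΨ', heq⟩ := h
  have dΦ := (hΦ.contDiffAt (Φ.open_source.mem_nhds hq)).differentiableAt (by simp)
  have dΦ' := (hΦ'.contDiffAt (Φ.open_target.mem_nhds (Φ.map_source hq))).differentiableAt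
    (by simp)
  have dΨ := (hΨ.contDiffAt (Ψ.open_source.mem_nhds hfq)).differentiableAt (by simp)
  have dΨ' := (hΨ'.contDiffAt (Ψ.open_target.mem_nhds (Ψ.map_source hfq))).differentiableAt
    (by simp)
  have hmodel := hasFDerivAt_cuspidalModel
  rw [← hΦq] at hmodel
  have hchain := (hmodel.comp q dΦ.hasFDerivAt).unique
    ((dΨ.hasFDerivAt.comp q hf.hasFDerivAt).congr_of_eventuallyEq (heq.mono fun _ => Eq.symm))
  intro hinj
  have hcomp := (bijective_fderiv Ψ hfq dΨ dΨ').injective.comp hinj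
  rw [← ContinuousLinearMap.coe_comp, ← hchain, ContinuousLinearMap.coe_comp] at hcomp
  have hmodelinj := hcomp.of_comp_right (bijective_fderiv Φ hq dΦ dΦ').surjective
  exact one_ne_zero (congrArg Prod.snd (hmodelinj (a₁ := (0, 1)) (a₂ := 0) (by simp)))

variable {a b lam s₀ s : ℝ}

/-- The sum of the roots `τ, τ, τ⁻²`, `τ = s / s₀`, of a monic cubic with constant term `-1`,
as a function of the point of `Π₂` with parameter `s`. -/
def rootSum (lam s₀ : ℝ) (P : Val) : ℝ := (P.2.1 + 2 * lam ^ 2 * P.1) / (2 * lam ^ 2 * s₀)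

/-- The second elementary symmetric function of the roots `τ, τ, τ⁻²`, see `rootSum`. -/
def rootPairSum (a b lam s₀ : ℝ) (P : Val) : ℝ :=
  ((a ^ 2 + b ^ 2) / 2 * (P.1 + lam ^ 2 / 2) - P.2.2) / (lam ^ 2 * s₀ ^ 2)

/-- Target coordinates straightening the cuspidal edge of `Π₂` at its point with parameters
`(h₀, s₀)`. A translation of the variable turns the cubic with the roots `τ, τ, τ⁻²` into the one
with the roots `v, v, -2v`, which is `T³ - 3v²T + 2v³`; its coefficients provide `v²` and `v³`. -/
def edgeTarget (a b lam h₀ s₀ : ℝ) (P : Val) : Val :=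
  (P.1 - h₀, 1 / 9 * rootSum lam s₀ P ^ 2 - 1 / 3 * rootPairSum a b lam s₀ P,
    1 / 6 * (rootSum lam s₀ P * rootPairSum a b lam s₀ P) - 1 / 27 * rootSum lam s₀ P ^ 3 - 1 / 2)

/-- Source coordinates straightening the cuspidal edge of `Π₂`; the second one is the double root
`v` of `edgeTarget`. -/
def edgeSource (h₀ s₀ : ℝ) (q : ℝ × ℝ) : ℝ × ℝ :=
  (q.1 - h₀, (q.2 / s₀ - s₀ ^ 2 / q.2 ^ 2) / 3)

lemma rootSum_surf₂ (hlam : lam ≠ 0) (hs₀ : s₀ ≠ 0)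
    (hedge : 8 * lam ^ 2 * s₀ ^ 3 = (a ^ 2 - b ^ 2) ^ 2) (h : ℝ) (hs : s ≠ 0) :
    rootSum lam s₀ (surf₂ a b lam (h, s)) = 2 * (s / s₀) + s₀ ^ 2 / s ^ 2 := by
  simp only [rootSum, surf₂, ← hedge]
  field_simp
  ring

lemma rootPairSum_surf₂ (hlam : lam ≠ 0) (hs₀ : s₀ ≠ 0)
    (hedge : 8 * lam ^ 2 * s₀ ^ 3 = (a ^ 2 - b ^ 2) ^ 2) (h : ℝ) (hs : s ≠ 0) :
    rootPairSum a b lam s₀ (surf₂ a b lam (h, s)) = (s / s₀) ^ 2 + 2 * (s₀ / s) := by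
  simp only [rootPairSum, surf₂, ← hedge]
  field_simp
  ring

lemma edgeTarget_surf₂ (hlam : lam ≠ 0) (hs₀ : s₀ ≠ 0)
    (hedge : 8 * lam ^ 2 * s₀ ^ 3 = (a ^ 2 - b ^ 2) ^ 2) (h₀ h : ℝ) (hs : s ≠ 0) :
    edgeTarget a b lam h₀ s₀ (surf₂ a b lam (h, s)) =
      ((edgeSource h₀ s₀ (h, s)).1, (edgeSource h₀ s₀ (h, s)).2 ^ 2,
        (edgeSource h₀ s₀ (h, s)).2 ^ 3) := by
  rw [edgeTarget, rootSum_surf₂ hlam hs₀ hedge h hs, rootPairSum_surf₂ hlam hs₀ hedge h hs,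
    edgeSource]
  refine Prod.ext rfl (Prod.ext ?_ ?_) <;>
  · field_simp
    ring

lemma hasFDerivAt_edgeSource (h₀ : ℝ) (hs₀ : s₀ ≠ 0) :
    HasFDerivAt (edgeSource h₀ s₀)
      ((ContinuousLinearMap.fst ℝ ℝ ℝ).prod ((1 / s₀) • ContinuousLinearMap.snd ℝ ℝ ℝ))
      (h₀, s₀) := by
  have hv : HasDerivAt (fun t => (t / s₀ - s₀ ^ 2 / t ^ 2) / 3) (1 / s₀) s₀ := by
    refine ((((hasDerivAt_id' s₀).div_const s₀).fun_sub ((hasDerivAt_const s₀ (s₀ ^ 2)).fun_div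
      (hasDerivAt_pow 2 s₀) (pow_ne_zero 2 hs₀))).div_const 3).congr_deriv ?_
    field_simp
    ring
  exact (hasFDerivAt_fst.sub_const _).prodMk
    (HasDerivAt.comp_hasFDerivAt (f := fun q : ℝ × ℝ => q.2) (h₀, s₀) hv hasFDerivAt_snd)

lemma contDiffAt_edgeSource (h₀ : ℝ) (hs₀ : s₀ ≠ 0) :
    ContDiffAt ℝ ω (edgeSource h₀ s₀) (h₀, s₀) := by
  have hsq : s₀ ^ 2 ≠ 0 := pow_ne_zero 2 hs₀
  unfold edgeSource
  fun_prop (disch := assumption)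

lemma contDiff_edgeTarget (a b lam h₀ s₀ : ℝ) : ContDiff ℝ ω (edgeTarget a b lam h₀ s₀) := by
  unfold edgeTarget rootSum rootPairSum
  fun_prop

/-- The differential of `rootSum`. -/
def rootSumDeriv (lam s₀ : ℝ) : Val →L[ℝ] ℝ :=
  (1 / (2 * lam ^ 2 * s₀)) • ((ContinuousLinearMap.fst ℝ ℝ ℝ).comp
    (ContinuousLinearMap.snd ℝ ℝ (ℝ × ℝ)) + (2 * lam ^ 2) • ContinuousLinearMap.fst ℝ ℝ (ℝ × ℝ))

/-- The differential of `rootPairSum`. -/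
def rootPairSumDeriv (a b lam s₀ : ℝ) : Val →L[ℝ] ℝ :=
  (1 / (lam ^ 2 * s₀ ^ 2)) • (((a ^ 2 + b ^ 2) / 2) • ContinuousLinearMap.fst ℝ ℝ (ℝ × ℝ)
    - (ContinuousLinearMap.snd ℝ ℝ ℝ).comp (ContinuousLinearMap.snd ℝ ℝ (ℝ × ℝ)))

lemma hasFDerivAt_rootSum (lam s₀ : ℝ) (P : Val) :
    HasFDerivAt (rootSum lam s₀) (rootSumDeriv lam s₀) P := by
  have hlin : rootSum lam s₀ = rootSumDeriv lam s₀ := by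
    funext P
    simp [rootSum, rootSumDeriv, div_eq_inv_mul, mul_add]
  rw [hlin]
  exact (rootSumDeriv lam s₀).hasFDerivAt

lemma hasFDerivAt_rootPairSum (a b lam s₀ : ℝ) (P : Val) :
    HasFDerivAt (rootPairSum a b lam s₀) (rootPairSumDeriv a b lam s₀) P := by
  have haff : rootPairSum a b lam s₀ = fun P => rootPairSumDeriv a b lam s₀ P +
      (a ^ 2 + b ^ 2) / 2 * (lam ^ 2 / 2) / (lam ^ 2 * s₀ ^ 2) := by
    funext P
    simp only [rootPairSum, rootPairSumDeriv, smul_apply, sub_apply,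
      ContinuousLinearMap.comp_apply, ContinuousLinearMap.coe_fst', ContinuousLinearMap.coe_snd',
      smul_eq_mul]
    ring
  rw [haff]
  exact (rootPairSumDeriv a b lam s₀).hasFDerivAt.add_const _

/-- The differential of `edgeTarget` at the points where the three roots of `rootSum` are `1`. -/
def edgeTargetDeriv (a b lam s₀ : ℝ) : Val →L[ℝ] Val :=
  (ContinuousLinearMap.fst ℝ ℝ (ℝ × ℝ)).prod
    (((1 / 3 : ℝ) • ((2 : ℝ) • rootSumDeriv lam s₀ - rootPairSumDeriv a b lam s₀)).prod
      ((1 / 2 : ℝ) • (rootPairSumDeriv a b lam s₀ - rootSumDeriv lam s₀)))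

lemma hasFDerivAt_edgeTarget (h₀ : ℝ) {P : Val} (hX : rootSum lam s₀ P = 3)
    (hY : rootPairSum a b lam s₀ P = 3) :
    HasFDerivAt (edgeTarget a b lam h₀ s₀) (edgeTargetDeriv a b lam s₀) P := by
  have hx := hasFDerivAt_rootSum lam s₀ P
  have hy := hasFDerivAt_rootPairSum a b lam s₀ P
  have hsq := ((hx.pow 2).const_mul (1 / 9)).sub (hy.const_mul (1 / 3))
  have hcube := (((hx.mul hy).const_mul (1 / 6)).sub ((hx.pow 3).const_mul (1 / 27))).sub_const
    (1 / 2)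
  refine ((hasFDerivAt_fst.sub_const h₀).prodMk (hsq.prodMk hcube)).congr_fderiv
    (ContinuousLinearMap.ext fun v => ?_)
  rw [hX, hY]
  simp only [edgeTargetDeriv, ContinuousLinearMap.prod_apply, smul_apply, sub_apply, add_apply,
    smul_eq_mul, Prod.mk.injEq, true_and, nsmul_eq_mul]
  norm_num
  constructor <;> ring

lemma injective_edgeTargetDeriv (hlam : lam ≠ 0) (hs₀ : s₀ ≠ 0) :
    Function.Injective (edgeTargetDeriv a b lam s₀) := by
  refine (injective_iff_map_eq_zero _).2 fun v hv => ?_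
  simp only [edgeTargetDeriv, ContinuousLinearMap.prod_apply, smul_apply, sub_apply,
    ContinuousLinearMap.coe_fst', smul_eq_mul, Prod.mk_eq_zero] at hv
  obtain ⟨hfst, hsq, hcube⟩ := hv
  have hx : rootSumDeriv lam s₀ v = 0 := by linarith
  have hy : rootPairSumDeriv a b lam s₀ v = 0 := by linarith
  simp only [rootSumDeriv, rootPairSumDeriv, smul_apply, sub_apply, add_apply, smul_eq_mul,
    ContinuousLinearMap.comp_apply, ContinuousLinearMap.coe_fst', ContinuousLinearMap.coe_snd',
    hfst, mul_zero, add_zero, zero_sub] at hx hy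
  have hk : v.2.1 = 0 := (mul_eq_zero.1 hx).resolve_left (by positivity)
  have hg : -v.2.2 = 0 := (mul_eq_zero.1 hy).resolve_left (by positivity)
  exact Prod.ext hfst (Prod.ext hk (neg_eq_zero.1 hg))

lemma injective_fderiv_edgeSource (hs₀ : s₀ ≠ 0) :
    Function.Injective
      ((ContinuousLinearMap.fst ℝ ℝ ℝ).prod ((1 / s₀) • ContinuousLinearMap.snd ℝ ℝ ℝ)) := by
  refine (injective_iff_map_eq_zero _).2 fun v hv => ?_
  obtain ⟨hfst, hsnd⟩ : v.1 = 0 ∧ v.2 = 0 := by simpa [hs₀] using hv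
  exact Prod.ext hfst hsnd

lemma isCuspidalEdgeAt_surf₂ (hlam : lam ≠ 0) (hs₀ : s₀ ≠ 0)
    (hedge : 8 * lam ^ 2 * s₀ ^ 3 = (a ^ 2 - b ^ 2) ^ 2) (h₀ : ℝ) :
    IsCuspidalEdgeAt (surf₂ a b lam) (h₀, s₀) := by
  have hX : rootSum lam s₀ (surf₂ a b lam (h₀, s₀)) = 3 := by
    rw [rootSum_surf₂ hlam hs₀ hedge h₀ hs₀]
    field_simp
    norm_num
  have hY : rootPairSum a b lam s₀ (surf₂ a b lam (h₀, s₀)) = 3 := by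
    rw [rootPairSum_surf₂ hlam hs₀ hedge h₀ hs₀]
    field_simp
    norm_num
  obtain ⟨Φ, hΦq, hΦeq, hΦ, hΦ'⟩ := exists_openPartialHomeomorph_of_injective_fderiv
    (contDiffAt_edgeSource h₀ hs₀) (hasFDerivAt_edgeSource h₀ hs₀) (injective_fderiv_edgeSource hs₀)
  obtain ⟨Ψ, hΨq, hΨeq, hΨ, hΨ'⟩ := exists_openPartialHomeomorph_of_injective_fderiv
    (contDiff_edgeTarget a b lam h₀ s₀).contDiffAt (hasFDerivAt_edgeTarget h₀ hX hY)
    (injective_edgeTargetDeriv hlam hs₀)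
  refine ⟨Φ, Ψ, hΦq, hΨq, ?_, hΦ, hΦ', hΨ, hΨ', ?_⟩
  · simp [hΦeq, edgeSource, hs₀]
  · filter_upwards [continuous_snd.continuousAt.eventually_ne hs₀] with y hy
    rw [hΦeq, hΨeq]
    exact edgeTarget_surf₂ hlam hs₀ hedge h₀ y.1 hy

lemma mem_cuspidalEdge₂_iff (hlam : lam ≠ 0) {P : Val} :
    P ∈ cuspidalEdge₂ a b lam ↔ ∃ h s : ℝ, s ≠ 0 ∧ surf₂ a b lam (h, s) = P ∧
      8 * lam ^ 2 * s ^ 3 - (a ^ 2 - b ^ 2) ^ 2 = 0 := by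
  constructor
  · rintro ⟨⟨h, s⟩, hs, rfl, hcusp⟩
    have hinj := hcusp.not_injective (hasFDerivAt_surf₂ a b lam h hs).differentiableAt
    rw [injective_fderiv_surf₂_iff hs, not_not, slope₂_eq_zero_iff hs] at hinj
    exact ⟨h, s, hs, rfl, hinj⟩
  · rintro ⟨h, s, hs, rfl, hedge⟩
    exact ⟨(h, s), hs, rfl, isCuspidalEdgeAt_surf₂ hlam hs (sub_eq_zero.1 hedge) h⟩

end CuspidalEdge

lemma setOf_muSq_eq_zero {a b lam : ℝ} (ha : a ≠ 0) (hb : b ≠ 0) (hab : a ^ 2 - b ^ 2 ≠ 0)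
    (hlam : lam ≠ 0) :
    {P : Val | ∃ h s : ℝ, s ≠ 0 ∧ surf₂ a b lam (h, s) = P ∧ muSq a b lam h s = 0} =
      cuspidalEdge₂ a b lam ∪ tangencyCurve a b lam := by
  ext P
  rw [Set.mem_union, mem_cuspidalEdge₂_iff hlam, tangencyCurve_eq ha hb hab, discriminantCurve,
    Set.mem_ofPred_eq, Set.mem_ofPred_eq]
  simp only [← exists_or, ← and_or_left]
  refine exists_congr fun h => exists_congr fun s => and_congr_right fun hs =>
    and_congr_right fun _ => ?_
  rw [muSq, mul_eq_zero, mul_eq_zero, neg_eq_zero, or_iff_right (one_div_ne_zero hs)]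

end KowalevskiGyrostat

end

open KowalevskiGyrostat in
theorem mainTheorem2_general {a b lam : ℝ} (ha : a ≠ 0) (hb : b ≠ 0) (hab : a ^ 2 ≠ b ^ 2)
    (hlam : lam ≠ 0) :
    (∀ x ∈ subsystem₂ a b lam,
      rankJ a b lam x ≤ 2 ∧
      (∃! s : ℝ, s ≠ 0 ∧ intJ a b lam x = surf₂ a b lam (intH x, s)) ∧
      (rankJ a b lam x = 2 →
        (∀ s : ℝ, s ≠ 0 → intJ a b lam x = surf₂ a b lam (intH x, s) →
          HasExponentSq lam (combo a b lam (coeffL a b lam s)) x (muSq a b lam (intH x) s) ∧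
          (IsCenter a b lam x ↔ muSq a b lam (intH x) s < 0) ∧
          (IsSaddle a b lam x ↔ 0 < muSq a b lam (intH x) s) ∧
          (IsDegenerate a b lam x ↔ muSq a b lam (intH x) s = 0)) ∧
        (IsDegenerate a b lam x ↔
          intJ a b lam x ∈ cuspidalEdge₂ a b lam ∪ tangencyCurve a b lam))) ∧
    {P : Val | ∃ h s : ℝ, s ≠ 0 ∧ surf₂ a b lam (h, s) = P ∧ muSq a b lam h s = 0} =
      cuspidalEdge₂ a b lam ∪ tangencyCurve a b lam := by
  have hr₀ : a ^ 2 - b ^ 2 ≠ 0 := sub_ne_zero.2 hab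
  refine ⟨fun x hx => ?_, setOf_muSq_eq_zero ha hb hr₀ hlam⟩
  obtain ⟨s, h⟩ := exists_isSurfaceParam hlam hx
  have hs : s ≠ 0 := h.ne_zero hr₀
  have hJ : intJ a b lam x = surf₂ a b lam (intH x, s) := h.intJ_eq hs
  have huniq (t : ℝ) (ht : t ≠ 0) (htJ : intJ a b lam x = surf₂ a b lam (intH x, t)) : t = s :=
    (surf₂_injective hlam ht hs (htJ.symm.trans hJ)).2
  refine ⟨rankJ_le_two (coeffL_two_ne_zero a b lam s) (h.criticalAt ha hb),
    ⟨s, ⟨hs, hJ⟩, fun t ht => huniq t ht.1 ht.2⟩, fun hr => ⟨fun t ht htJ => ?_, ?_⟩⟩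
  · obtain rfl := huniq t ht htJ
    exact ⟨h.hasExponentSq ha hb hs hr, h.isCenter_iff ha hb hs hr, h.isSaddle_iff ha hb hs hr,
      h.isDegenerate_iff ha hb hs hr⟩
  · rw [h.isDegenerate_iff ha hb hs hr, ← setOf_muSq_eq_zero ha hb hr₀ hlam]
    constructor
    · exact fun hμ => ⟨intH x, s, hs, hJ.symm, hμ⟩
    · rintro ⟨h', t, ht, htJ, hμ⟩
      obtain ⟨rfl, rfl⟩ := surf₂_injective hlam ht hs (htJ.trans hJ)
      exact hμ

open KowalevskiGyrostat in
theorem mainTheorem2 (a b lam : ℝ) (hb : 0 < b) (hab : b < a) (hlam : lam ≠ 0) :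
    (∀ x ∈ subsystem₂ a b lam,
      rankJ a b lam x ≤ 2 ∧
      (∃! s : ℝ, s ≠ 0 ∧ intJ a b lam x = surf₂ a b lam (intH x, s)) ∧
      (rankJ a b lam x = 2 →
        (∀ s : ℝ, s ≠ 0 → intJ a b lam x = surf₂ a b lam (intH x, s) →
          HasExponentSq lam (combo a b lam (coeffL a b lam s)) x (muSq a b lam (intH x) s) ∧
          (IsCenter a b lam x ↔ muSq a b lam (intH x) s < 0) ∧
          (IsSaddle a b lam x ↔ 0 < muSq a b lam (intH x) s) ∧
          (IsDegenerate a b lam x ↔ muSq a b lam (intH x) s = 0)) ∧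
        (IsDegenerate a b lam x ↔
          intJ a b lam x ∈ cuspidalEdge₂ a b lam ∪ tangencyCurve a b lam))) ∧
    {P : Val | ∃ h s : ℝ, s ≠ 0 ∧ surf₂ a b lam (h, s) = P ∧ muSq a b lam h s = 0} =
      cuspidalEdge₂ a b lam ∪ tangencyCurve a b lam := by
  exact mainTheorem2_general (hb.trans hab).ne' hb.ne'
    (pow_lt_pow_left₀ hab hb.le two_ne_zero).ne' hlam
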